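/- For a Young diagram $\mu$ with $N$ boxes let $d_\mu$ be the number of standard Young tableaux of shape $\mu$ and let $l^{(k)}(\mu)$ be the number of boxes in its $k$-th row ($k\ge 1$). For $n,N\ge 0$ set $$q^{(k)}_{n,N}=\frac1{N!}\sum_{\mu\vdash N,\ l^{(k)}(\mu)\le n} d_\mu^2$$ (the probability that $l^{(k)}\le n$ under Plancherel measure; in particular $q^{(k)}_{n,0}=1$), and for $\lambda\ge 0$ let $$\phi^{(k)}_n(\lambda)=\sum_{N=0}^\infty \frac{e^{-\lambda}\lambda^N}{N!}\,q^{(k)}_{n,N}.$$ Let $\Sigma$ be the unit circle in $\mathbb C$, oriented counterclockwise, let $\varphi(z)=e^{\sqrt\lambda\,(z-z^{-1})}$, and let $\mathcal K_n$ be the integral operator on $L^2(\Sigma,|dw|)$, $$(\mathcal K_nf)(z)=\int_\Sigma \mathcal K_n(z,w)f(w)\,dw,\qquad \mathcal K_n(z,w)=\frac{z^{-n}w^n-\varphi(z)\varphi(w)^{-1}}{2\pi i(z-w)}.$$ Then, for every integer $n\ge 0$ and every real $\lambda\ge 0$, $\mathcal K_n$ is a well-defined trace class operator (so that the Fredholm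 determinants $\det(I-c\,\mathcal K_n)$, $c\in\mathbb C$, exist), and $$\phi^{(1)}_n(\lambda)=2^{-n}\det(I-\mathcal K_n).$$ Moreover $t\mapsto(1+\sqrt t)^{-n}\det(I-\sqrt t\,\mathcal K_n)$ is differentiable at $t=1$, and $$\phi^{(2)}_{n+1}(\lambda)=\phi^{(1)}_n(\lambda)+\Bigl(-\frac{\partial}{\partial t}\Bigr)\Bigr|_{t=1}\Bigl[(1+\sqrt t)^{-n}\det(I-\sqrt t\,\mathcal K_n)\Bigr].$$ -/

import Mathlib

noncomputable section

namespace PlancherelRows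

open MeasureTheory Filter Topology

/-! ### Plancherel measure on Young diagrams -/

/-- A standard Young tableau of shape `μ`: a bijective filling of the boxes of `μ` by `μ.card`
consecutive integers (here `0, …, μ.card - 1`) that increases along every row and every column. -/
structure StandardYoungTableau (μ : YoungDiagram) where
  entry : μ.cells ≃ Fin μ.card
  row_strict : ∀ a b : μ.cells, a.1.1 = b.1.1 → a.1.2 < b.1.2 → entry a < entry b
  col_strict : ∀ a b : μ.cells, a.1.2 = b.1.2 → a.1.1 < b.1.1 → entry a < entry b

/-- `d_μ`, the number of standard Young tableaux of shape `μ`. -/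
def numSYT (μ : YoungDiagram) : ℕ := Nat.card (StandardYoungTableau μ)

theorem finite_youngDiagrams (N : ℕ) : {μ : YoungDiagram | μ.card = N}.Finite := by
  have hfin : ((Finset.range N ×ˢ Finset.range N).powerset : Set (Finset (ℕ × ℕ))).Finite :=
    Finset.finite_toSet _
  refine Set.Finite.of_finite_image (f := YoungDiagram.cells) (hfin.subset ?_) ?_
  · rintro _ ⟨μ, hμ, rfl⟩
    simp only [Set.mem_ofPred_eq] at hμ
    simp only [Finset.coe_powerset, Set.mem_preimage, Set.mem_powerset_iff, Finset.coe_subset]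
    rintro ⟨i, j⟩ hc
    rw [YoungDiagram.mem_cells] at hc
    have hj : j < μ.rowLen i := YoungDiagram.mem_iff_lt_rowLen.1 hc
    have hi : i < μ.colLen j := YoungDiagram.mem_iff_lt_colLen.1 hc
    have h1 : μ.rowLen i ≤ μ.card := by
      rw [YoungDiagram.rowLen_eq_card]; exact Finset.card_le_card (Finset.filter_subset _ _)
    have h2 : μ.colLen j ≤ μ.card := by
      rw [YoungDiagram.colLen_eq_card]; exact Finset.card_le_card (Finset.filter_subset _ _)
    simp only [Finset.mem_product, Finset.mem_range]
    omega
  · intro μ _ ν _ h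
    exact YoungDiagram.ext h

/-- The Young diagrams with `N` boxes. -/
def youngDiagrams (N : ℕ) : Finset YoungDiagram := (finite_youngDiagrams N).toFinset

/-- `q^{(k)}_{n,N}`: the probability under Plancherel measure (weight `d_μ² / N!`) on the Young
diagrams with `N` boxes that the `k`-th row, `k ≥ 1`, has at most `n` boxes. (Mathlib numbers the
rows from `0`.) For `N = 0` only the empty diagram occurs and the value is `1`. -/
def rowProb (k n N : ℕ) : ℝ :=
  (1 / (N.factorial : ℝ)) *
    ∑ μ ∈ (youngDiagrams N).filter (fun μ => μ.rowLen (k - 1) ≤ n), (numSYT μ : ℝ) ^ 2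

/-- `φ^{(k)}_n(lam)`, the Poissonization of `q^{(k)}_{n,N}`. -/
def poissonRow (k n : ℕ) (lam : ℝ) : ℝ :=
  ∑' N : ℕ, Real.exp (-lam) * lam ^ N / (N.factorial : ℝ) * rowProb k n N

/-! ### Trace class operators and Fredholm determinants -/

section Fredholm

variable {H : Type} [NormedAddCommGroup H] [InnerProductSpace ℂ H]

/-- `T` is trace class (nuclear): `T = ∑ ⟨y i, ·⟩ x i` with `∑ ‖x i‖ ‖y i‖ < ∞`. -/
def IsTraceClass (T : H →L[ℂ] H) : Prop :=
  ∃ x y : ℕ → H, Summable (fun i => ‖x i‖ * ‖y i‖) ∧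
    ∀ v : H, HasSum (fun i => inner ℂ (y i) v • x i) (T v)

open Classical in
/-- The determinant of the finite section of `I - T` on the span of `b i`, `i ∈ s`. -/
def sectionDet {ι : Type} (b : HilbertBasis ι ℂ H) (T : H →L[ℂ] H) (s : Finset ι) : ℂ :=
  Matrix.det (1 - Matrix.of fun i j : s => inner ℂ (b i) (T (b j)))

/-- `det (I - T) = d`: in every orthonormal basis the determinants of the finite sections of
`I - T` converge to `d`. For trace class `T` on a Hilbert space there is exactly one such `d`. -/
def HasFredholmDet (T : H →L[ℂ] H) (d : ℂ) : Prop :=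
  ∀ (ι : Type) (b : HilbertBasis ι ℂ H), Tendsto (sectionDet b T) atTop (𝓝 d)

open Classical in
/-- The Fredholm determinant `det (I - T)` (with value `0` if it does not exist). -/
def fredholmDet (T : H →L[ℂ] H) : ℂ :=
  if h : ∃ d, HasFredholmDet T d then h.choose else 0

end Fredholm

/-! ### The integral operator on the unit circle -/

/-- The unit circle, parametrized by the angle modulo `2π`; its volume measure is arc length. -/
abbrev Angle : Type := AddCircle (2 * Real.pi)

instance fact_two_pi_pos : Fact (0 < 2 * Real.pi) := ⟨Real.two_pi_pos⟩

/-- The point `e^{iθ}` of the unit circle. -/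
def pt (θ : Angle) : ℂ := (AddCircle.toCircle θ : ℂ)

/-- `L²` of the unit circle with respect to arc length. -/
abbrev L2Circle : Type := Lp ℂ 2 (volume : Measure Angle)

/-- `φ(z) = exp (√lam (z - 1/z))`. -/
def symbolFn (lam : ℝ) (z : ℂ) : ℂ := Complex.exp ((Real.sqrt lam : ℂ) * (z - z⁻¹))

/-- `K_n(z, w) = (z^{-n} w^n - φ(z) φ(w)^{-1}) / (2πi (z - w))`. The diagonal is a null set, so the
value there plays no role for the integral operator. -/
def kernel (lam : ℝ) (n : ℕ) (z w : ℂ) : ℂ :=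
  (z ^ (-(n : ℤ)) * w ^ n - symbolFn lam z * (symbolFn lam w)⁻¹) /
    (2 * (Real.pi : ℂ) * Complex.I * (z - w))

/-- `K` is the integral operator `(K f)(z) = ∫ k(z, w) f(w) dw` on `L²` of the unit circle, where
`dw` is the complex line element: `w = e^{iθ}`, `dw = i w dθ`. -/
def IsIntegralOperator (k : ℂ → ℂ → ℂ) (K : L2Circle →L[ℂ] L2Circle) : Prop :=
  ∀ f : L2Circle, ∀ᵐ θ : Angle,
    K f θ = ∫ η : Angle, k (pt θ) (pt η) * f η * (Complex.I * pt η)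

end PlancherelRows

end

/-! Write u = √λ and let P be the projection of L² of the circle onto the closed span H of z^j, j ≥
0. Multiplication by e^{uz} and by its inverse preserves H, so φH = e^{-u/z}H, and since |φ| = 1 the
projection Q onto this space is φPφ⁻¹. Reading off Cauchy kernels, K_n = Q − R, where R projects
onto the closed span of z^k, k ≥ −n (`isIntegralOperator_fullDiff`).

Cut both spaces off: Q_M projects onto the span of e^{-u/z}z^j, 0 ≤ j < M, and R_M onto that of z^k,
−n ≤ k < M. A Schur complement gives det(I − c(Q_M − R_M)) = (1+c)^n det((1−c²)T + c²C*C)/det T,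
where T is the Gram matrix of the e^{-u/z}z^j and C contains their inner products with the z^k
(`det_fromBlocks_projections`). With the powers numbered downwards as z^{M−1−y} and v = −u, the
entries of T are ∑_y v^{y−i}v^{y−j}/((y−i)!(y−j)!), and C*C has the same sums restricted to y < M+n.
For c² = t the numerator is therefore the determinant with weight 1−t on y ≥ M+n and 1 elsewhere.

Andréief's identity expands this determinant over sets of M points y_r = μ_r + M − 1 − r, that is,
over diagrams with at most M rows. Since d_μ = N! det(1/(y_r − i)!)
(`numSYT_eq_factorial_mul_invFactDet`), it is the sum of λ^N (d_μ/N!)² (1−t)^{e(μ)}, where e(μ)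
counts the rows r ≥ 0 with μ_r ≥ n+1+r (`weightedDet_eq_tsum`). The denominator is the case t = 0
and tends to e^λ, because ∑ d_μ² = N! (`sum_numSYT_sq`). Hence (1+√t)^{-n} det(I − √t K_n) is the
Poissonized mean of (1−t)^{e(μ)}. At t = 1 this is the probability of e = 0, i.e. of a first row at
most n; minus its derivative there is the probability of e = 1, and e ≤ 1 means that the second row
is at most n+1 (`hasDerivAt_poissonGen`).

The limit M → ∞ needs no trace norm estimate. The Fredholm determinant of ∑ ⟨y_i, ·⟩ x_i is the
signed sum of the principal minors of (⟨y_i, x_j⟩) (`hasFredholmDet_of_nuclear`), and Hadamard's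
inequality bounds a minor by ∏ ‖x_i‖‖y_i‖. The operators Q_M − R_M and K_n have expansions over one
index set with one summable bound, so dominated convergence applies (`tendsto_minorSum_cut`). -/

noncomputable section

namespace PlancherelRows

open MeasureTheory Filter Topology

/-! ### Hadamard's inequality -/

section Hadamard

open scoped ComplexOrder

variable {n : Type*} [Fintype n] [DecidableEq n]
variable {E : Type*} [NormedAddCommGroup E] [InnerProductSpace ℂ E]

/-- The Gram determinant of unit vectors is at most one. -/
theorem norm_det_gram_le_one (v : n → E) (hv : ∀ i, ‖v i‖ = 1) :
    ‖(Matrix.gram ℂ v).det‖ ≤ 1 := by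
  have hpsd := Matrix.posSemidef_gram ℂ v
  have hH := hpsd.isHermitian
  have htr : (∑ i, hH.eigenvalues i : ℝ) = Fintype.card n := by
    have h1 := hH.trace_eq_sum_eigenvalues
    have h2 : (Matrix.gram ℂ v).trace = (Fintype.card n : ℂ) := by
      simp [Matrix.trace, Matrix.gram_apply, inner_self_eq_norm_sq_to_K, hv]
    rw [h2] at h1
    have h3 : ((∑ i, hH.eigenvalues i : ℝ) : ℂ) = ((Fintype.card n : ℝ) : ℂ) := by
      push_cast
      exact h1.symm
    exact Complex.ofReal_injective h3
  rw [hH.det_eq_prod_eigenvalues, norm_prod]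
  -- As `x ≤ exp (x - 1)`, the product of the nonnegative eigenvalues is at most `exp (trace - card
  -- n)`, and the trace is `card n` for unit vectors.
  calc ∏ i, ‖((hH.eigenvalues i : ℝ) : ℂ)‖
      ≤ ∏ i, Real.exp (hH.eigenvalues i - 1) := by
        refine Finset.prod_le_prod (fun _ _ => norm_nonneg _) fun i _ => ?_
        rw [Complex.norm_real, Real.norm_of_nonneg (hpsd.eigenvalues_nonneg i)]
        simpa using Real.add_one_le_exp (hH.eigenvalues i - 1)
    _ = 1 := by
        rw [← Real.exp_sum, Finset.sum_sub_distrib, htr]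
        simp

/-- Hadamard's inequality in an orthonormal basis. -/
theorem norm_det_repr_le (b : OrthonormalBasis n ℂ E) (v : n → E) :
    ‖(Matrix.of fun i j => b.repr (v j) i).det‖ ≤ ∏ i, ‖v i‖ := by
  by_cases h0 : ∃ i, v i = 0
  · obtain ⟨i, hi⟩ := h0
    rw [Matrix.det_eq_zero_of_column_eq_zero i (by intro j; simp [hi]), norm_zero]
    positivity
  push Not at h0
  set w : n → E := fun i => ((‖v i‖⁻¹ : ℝ) : ℂ) • v i with hw
  have hw1 : ∀ i, ‖w i‖ = 1 := fun i => by
    have := norm_ne_zero_iff.2 (h0 i)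
    simp [hw, norm_smul, this]
  have key : ‖(Matrix.of fun i j => b.repr (w j) i).det‖ ≤ 1 := by
    -- The Gram matrix is `B* B` with `B` the coordinate matrix, so its determinant is `|det B|²`.
    have h := norm_det_gram_le_one w hw1
    rw [Matrix.gram_eq_conjTranspose_mul b w, Matrix.det_mul, Matrix.det_conjTranspose, norm_mul,
      norm_star] at h
    nlinarith [norm_nonneg (Matrix.of fun i j => b.repr (w j) i).det]
  have hvw : (Matrix.of fun i j => b.repr (v j) i) =
      Matrix.of fun i j => ((‖v j‖ : ℝ) : ℂ) * (Matrix.of fun i j => b.repr (w j) i) i j := by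
    ext i j
    have : ((‖v j‖ : ℝ) : ℂ) ≠ 0 := by simpa using h0 j
    simp [hw, this]
  rw [hvw, Matrix.det_mul_row, norm_mul, norm_prod]
  simpa using mul_le_of_le_one_right (by positivity) key

/-- Hadamard's inequality for the matrix of inner products of two families. -/
theorem norm_det_inner_le (x y : n → E) :
    ‖(Matrix.of fun i j => inner ℂ (y i) (x j)).det‖ ≤ ∏ i, ‖x i‖ * ‖y i‖ := by
  by_cases hx : LinearIndependent ℂ x
  -- Only the components of the `y i` in the span of the `x j` enter, and projecting does not
  -- increase norms. In an orthonormal basis of the span the matrix is a product of two coordinate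
  -- matrices.
  · let V := Submodule.span ℂ (Set.range x)
    have : FiniteDimensional ℂ V := FiniteDimensional.span_of_finite ℂ (Set.finite_range x)
    have hV : Module.finrank ℂ V = Fintype.card n := finrank_span_eq_card hx
    let b : OrthonormalBasis n ℂ V :=
      (stdOrthonormalBasis ℂ V).reindex ((finCongr hV).trans (Fintype.equivFin n).symm)
    let x' : n → V := fun i => ⟨x i, Submodule.subset_span ⟨i, rfl⟩⟩
    let y' : n → V := fun i => V.orthogonalProjectionOnto (y i)
    have hfac : (Matrix.of fun i j => inner ℂ (y i) (x j)) =
        (Matrix.of fun i j => b.repr (y' j) i).conjTranspose *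
          (Matrix.of fun i j => b.repr (x' j) i) := by
      ext i j
      have h1 : inner ℂ (y i) (x j) = inner ℂ (y' i) (x' j) :=
        (V.inner_orthogonalProjectionOnto_eq_of_mem_right (x' j) (y i)).symm
      rw [Matrix.of_apply, h1, Matrix.mul_apply, ← b.sum_inner_mul_inner]
      simp [b.repr_apply_apply]
    rw [hfac, Matrix.det_mul, Matrix.det_conjTranspose, norm_mul, norm_star,
      Finset.prod_mul_distrib, mul_comm]
    refine mul_le_mul (norm_det_repr_le b x') ((norm_det_repr_le b y').trans ?_) (norm_nonneg _)
      (by positivity)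
    exact Finset.prod_le_prod (fun _ _ => norm_nonneg _)
      fun i _ => V.norm_orthogonalProjectionOnto_apply_le (y i)
  · rw [Fintype.linearIndependent_iff] at hx
    push Not at hx
    obtain ⟨c, hc, i, hi⟩ := hx
    have : (Matrix.of fun i j => inner ℂ (y i) (x j)).det = 0 := by
      refine Matrix.exists_mulVec_eq_zero_iff.1 ⟨c, fun h => hi (by rw [h]; rfl), ?_⟩
      ext k
      have : inner ℂ (y k) (∑ j, c j • x j) = 0 := by rw [hc, inner_zero_right]
      simpa [Matrix.mulVec, dotProduct, inner_sum, inner_smul_right, mul_comm] using this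
    rw [this, norm_zero]
    positivity

end Hadamard

/-! ### Sums of principal minors -/

section MinorSum

open Classical in
/-- The principal minor of an (infinite) matrix on a finite set of indices. -/
def principalMinor {I : Type*} (G : I → I → ℂ) (S : Finset I) : ℂ :=
  (Matrix.of fun i j : S => G i j).det

/-- The signed sum of all principal minors; for a finite matrix this is `det (1 - G)`. -/
def minorSum {I : Type*} (G : I → I → ℂ) : ℂ :=
  ∑' S : Finset I, (-1) ^ S.card * principalMinor G S

theorem principalMinor_congr {I J : Type*} (G : I → I → ℂ) (f : J ↪ I) (S : Finset J) :
    principalMinor (fun i j => G (f i) (f j)) S = principalMinor G (S.map f) := by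
  classical
  let e : S ≃ (S.map f : Finset I) := Equiv.ofBijective
    (fun a => ⟨f a, Finset.mem_map_of_mem f a.2⟩)
    ⟨fun a b h => Subtype.ext (f.injective (Subtype.ext_iff.1 h)), fun ⟨i, hi⟩ => by
      obtain ⟨a, ha, rfl⟩ := Finset.mem_map.1 hi
      exact ⟨⟨a, ha⟩, rfl⟩⟩
  unfold principalMinor
  rw [← Matrix.det_submatrix_equiv_self e]
  congr 1

/-- Multilinearity in the rows: taking the rows in `S` from `-G` and the others from the identity
leaves the minor of `-G` on `S`. -/
theorem det_one_sub_eq_sum {n : Type*} [Fintype n] [DecidableEq n] (G : Matrix n n ℂ) :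
    (1 - G).det = ∑ S : Finset n, (-1) ^ S.card * principalMinor G S := by
  have h := (Matrix.detRowAlternating (n := n) (R := ℂ)).toMultilinearMap.map_add_univ
    (fun i => (-G) i) (fun i => (1 : Matrix n n ℂ) i)
  have h' : (1 - G).det = ∑ S : Finset n,
      (Matrix.of (S.piecewise (-G).row (1 : Matrix n n ℂ).row)).det := by
    rw [sub_eq_neg_add]
    exact h
  rw [h']
  refine Finset.sum_congr rfl fun S _ => ?_
  rw [Matrix.det_piecewise_one_eq_submatrix_det]
  have : ((-G).submatrix (Subtype.val : S → n) (Subtype.val : S → n)) =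
      -(Matrix.of fun i j : S => G i j) := by ext; simp
  rw [this, Matrix.det_neg, Fintype.card_coe]
  unfold principalMinor
  congr!

theorem minorSum_of_fintype {n : Type*} [Fintype n] [DecidableEq n] (G : Matrix n n ℂ) :
    minorSum G = (1 - G).det := by
  rw [det_one_sub_eq_sum]
  exact tsum_fintype _

/-- Turns partial sums of `minorSum` into determinants of finite matrices, to which `det (1 - AB) =
det (1 - BA)` applies. -/
theorem sum_powerset_principalMinor {I : Type*} (G : I → I → ℂ) (J : Finset I) [DecidableEq J] :
    ∑ S ∈ J.powerset, (-1) ^ S.card * principalMinor G S =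
      (1 - Matrix.of fun i j : J => G i j).det := by
  classical
  rw [det_one_sub_eq_sum]
  symm
  refine Finset.sum_bij (fun S _ => S.map (Function.Embedding.subtype _)) ?_ ?_ ?_ ?_
  · intro S _
    rw [Finset.mem_powerset]
    intro i hi
    simp only [Finset.mem_map, Function.Embedding.subtype_apply] at hi
    obtain ⟨a, _, rfl⟩ := hi
    exact a.2
  · intro S _ S' _ h
    exact Finset.map_injective _ h
  · intro S hS
    rw [Finset.mem_powerset] at hS
    refine ⟨S.subtype (· ∈ J), Finset.mem_univ _, ?_⟩
    rw [Finset.subtype_map]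
    exact Finset.filter_true_of_mem fun i hi => hS hi
  · intro S _
    rw [Finset.card_map]
    congr 1
    exact principalMinor_congr G (Function.Embedding.subtype _) S

theorem tendsto_principalMinor {I α : Type*} {l : Filter α} {G : α → I → I → ℂ} {G' : I → I → ℂ}
    (h : ∀ i j, Tendsto (fun a => G a i j) l (𝓝 (G' i j))) (S : Finset I) :
    Tendsto (fun a => principalMinor (G a) S) l (𝓝 (principalMinor G' S)) := by
  classical
  have : Continuous fun M : Matrix S S ℂ => M.det := continuous_id.matrix_det
  refine (this.tendsto _).comp ?_
  refine tendsto_pi_nhds.2 fun i => tendsto_pi_nhds.2 fun j => h i j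

/-- Dominated convergence for sums of principal minors. -/
theorem tendsto_minorSum {I α : Type*} {l : Filter α} {G : α → I → I → ℂ} {G' : I → I → ℂ}
    {w : I → ℝ} (hw : Summable w) (hw0 : 0 ≤ w)
    (hb : ∀ a S, ‖principalMinor (G a) S‖ ≤ ∏ i ∈ S, w i)
    (h : ∀ i j, Tendsto (fun a => G a i j) l (𝓝 (G' i j))) :
    Tendsto (fun a => minorSum (G a)) l (𝓝 (minorSum G')) := by
  -- The products of `w` over finite sets are summable (they are the terms of the expanded `∏ (1 + w
  -- i)`), and each minor is continuous in finitely many entries.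
  refine tendsto_tsum_of_dominated_convergence
    (summable_finsetProd_of_summable_nonneg (f := w) hw0 hw)
    (fun S => (tendsto_principalMinor h S).const_mul _) (Eventually.of_forall fun a S => ?_)
  rw [norm_mul, norm_pow, norm_neg, norm_one, one_pow, one_mul]
  exact hb a S

/-- Hadamard's inequality in the form that supplies the domination for `tendsto_minorSum`. -/
theorem norm_principalMinor_inner_le {I E : Type*} [NormedAddCommGroup E] [InnerProductSpace ℂ E]
    (x y : I → E) (S : Finset I) :
    ‖principalMinor (fun i j => inner ℂ (y i) (x j)) S‖ ≤ ∏ i ∈ S, ‖x i‖ * ‖y i‖ := by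
  classical
  rw [← Finset.prod_coe_sort]
  unfold principalMinor
  convert norm_det_inner_le (fun i : S => x i) (fun i : S => y i)

end MinorSum

/-! ### Fredholm determinants of nuclear operators -/

section Nuclear

variable {H : Type} [NormedAddCommGroup H] [InnerProductSpace ℂ H]

/-- The truncation of a vector to finitely many coordinates has at most its norm. -/
theorem norm_coordinates_le {ι : Type*} (b : HilbertBasis ι ℂ H) (s : Finset ι) (v : H) :
    ‖WithLp.toLp 2 (fun k : s => inner ℂ (b k) v)‖ ≤ ‖v‖ := by
  rw [← sq_le_sq₀ (norm_nonneg _) (norm_nonneg _), EuclideanSpace.norm_sq_eq]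
  simp only
  rw [Finset.sum_coe_sort s fun k => ‖inner ℂ (b k) v‖ ^ 2]
  exact b.orthonormal.sum_inner_products_le v

/-- For finitely many rank one terms this is `det (1 - AB) = det (1 - BA)`, the two factors pairing
the `x i` and the `y i` with the basis vectors of the section. The general case is a limit over
finite sets `J` of terms: the minors are absolutely summable by Hadamard and Bessel, and the matrix
of the section converges entrywise. -/
theorem sectionDet_eq_minorSum {ι I : Type} (b : HilbertBasis ι ℂ H) {T : H →L[ℂ] H}
    {x y : I → H} (hs : Summable fun i => ‖x i‖ * ‖y i‖)
    (hT : ∀ v, HasSum (fun i => inner ℂ (y i) v • x i) (T v)) (s : Finset ι) :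
    sectionDet b T s = minorSum fun i j => ∑ k ∈ s, inner ℂ (y i) (b k) * inner ℂ (b k) (x j) := by
  classical
  set X : I → EuclideanSpace ℂ s := fun i => WithLp.toLp 2 fun k : s => inner ℂ (b k) (x i)
  set Y : I → EuclideanSpace ℂ s := fun i => WithLp.toLp 2 fun k : s => inner ℂ (b k) (y i)
  have hG : (fun i j => ∑ k ∈ s, inner ℂ (y i) (b k) * inner ℂ (b k) (x j)) =
      fun i j => inner ℂ (Y i) (X j) := by
    ext i j
    rw [PiLp.inner_apply, ← Finset.sum_coe_sort]
    refine Finset.sum_congr rfl fun k _ => ?_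
    simp [X, Y, mul_comm]
  have hb : ∀ S : Finset I, ‖(-1) ^ S.card * principalMinor (fun i j => inner ℂ (Y i) (X j)) S‖ ≤
      ∏ i ∈ S, ‖x i‖ * ‖y i‖ := fun S => by
    rw [norm_mul, norm_pow, norm_neg, norm_one, one_pow, one_mul]
    refine (norm_principalMinor_inner_le X Y S).trans ?_
    refine Finset.prod_le_prod (fun _ _ => by positivity) fun i _ => ?_
    exact mul_le_mul (norm_coordinates_le b s _) (norm_coordinates_le b s _) (norm_nonneg _)
      (norm_nonneg _)
  have hsum : Summable fun S : Finset I =>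
      (-1) ^ S.card * principalMinor (fun i j => inner ℂ (Y i) (X j)) S :=
    Summable.of_norm_bounded (summable_finsetProd_of_summable_nonneg
      (f := fun i => ‖x i‖ * ‖y i‖) (fun i => by positivity) hs) hb
  rw [hG]
  have h1 : Tendsto (fun J : Finset I => ∑ S ∈ J.powerset,
      (-1) ^ S.card * principalMinor (fun i j => inner ℂ (Y i) (X j)) S) atTop
      (𝓝 (minorSum fun i j => inner ℂ (Y i) (X j))) :=
    hsum.hasSum.comp tendsto_finset_powerset_atTop_atTop
  refine tendsto_nhds_unique ?_ h1
  have h2 : ∀ J : Finset I, ∑ S ∈ J.powerset,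
      (-1) ^ S.card * principalMinor (fun i j => inner ℂ (Y i) (X j)) S =
      (1 - Matrix.of fun k l : s => ∑ i ∈ J, inner ℂ (y i) (b l) * inner ℂ (b k) (x i)).det := by
    intro J
    rw [sum_powerset_principalMinor]
    have e1 : (Matrix.of fun i j : J => inner ℂ (Y i) (X j)) =
        (Matrix.of fun (i : J) (k : s) => inner ℂ (y i) (b k)) *
          (Matrix.of fun (k : s) (i : J) => inner ℂ (b k) (x i)) := by
      ext i j
      rw [Matrix.mul_apply, Matrix.of_apply, PiLp.inner_apply]
      refine Finset.sum_congr rfl fun k _ => ?_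
      simp [X, Y, mul_comm]
    rw [e1, Matrix.det_one_sub_mul_comm]
    congr 2
    ext k l
    rw [Matrix.mul_apply, Matrix.of_apply]
    simp only [Matrix.of_apply]
    rw [← Finset.sum_coe_sort J fun i => inner ℂ (y i) (b l) * inner ℂ (b k) (x i)]
    exact Finset.sum_congr rfl fun i _ => mul_comm _ _
  simp_rw [h2]
  have hc : Continuous fun M : Matrix s s ℂ => (1 - M).det :=
    (continuous_const.sub continuous_id).matrix_det
  have hm : Tendsto (fun J : Finset I =>
      (Matrix.of fun k l : s => ∑ i ∈ J, inner ℂ (y i) (b l) * inner ℂ (b k) (x i))) atTop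
      (𝓝 (Matrix.of fun k l : s => inner ℂ (b k) (T (b l)))) := by
    refine tendsto_pi_nhds.2 fun k => tendsto_pi_nhds.2 fun l => ?_
    have := (hT (b l)).mapL (innerSL ℂ (b k))
    simpa [HasSum, inner_smul_right] using this
  have hlim := (hc.tendsto _).comp hm
  have hsec : sectionDet b T s =
      (1 - Matrix.of fun k l : s => inner ℂ (b k) (T (b l))).det := by
    unfold sectionDet
    congr!
  rw [hsec]
  exact hlim

/-- A nuclear operator has a Fredholm determinant, the signed sum of the principal minors of the
matrix of inner products of the vectors in a nuclear representation. -/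
theorem hasFredholmDet_of_nuclear {I : Type} {T : H →L[ℂ] H}
    {x y : I → H} (hs : Summable fun i => ‖x i‖ * ‖y i‖)
    (hT : ∀ v, HasSum (fun i => inner ℂ (y i) v • x i) (T v)) :
    HasFredholmDet T (minorSum fun i j => inner ℂ (y i) (x j)) := by
  classical
  intro ι b
  rw [funext (sectionDet_eq_minorSum b hs hT)]
  -- Parseval's identity gives the limit of each entry as `s` grows; by Bessel the truncated vectors
  -- obey the same norm bound for every `s`.
  refine tendsto_minorSum hs (fun i => by positivity) (fun s S => ?_)
    fun i j => b.hasSum_inner_mul_inner (y i) (x j)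
  have hG : (fun i j => ∑ k ∈ s, inner ℂ (y i) (b k) * inner ℂ (b k) (x j)) =
      fun i j => inner ℂ (WithLp.toLp 2 fun k : s => inner ℂ (b k) (y i))
        (WithLp.toLp 2 fun k : s => inner ℂ (b k) (x j)) := by
    ext i j
    rw [PiLp.inner_apply, ← Finset.sum_coe_sort]
    refine Finset.sum_congr rfl fun k _ => ?_
    simp [mul_comm]
  rw [hG]
  refine (norm_principalMinor_inner_le _ _ S).trans ?_
  refine Finset.prod_le_prod (fun _ _ => by positivity) fun i _ => ?_
  exact mul_le_mul (norm_coordinates_le b s _) (norm_coordinates_le b s _) (norm_nonneg _)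
    (norm_nonneg _)

/-- A Hilbert basis has to be supplied: if none existed, `HasFredholmDet` would hold vacuously for
every value. -/
theorem HasFredholmDet.unique {ι : Type} (b : HilbertBasis ι ℂ H) {T : H →L[ℂ] H} {d d' : ℂ}
    (h : HasFredholmDet T d) (h' : HasFredholmDet T d') : d = d' :=
  tendsto_nhds_unique (h ι b) (h' ι b)

theorem HasFredholmDet.fredholmDet_eq {ι : Type} (b : HilbertBasis ι ℂ H) {T : H →L[ℂ] H} {d : ℂ}
    (h : HasFredholmDet T d) : fredholmDet T = d := by
  have hex : ∃ d, HasFredholmDet T d := ⟨d, h⟩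
  rw [fredholmDet, dif_pos hex]
  exact hex.choose_spec.unique b h

theorem HasFredholmDet.fredholmDet {T : H →L[ℂ] H} {d : ℂ}
    (h : HasFredholmDet T d) : HasFredholmDet T (fredholmDet T) := by
  have hex : ∃ d, HasFredholmDet T d := ⟨d, h⟩
  rw [PlancherelRows.fredholmDet, dif_pos hex]
  exact hex.choose_spec

theorem isTraceClass_of_nuclear {I : Type} [Countable I] {T : H →L[ℂ] H}
    {x y : I → H} (hs : Summable fun i => ‖x i‖ * ‖y i‖)
    (hT : ∀ v, HasSum (fun i => inner ℂ (y i) v • x i) (T v)) : IsTraceClass T := by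
  obtain ⟨f, hf⟩ := Countable.exists_injective_nat I
  refine ⟨Function.extend f x 0, Function.extend f y 0, ?_, fun v => ?_⟩
  · rw [← hf.summable_iff]
    · simpa [Function.comp_def, hf.extend_apply] using hs
    · intro k hk
      rw [Function.extend_apply' _ _ _ (by simpa using hk)]
      simp
  · rw [← hf.hasSum_iff]
    · simpa [Function.comp_def, hf.extend_apply] using hT v
    · intro k hk
      rw [Function.extend_apply' _ _ _ (by simpa using hk)]
      simp

/-- A nuclear expansion that holds on a Hilbert basis holds everywhere. -/
theorem hasSum_nuclear_of_basis {ι I : Type*} [CompleteSpace H] (b : HilbertBasis ι ℂ H)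
    {T : H →L[ℂ] H} {x y : I → H} (hs : Summable fun i => ‖x i‖ * ‖y i‖)
    (hT : ∀ k, HasSum (fun i => inner ℂ (y i) (b k) • x i) (T (b k))) (v : H) :
    HasSum (fun i => inner ℂ (y i) v • x i) (T v) := by
  -- The expansion converges absolutely in operator norm; its sum agrees with `T` on the span of the
  -- basis, which is dense.
  have hsum : Summable fun i => InnerProductSpace.rankOne ℂ (x i) (y i) := by
    refine Summable.of_norm ?_
    simpa using hs
  have happ : ∀ v, HasSum (fun i => inner ℂ (y i) v • x i)
      ((∑' i, InnerProductSpace.rankOne ℂ (x i) (y i)) v) := fun v => by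
    have := hsum.hasSum.mapL (ContinuousLinearMap.apply ℂ H v)
    simpa using this
  have hTT : T = ∑' i, InnerProductSpace.rankOne ℂ (x i) (y i) := by
    refine ContinuousLinearMap.ext_on
      (Submodule.dense_iff_topologicalClosure_eq_top.2 b.dense_span) ?_
    rintro _ ⟨k, rfl⟩
    exact (hT k).unique (happ (b k))
  rw [hTT]
  exact happ v

end Nuclear

end PlancherelRows

end

noncomputable section

namespace PlancherelRows

open MeasureTheory Filter Topology

/-! ### Determinants of inverse factorials -/

section RowUpdates

variable {n : Type*} [Fintype n] [DecidableEq n] (A : Matrix n n ℝ)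

theorem det_updateRow_eq_sum (r : n) (b : n → ℝ) :
    (A.updateRow r b).det = ∑ i, A.adjugate i r * b i := by
  rw [← Matrix.cramer_transpose_apply, Matrix.cramer_eq_adjugate_mulVec,
    ← Matrix.adjugate_transpose]
  rfl

theorem det_updateCol_eq_sum (i : n) (b : n → ℝ) :
    (A.updateCol i b).det = ∑ r, A.adjugate i r * b r := by
  rw [← Matrix.cramer_apply, Matrix.cramer_eq_adjugate_mulVec]
  rfl

/-- Both sides are `trace (adj A * B)`, the derivative of the determinant at `A` in the direction
`B`. -/
theorem sum_det_updateRow_eq_sum_det_updateCol (B : n → n → ℝ) :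
    ∑ r, (A.updateRow r (B r)).det = ∑ i, (A.updateCol i fun r => B r i).det := by
  simp_rw [det_updateRow_eq_sum, det_updateCol_eq_sum]
  exact Finset.sum_comm

/-- The derivative of the determinant along `diag(a) A - A diag(b)`: scaling rows contributes `∑ a`,
scaling columns `∑ b`. -/
theorem sum_det_updateRow_weights (a b : n → ℝ) :
    ∑ r, (A.updateRow r fun i => (a r - b i) * A r i).det = (∑ r, a r - ∑ i, b i) * A.det := by
  have h1 : ∀ r, ∑ i, A r i * A.adjugate i r = A.det := fun r => by
    have := congrFun (congrFun (Matrix.mul_adjugate A) r) r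
    simpa [Matrix.mul_apply] using this
  have h2 : ∀ i, ∑ r, A.adjugate i r * A r i = A.det := fun i => by
    have := congrFun (congrFun (Matrix.adjugate_mul A) i) i
    simpa [Matrix.mul_apply] using this
  simp_rw [det_updateRow_eq_sum]
  calc ∑ r, ∑ i, A.adjugate i r * ((a r - b i) * A r i)
      = ∑ r, a r * ∑ i, A r i * A.adjugate i r - ∑ i, b i * ∑ r, A.adjugate i r * A r i := by
        simp_rw [Finset.mul_sum]
        rw [Finset.sum_comm (f := fun i r => b i * (A.adjugate i r * A r i)),
          ← Finset.sum_sub_distrib]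
        refine Finset.sum_congr rfl fun r _ => ?_
        rw [← Finset.sum_sub_distrib]
        exact Finset.sum_congr rfl fun i _ => by ring
    _ = _ := by simp_rw [h1, h2, ← Finset.sum_mul]; ring

end RowUpdates

/-- `1 / (y - i)!`, which is zero for `y < i`. -/
def invFact (y i : ℕ) : ℝ := if i ≤ y then 1 / ((y - i).factorial : ℝ) else 0

theorem invFact_succ_succ (y i : ℕ) : invFact (y + 1) (i + 1) = invFact y i := by
  simp [invFact]

theorem invFact_zero_left (i : ℕ) : invFact 0 i = if i = 0 then 1 else 0 := by
  by_cases h : i = 0 <;> simp [invFact, h]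

/-- No condition relating `y` and `i` is needed, as both sides vanish for `y ≤ i`. Multiplying by `y
- i` thus amounts to lowering `y`. -/
theorem sub_mul_invFact (y i : ℕ) : ((y : ℝ) - i) * invFact y i = invFact y (i + 1) := by
  unfold invFact
  rcases lt_trichotomy y i with h | h | h
  · rw [if_neg (by omega), if_neg (by omega), mul_zero]
  · subst h; simp
  · obtain ⟨k, rfl⟩ : ∃ k, y = i + k + 1 := ⟨y - i - 1, by omega⟩
    rw [if_pos (by omega), if_pos (by omega), show i + k + 1 - i = k + 1 by omega,
      show i + k + 1 - (i + 1) = k by omega, Nat.factorial_succ]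
    push_cast
    have : ((k : ℝ) + 1) ≠ 0 := by positivity
    field_simp
    ring

/-- `det (1 / (z r - i)!)`. -/
def invFactDet {M : ℕ} (z : Fin M → ℕ) : ℝ :=
  (Matrix.of fun r i : Fin M => invFact (z r) i).det

/-- The sum `0 + 1 + ⋯ + (M - 1)`, the least sum of `M` distinct natural numbers. -/
def staircase (M : ℕ) : ℕ := ∑ i : Fin M, (i : ℕ)

/-! ### Raising and lowering identities for the determinants -/

variable {M : ℕ}

theorem invFactDet_comp_perm (z : Fin M → ℕ) (σ : Equiv.Perm (Fin M)) :
    invFactDet (z ∘ σ) = (Equiv.Perm.sign σ : ℤ) * invFactDet z := by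
  have := Matrix.det_permute σ (Matrix.of fun r i : Fin M => invFact (z r) i)
  exact this

theorem invFactDet_comp_perm_sq (z : Fin M → ℕ) (σ : Equiv.Perm (Fin M)) :
    invFactDet (z ∘ σ) ^ 2 = invFactDet z ^ 2 := by
  rw [invFactDet_comp_perm, mul_pow]
  rcases Int.units_eq_one_or (Equiv.Perm.sign σ) with h | h <;> simp [h]

theorem injective_of_invFactDet_ne_zero {z : Fin M → ℕ} (h : invFactDet z ≠ 0) :
    Function.Injective z := by
  intro a b hab
  by_contra hne
  exact h (Matrix.det_zero_of_row_eq hne (by ext i; simp [hab]))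

theorem invFactDet_update (z : Fin M → ℕ) (r : Fin M) (k : ℕ) :
    invFactDet (Function.update z r k) =
      ((Matrix.of fun r i : Fin M => invFact (z r) i).updateRow r fun i => invFact k i).det := by
  unfold invFactDet
  congr 1
  ext a i
  by_cases h : a = r
  · subst h; simp
  · simp [h]

/-- Lowering one of the arguments in all possible ways. -/
theorem sum_invFactDet_lower (z : Fin M → ℕ) :
    ∑ r, (if z r = 0 then 0 else invFactDet (Function.update z r (z r - 1))) =
      ((∑ r, z r : ℕ) - (staircase M : ℝ)) * invFactDet z := by
  have h := sum_det_updateRow_weights (Matrix.of fun r i : Fin M => invFact (z r) i)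
    (fun r => (z r : ℝ)) (fun i => ((i : ℕ) : ℝ))
  unfold staircase
  push_cast
  unfold invFactDet at *
  rw [← h]
  refine Finset.sum_congr rfl fun r _ => ?_
  simp only [Matrix.of_apply, sub_mul_invFact]
  -- For `z r = 0` the weighted row `invFact 0 (i + 1)` is zero, in agreement with the convention on
  -- the left. Otherwise raising `i` is the same as lowering `z r`.
  split_ifs with h0
  · symm
    refine Matrix.det_eq_zero_of_row_eq_zero r fun i => ?_
    simp [h0, invFact]
  · have := invFactDet_update z r (z r - 1)
    unfold invFactDet at this
    rw [this]
    congr 2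
    ext i
    rw [← invFact_succ_succ, Nat.sub_add_cancel (by omega)]

/-- A nonzero determinant has distinct arguments, and `M` distinct natural numbers add up to at
least `0 + ⋯ + (M - 1)`. -/
theorem invFactDet_eq_zero_of_sum_lt (z : Fin M → ℕ) (h : ∑ r, z r < staircase M) :
    invFactDet z = 0 := by
  by_contra hne
  have hinj := injective_of_invFactDet_ne_zero hne
  have h1 := Finset.sum_range_le_sum
    (s := Finset.univ.map ((⟨z, hinj⟩ : Fin M ↪ ℕ).trans Nat.castEmbedding)) (c := 0)
    (by intro x hx; simp at hx; obtain ⟨a, rfl⟩ := hx; positivity)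
  rw [Finset.card_map, Finset.card_univ, Fintype.card_fin, Finset.sum_map] at h1
  simp only [zero_add, Function.Embedding.trans_apply, Function.Embedding.coeFn_mk,
    Nat.castEmbedding_apply] at h1
  unfold staircase at h
  rw [Fin.sum_univ_eq_sum_range (fun i => i)] at h
  zify at h
  omega

/-- Distinct positive numbers add up to at least `1 + ⋯ + M`. In degrees `N < M` this provides the
zero argument required by `sum_invFactDet_raise`. -/
theorem exists_eq_zero_of_sum_lt {z : Fin M → ℕ} (hz : Function.Injective z)
    (h : ∑ r, z r < staircase M + M) : ∃ r, z r = 0 := by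
  by_contra! hne
  have h1 := Finset.sum_range_le_sum
    (s := Finset.univ.map ((⟨z, hz⟩ : Fin M ↪ ℕ).trans Nat.castEmbedding)) (c := 1)
    (by intro x hx; simp at hx; obtain ⟨a, rfl⟩ := hx; have := hne a; omega)
  rw [Finset.card_map, Finset.card_univ, Fintype.card_fin, Finset.sum_map] at h1
  simp only [Function.Embedding.trans_apply, Function.Embedding.coeFn_mk,
    Nat.castEmbedding_apply, Finset.sum_add_distrib] at h1
  unfold staircase at h
  rw [Fin.sum_univ_eq_sum_range (fun i => i)] at h
  zify at h
  simp at h1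
  omega

/-- Raising one of the arguments in all possible ways. -/
theorem sum_invFactDet_raise (z : Fin M → ℕ) (r₀ : Fin M) (h₀ : z r₀ = 0) :
    ∑ r, invFactDet (Function.update z r (z r + 1)) = invFactDet z := by
  obtain ⟨m, rfl⟩ : ∃ m, M = m + 1 := ⟨M - 1, by have := r₀.2; omega⟩
  set A : Matrix (Fin (m + 1)) (Fin (m + 1)) ℝ := Matrix.of fun r i => invFact (z r) i with hA
  simp_rw [invFactDet_update]
  rw [sum_det_updateRow_eq_sum_det_updateCol A fun r i => invFact (z r + 1) i, Fin.sum_univ_succ]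
  -- Column `i + 1` at raised arguments equals column `i` at the original ones, so only the
  -- replacement of column `0` contributes.
  have hz : ∑ i : Fin m, (A.updateCol i.succ fun r => invFact (z r + 1) i.succ).det = 0 := by
    refine Finset.sum_eq_zero fun i _ => ?_
    refine Matrix.det_zero_of_column_eq (i := i.castSucc) (j := i.succ)
      (Fin.castSucc_lt_succ).ne fun r => ?_
    rw [Matrix.updateCol_self, Matrix.updateCol_ne (Fin.castSucc_lt_succ).ne]
    simp [hA, invFact_succ_succ]
  rw [hz, add_zero]
  have hsplit : (fun r => invFact (z r + 1) (0 : Fin (m + 1))) =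
      (fun r => A r 0) + fun r => invFact (z r + 1) (0 : Fin (m + 1)) - A r 0 := by
    ext r; simp
  rw [hsplit, Matrix.det_updateCol_add, Matrix.updateCol_eq_self]
  -- Row `r₀` of `A` is `(1, 0, …, 0)` because `z r₀ = 0`, and its entry in the new column is `1 /
  -- 1! - 1 / 0! = 0`.
  have : (A.updateCol 0 fun r => invFact (z r + 1) (0 : Fin (m + 1)) - A r 0).det = 0 := by
    refine Matrix.det_eq_zero_of_row_eq_zero r₀ fun i => ?_
    by_cases hi : i = 0
    · subst hi
      simp [hA, h₀, invFact]
    · rw [Matrix.updateCol_ne hi]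
      simp [hA, h₀, invFact_zero_left, hi]
  rw [this, add_zero]
  rfl

/-- The sum of the squares of the determinants of inverse factorials in degree `N`. -/
def sqSum (M N : ℕ) : ℝ :=
  ∑ z ∈ Finset.piAntidiag (Finset.univ : Finset (Fin M)) (N + staircase M), invFactDet z ^ 2

/-- Raising and lowering are adjoint to each other: the left side pairs each sequence with its
lowerings, the right side with its raisings. The condition `N < M` forces a zero argument wherever
the determinant is nonzero. -/
theorem sqSum_succ {N : ℕ} (hN : N < M) : ((N : ℝ) + 1) * sqSum M (N + 1) = sqSum M N := by
  have h1 : ((N : ℝ) + 1) * sqSum M (N + 1) =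
      ∑ z ∈ Finset.piAntidiag (Finset.univ : Finset (Fin M)) (N + 1 + staircase M), ∑ r,
        if z r = 0 then 0 else invFactDet z * invFactDet (Function.update z r (z r - 1)) := by
    unfold sqSum
    rw [Finset.mul_sum]
    refine Finset.sum_congr rfl fun z hz => ?_
    have hs : ∑ r, z r = N + 1 + staircase M := by simpa using hz
    have := sum_invFactDet_lower z
    rw [hs] at this
    push_cast at this
    have h2 : ∑ r, (if z r = 0 then 0 else
        invFactDet z * invFactDet (Function.update z r (z r - 1)))
        = invFactDet z *
          ∑ r, (if z r = 0 then 0 else invFactDet (Function.update z r (z r - 1))) := by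
      rw [Finset.mul_sum]
      exact Finset.sum_congr rfl fun r _ => by split_ifs <;> simp
    rw [h2, this]
    ring
  have h3 : sqSum M N =
      ∑ z ∈ Finset.piAntidiag (Finset.univ : Finset (Fin M)) (N + staircase M), ∑ r,
        invFactDet z * invFactDet (Function.update z r (z r + 1)) := by
    unfold sqSum
    refine Finset.sum_congr rfl fun z hz => ?_
    have hs : ∑ r, z r = N + staircase M := by simpa using hz
    rw [← Finset.mul_sum]
    by_cases h0 : invFactDet z = 0
    · simp [h0]
    obtain ⟨r, hr⟩ := exists_eq_zero_of_sum_lt (injective_of_invFactDet_ne_zero h0)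
      (by rw [hs]; omega)
    rw [sum_invFactDet_raise z r hr, sq]
  rw [h1, h3, Finset.sum_comm, Finset.sum_comm (s := Finset.piAntidiag _ (N + staircase M))]
  refine Finset.sum_congr rfl fun r _ => ?_
  -- Discarding zero terms makes lowering and raising of coordinate `r` inverse bijections, since a
  -- nonzero term on the lowering side has `z r ≠ 0`.
  rw [← Finset.sum_filter_ne_zero (s := Finset.piAntidiag _ (N + 1 + staircase M))]
  have hupd : ∀ (z : Fin M → ℕ) (k : ℕ),
      Finset.univ.sum (Function.update z r k) + z r = Finset.univ.sum z + k := fun z k => by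
    rw [Finset.sum_update_of_mem (Finset.mem_univ r),
      ← Finset.add_sum_erase _ _ (Finset.mem_univ r), Finset.sdiff_singleton_eq_erase]
    ring
  symm
  rw [← Finset.sum_filter_ne_zero (s := Finset.piAntidiag _ (N + staircase M))]
  refine Finset.sum_bij' (fun z _ => Function.update z r (z r + 1))
    (fun z _ => Function.update z r (z r - 1)) ?_ ?_ ?_ ?_ ?_
  · intro z hz
    simp only [Finset.mem_filter, Finset.mem_piAntidiag, Finset.mem_univ, implies_true,
      and_true] at hz ⊢
    refine ⟨by have := hupd z (z r + 1); omega, ?_⟩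
    simpa [mul_comm] using hz.2
  · intro z hz
    simp only [Finset.mem_filter, Finset.mem_piAntidiag, Finset.mem_univ, implies_true,
      and_true] at hz ⊢
    have h0 : z r ≠ 0 := fun h => hz.2 (by simp [h])
    have h1 : z r - 1 + 1 = z r := by omega
    refine ⟨by have := hupd z (z r - 1); omega, ?_⟩
    have h2 := hz.2
    rw [if_neg h0] at h2
    simpa [mul_comm, h1] using h2
  · intro z _
    simp
  · intro z hz
    simp only [Finset.mem_filter] at hz
    have h0 : z r ≠ 0 := fun h => hz.2 (by simp [h])
    have h1 : z r - 1 + 1 = z r := by omega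
    simp [h1]
  · intro z _
    simp [mul_comm]

/-! ### Andréief's identity -/

/-- Andréief's identity for finite sums (the Cauchy–Binet formula). -/
theorem andreief {n : Type*} [Fintype n] [DecidableEq n] (s : Finset ℕ) (a b : ℕ → n → ℝ) :
    ∑ y ∈ Fintype.piFinset fun _ : n => s,
        (Matrix.of fun r i => a (y r) i).det * (Matrix.of fun r i => b (y r) i).det =
      (Fintype.card n).factorial * (Matrix.of fun i j => ∑ y ∈ s, a y i * b y j).det := by
  have h1 : ∀ y : n → ℕ, (Matrix.of fun r i => b (y r) i).det =
      ∑ τ : Equiv.Perm n, ((Equiv.Perm.sign τ : ℤ) : ℝ) * ∏ r, b (y (τ r)) r := fun y => by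
    rw [Matrix.det_apply']
    rfl
  -- Relabelling `y` by `τ` produces a second sign of `τ` from the other determinant, so all
  -- permutations contribute the same sum.
  have h2 : ∀ τ : Equiv.Perm n,
      ∑ y ∈ Fintype.piFinset fun _ : n => s, (Matrix.of fun r i => a (y r) i).det *
        (((Equiv.Perm.sign τ : ℤ) : ℝ) * ∏ r, b (y (τ r)) r) =
      ∑ y ∈ Fintype.piFinset fun _ : n => s, (Matrix.of fun r i => a (y r) i).det *
        ∏ r, b (y r) r := by
    intro τ
    refine Finset.sum_bij' (fun y _ => y ∘ τ) (fun y _ => y ∘ τ.symm) ?_ ?_ ?_ ?_ ?_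
    · intro y hy; simp only [Fintype.mem_piFinset] at hy ⊢; exact fun r => hy _
    · intro y hy; simp only [Fintype.mem_piFinset] at hy ⊢; exact fun r => hy _
    · intro y _; ext; simp
    · intro y _; ext; simp
    · intro y _
      have hp := Matrix.det_permute τ (Matrix.of fun r i => a (y r) i)
      have hp' : (Matrix.of fun r i => a ((y ∘ τ) r) i).det =
          ((Equiv.Perm.sign τ : ℤ) : ℝ) * (Matrix.of fun r i => a (y r) i).det := hp
      rw [hp']
      simp only [Function.comp_apply]
      ring
  have h3 : ∑ y ∈ Fintype.piFinset fun _ : n => s, (Matrix.of fun r i => a (y r) i).det *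
      ∏ r, b (y r) r = (Matrix.of fun i j => ∑ y ∈ s, a y i * b y j).det := by
    rw [Matrix.det_apply' (Matrix.of fun i j => ∑ y ∈ s, a y i * b y j)]
    simp only [Matrix.of_apply]
    simp_rw [Finset.prod_univ_sum, Finset.mul_sum]
    rw [Finset.sum_comm]
    refine Finset.sum_congr rfl fun y _ => ?_
    rw [← Matrix.det_transpose, Matrix.det_apply', Finset.sum_mul]
    refine Finset.sum_congr rfl fun σ _ => ?_
    simp only [Matrix.transpose_apply, Matrix.of_apply, Finset.prod_mul_distrib]
    ring
  simp_rw [h1, Finset.mul_sum]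
  rw [Finset.sum_comm]
  simp_rw [h2, h3]
  simp [Fintype.card_perm]

end PlancherelRows

end

noncomputable section

namespace PlancherelRows

open MeasureTheory Filter Topology

/-! ### The branching rule for standard Young tableaux -/

/-- The fillings of the boxes of `μ` that are standard Young tableaux, as functions on `ℕ × ℕ`
vanishing outside `μ`. -/
structure IsTableau (μ : YoungDiagram) (f : ℕ × ℕ → ℕ) : Prop where
  zero_off : ∀ c, c ∉ μ → f c = 0
  lt_card : ∀ c, c ∈ μ → f c < μ.card
  inj : ∀ a b, a ∈ μ → b ∈ μ → f a = f b → a = b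
  row : ∀ i j j', j < j' → (i, j') ∈ μ → f (i, j) < f (i, j')
  col : ∀ i i' j, i < i' → (i', j) ∈ μ → f (i, j) < f (i', j)

theorem StandardYoungTableau.entry_injective (μ : YoungDiagram) :
    Function.Injective (StandardYoungTableau.entry (μ := μ)) := by
  rintro ⟨e, _, _⟩ ⟨e', _, _⟩ h
  cases h
  rfl

/-- The function on `ℕ × ℕ` given by a standard Young tableau. -/
def StandardYoungTableau.toFun {μ : YoungDiagram} (T : StandardYoungTableau μ) (c : ℕ × ℕ) : ℕ :=
  if h : c ∈ μ.cells then (T.entry ⟨c, h⟩ : ℕ) else 0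

theorem StandardYoungTableau.toFun_of_mem {μ : YoungDiagram} (T : StandardYoungTableau μ)
    {c : ℕ × ℕ} (h : c ∈ μ.cells) : T.toFun c = T.entry ⟨c, h⟩ := dif_pos h

theorem StandardYoungTableau.isTableau {μ : YoungDiagram} (T : StandardYoungTableau μ) :
    IsTableau μ T.toFun where
  zero_off c hc := dif_neg (by simpa using hc)
  lt_card c hc := by
    rw [T.toFun_of_mem (by simpa using hc)]
    exact Fin.is_lt _
  inj a b ha hb h := by
    rw [T.toFun_of_mem (by simpa using ha), T.toFun_of_mem (by simpa using hb)] at h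
    exact congrArg Subtype.val (T.entry.injective (Fin.ext h))
  row i j j' hj h := by
    rw [T.toFun_of_mem (by simpa using μ.up_left_mem le_rfl hj.le h),
      T.toFun_of_mem (by simpa using h)]
    exact T.row_strict _ _ rfl hj
  col i i' j hi h := by
    rw [T.toFun_of_mem (by simpa using μ.up_left_mem hi.le le_rfl h),
      T.toFun_of_mem (by simpa using h)]
    exact T.col_strict _ _ rfl hi

/-- As plain functions on `ℕ × ℕ`, tableaux of different shapes can be compared and updated without
dependent types. -/
theorem numSYT_eq_card_isTableau (μ : YoungDiagram) :
    numSYT μ = Nat.card {f : ℕ × ℕ → ℕ // IsTableau μ f} := by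
  refine Nat.card_eq_of_bijective (fun T : StandardYoungTableau μ => ⟨T.toFun, T.isTableau⟩)
    ⟨?_, ?_⟩
  · intro T T' h
    refine StandardYoungTableau.entry_injective μ (Equiv.ext fun c => Fin.ext ?_)
    have := congrFun (Subtype.ext_iff.1 h) c.1
    simpa [T.toFun_of_mem c.2, T'.toFun_of_mem c.2] using this
  · rintro ⟨f, hf⟩
    let e : μ.cells → Fin μ.card := fun c => ⟨f c, hf.lt_card _ (by simp)⟩
    have he : Function.Bijective e := by
      rw [Fintype.bijective_iff_injective_and_card]
      refine ⟨fun a b h => Subtype.ext (hf.inj _ _ (by simp) (by simp)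
        (by simpa [e] using h)), by simp⟩
    refine ⟨⟨Equiv.ofBijective e he, ?_, ?_⟩, Subtype.ext (funext fun c => ?_)⟩
    · rintro ⟨⟨i, j⟩, ha⟩ ⟨⟨i', j'⟩, hb⟩ (rfl : i = i') h
      rw [Equiv.ofBijective_apply, Equiv.ofBijective_apply]
      exact hf.row i j j' h (by simpa using hb)
    · rintro ⟨⟨i, j⟩, ha⟩ ⟨⟨i', j'⟩, hb⟩ (rfl : j = j') h
      rw [Equiv.ofBijective_apply, Equiv.ofBijective_apply]
      exact hf.col i i' j h (by simpa using hb)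
    · change StandardYoungTableau.toFun _ c = f c
      by_cases h : c ∈ μ.cells
      · rw [StandardYoungTableau.toFun_of_mem _ h]
        rfl
      · rw [hf.zero_off c (by simpa using h)]
        exact dif_neg h

instance (μ : YoungDiagram) : Finite {f : ℕ × ℕ → ℕ // IsTableau μ f} := by
  refine Finite.of_injective
    (fun f => fun c : μ.cells => (⟨f.1 c, f.2.lt_card _ (by simp)⟩ : Fin μ.card)) ?_
  intro f g h
  refine Subtype.ext (funext fun c => ?_)
  by_cases hc : c ∈ μ.cells
  · simpa using congrFun h ⟨c, hc⟩
  · rw [f.2.zero_off c (by simpa using hc), g.2.zero_off c (by simpa using hc)]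

theorem rowLen_eq_of_mem_iff {μ : YoungDiagram} {i m : ℕ} (h : ∀ j, (i, j) ∈ μ ↔ j < m) :
    μ.rowLen i = m := by
  refine le_antisymm ?_ ?_
  · by_contra! hlt
    exact lt_irrefl _ ((h m).1 (YoungDiagram.mem_iff_lt_rowLen.2 hlt))
  · by_contra! hlt
    exact lt_irrefl _ (YoungDiagram.mem_iff_lt_rowLen.1 ((h _).2 hlt))

/-- `μ` with the last box of row `r` removed, for a row longer than the next one (and `μ`
otherwise). -/
def eraseRow (μ : YoungDiagram) (r : ℕ) : YoungDiagram :=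
  if h : μ.rowLen (r + 1) < μ.rowLen r then
    { cells := μ.cells.erase (r, μ.rowLen r - 1)
      isLowerSet := by
        rintro ⟨i, j⟩ ⟨i', j'⟩ ⟨hi, hj⟩ hm
        simp only [Finset.coe_erase, Set.mem_sdiff, Finset.mem_coe, YoungDiagram.mem_cells,
          Set.mem_singleton_iff, Prod.mk.injEq] at hm ⊢
        simp only at hi hj
        refine ⟨μ.up_left_mem hi hj hm.1, ?_⟩
        rintro ⟨rfl, rfl⟩
        refine hm.2 ?_
        have h1 := YoungDiagram.mem_iff_lt_rowLen.1 hm.1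
        rcases Nat.eq_or_lt_of_le hi with rfl | hlt
        · omega
        · have := μ.rowLen_anti _ _ (Nat.succ_le_of_lt hlt)
          simp only [Nat.succ_eq_add_one] at this
          omega }
  else μ

theorem mem_eraseRow {μ : YoungDiagram} {r : ℕ} (h : μ.rowLen (r + 1) < μ.rowLen r) (c : ℕ × ℕ) :
    c ∈ eraseRow μ r ↔ c ∈ μ ∧ c ≠ (r, μ.rowLen r - 1) := by
  rw [eraseRow, dif_pos h, ← YoungDiagram.mem_cells]
  simp [and_comm]

theorem card_eraseRow {μ : YoungDiagram} {r : ℕ} (h : μ.rowLen (r + 1) < μ.rowLen r) :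
    (eraseRow μ r).card + 1 = μ.card := by
  have hm : (r, μ.rowLen r - 1) ∈ μ.cells := by
    rw [YoungDiagram.mem_cells, YoungDiagram.mem_iff_lt_rowLen]
    omega
  have : (eraseRow μ r).card = (μ.cells.erase (r, μ.rowLen r - 1)).card := by
    rw [eraseRow, dif_pos h]
  rw [this]
  exact Finset.card_erase_add_one hm

theorem rowLen_eraseRow {μ : YoungDiagram} {r : ℕ} (h : μ.rowLen (r + 1) < μ.rowLen r) (i : ℕ) :
    (eraseRow μ r).rowLen i = if i = r then μ.rowLen r - 1 else μ.rowLen i := by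
  refine rowLen_eq_of_mem_iff fun j => ?_
  rw [mem_eraseRow h, YoungDiagram.mem_iff_lt_rowLen]
  split_ifs with hi
  · subst hi
    simp only [ne_eq, Prod.mk.injEq, true_and]
    omega
  · simp [hi]

/-- The added box is a corner: nothing lies to its right or below it, so placing the largest entry
there violates no inequality. -/
theorem isTableau_update {μ : YoungDiagram} {r : ℕ} (h : μ.rowLen (r + 1) < μ.rowLen r)
    {g : ℕ × ℕ → ℕ} (hg : IsTableau (eraseRow μ r) g) :
    IsTableau μ (Function.update g (r, μ.rowLen r - 1) (eraseRow μ r).card) := by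
  have hm : (r, μ.rowLen r - 1) ∈ μ := by
    rw [YoungDiagram.mem_iff_lt_rowLen]
    omega
  have hcard := card_eraseRow h
  refine ⟨fun c hc => ?_, fun c hc => ?_, fun a b ha hb hab => ?_, fun i j j' hj hc => ?_,
    fun i i' j hi hc => ?_⟩
  · rw [Function.update_of_ne (by rintro rfl; exact hc hm)]
    exact hg.zero_off c fun h' => hc ((mem_eraseRow h c).1 h').1
  · by_cases hcc : c = (r, μ.rowLen r - 1)
    · subst hcc
      rw [Function.update_self]
      omega
    · rw [Function.update_of_ne hcc]
      have := hg.lt_card c ((mem_eraseRow h c).2 ⟨hc, hcc⟩)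
      omega
  · by_cases h1 : a = (r, μ.rowLen r - 1) <;> by_cases h2 : b = (r, μ.rowLen r - 1)
    · rw [h1, h2]
    · subst h1
      rw [Function.update_self, Function.update_of_ne h2] at hab
      have := hg.lt_card b ((mem_eraseRow h b).2 ⟨hb, h2⟩)
      omega
    · subst h2
      rw [Function.update_self, Function.update_of_ne h1] at hab
      have := hg.lt_card a ((mem_eraseRow h a).2 ⟨ha, h1⟩)
      omega
    · rw [Function.update_of_ne h1, Function.update_of_ne h2] at hab
      exact hg.inj a b ((mem_eraseRow h a).2 ⟨ha, h1⟩) ((mem_eraseRow h b).2 ⟨hb, h2⟩) hab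
  · have hlt := YoungDiagram.mem_iff_lt_rowLen.1 hc
    have h1 : (i, j) ≠ (r, μ.rowLen r - 1) := by
      rintro h'
      rw [Prod.mk.injEq] at h'
      rw [h'.1] at hlt
      omega
    rw [Function.update_of_ne h1]
    by_cases h2 : (i, j') = (r, μ.rowLen r - 1)
    · rw [h2, Function.update_self]
      exact hg.lt_card _ ((mem_eraseRow h _).2 ⟨μ.up_left_mem le_rfl hj.le hc, h1⟩)
    · rw [Function.update_of_ne h2]
      exact hg.row i j j' hj ((mem_eraseRow h _).2 ⟨hc, h2⟩)
  · have hlt := YoungDiagram.mem_iff_lt_rowLen.1 hc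
    have h1 : (i, j) ≠ (r, μ.rowLen r - 1) := by
      rintro h'
      rw [Prod.mk.injEq] at h'
      have := μ.rowLen_anti (r + 1) i' (by omega)
      omega
    rw [Function.update_of_ne h1]
    by_cases h2 : (i', j) = (r, μ.rowLen r - 1)
    · rw [h2, Function.update_self]
      exact hg.lt_card _ ((mem_eraseRow h _).2 ⟨μ.up_left_mem hi.le le_rfl hc, h1⟩)
    · rw [Function.update_of_ne h2]
      exact hg.col i i' j hi ((mem_eraseRow h _).2 ⟨hc, h2⟩)

theorem IsTableau.exists_eq {μ : YoungDiagram} {f : ℕ × ℕ → ℕ} (hf : IsTableau μ f) {k : ℕ}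
    (hk : k < μ.card) : ∃ c ∈ μ, f c = k := by
  have h : μ.cells.image f = Finset.range μ.card := by
    refine Finset.eq_of_subset_of_card_le (fun x hx => ?_) ?_
    · obtain ⟨c, hc, rfl⟩ := Finset.mem_image.1 hx
      exact Finset.mem_range.2 (hf.lt_card c (by simpa using hc))
    · rw [Finset.card_range, Finset.card_image_of_injOn]
      intro a ha b hb hab
      exact hf.inj a b (by simpa using ha) (by simpa using hb) hab
  have hm : k ∈ μ.cells.image f := by rw [h]; exact Finset.mem_range.2 hk
  obtain ⟨c, hc, rfl⟩ := Finset.mem_image.1 hm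
  exact ⟨c, by simpa using hc, rfl⟩

/-- The box with the largest entry has no box to its right or below, hence it ends a row strictly
longer than the next one. -/
theorem exists_isTableau_update {μ : YoungDiagram} (hμ : 0 < μ.card) {f : ℕ × ℕ → ℕ}
    (hf : IsTableau μ f) : ∃ r, μ.rowLen (r + 1) < μ.rowLen r ∧ ∃ g, IsTableau (eraseRow μ r) g ∧
      f = Function.update g (r, μ.rowLen r - 1) (eraseRow μ r).card := by
  obtain ⟨⟨r, j⟩, hc, hcv⟩ := hf.exists_eq (k := μ.card - 1) (by omega)
  have hj : j < μ.rowLen r := YoungDiagram.mem_iff_lt_rowLen.1 hc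
  have hright : (r, j + 1) ∉ μ := fun h => by
    have h1 := hf.row r j (j + 1) (by omega) h
    have h2 := hf.lt_card _ h
    omega
  have hdown : (r + 1, j) ∉ μ := fun h => by
    have h1 := hf.col r (r + 1) j (by omega) h
    have h2 := hf.lt_card _ h
    omega
  rw [YoungDiagram.mem_iff_lt_rowLen, not_lt] at hright hdown
  have h : μ.rowLen (r + 1) < μ.rowLen r := by omega
  obtain rfl : j = μ.rowLen r - 1 := by omega
  have hcard := card_eraseRow h
  have hne : ∀ c, c ∈ eraseRow μ r → c ≠ (r, μ.rowLen r - 1) := fun c hc' =>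
    ((mem_eraseRow h c).1 hc').2
  refine ⟨r, h, Function.update f (r, μ.rowLen r - 1) 0, ?_, ?_⟩
  · refine ⟨fun c hc' => ?_, fun c hc' => ?_, fun a b ha hb hab => ?_, fun i j j' hj' hc' => ?_,
      fun i i' j hi hc' => ?_⟩
    · by_cases hcc : c = (r, μ.rowLen r - 1)
      · rw [hcc, Function.update_self]
      · rw [Function.update_of_ne hcc]
        exact hf.zero_off c fun hm => hc' ((mem_eraseRow h c).2 ⟨hm, hcc⟩)
    · rw [Function.update_of_ne (hne c hc')]
      have hm := ((mem_eraseRow h c).1 hc').1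
      have h1 := hf.lt_card c hm
      have h2 : f c ≠ μ.card - 1 := fun h3 => hne c hc' (hf.inj _ _ hm hc (h3.trans hcv.symm))
      omega
    · rw [Function.update_of_ne (hne a ha), Function.update_of_ne (hne b hb)] at hab
      exact hf.inj a b ((mem_eraseRow h a).1 ha).1 ((mem_eraseRow h b).1 hb).1 hab
    · have h2 := (eraseRow μ r).up_left_mem le_rfl hj'.le hc'
      rw [Function.update_of_ne (hne _ hc'), Function.update_of_ne (hne _ h2)]
      exact hf.row i j j' hj' ((mem_eraseRow h _).1 hc').1
    · have h2 := (eraseRow μ r).up_left_mem hi.le le_rfl hc'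
      rw [Function.update_of_ne (hne _ hc'), Function.update_of_ne (hne _ h2)]
      exact hf.col i i' j hi ((mem_eraseRow h _).1 hc').1
  · rw [Function.update_idem]
    ext c
    by_cases hcc : c = (r, μ.rowLen r - 1)
    · rw [hcc, Function.update_self, hcv]
      omega
    · rw [Function.update_of_ne hcc]

/-- The branching rule: the largest entry of a standard Young tableau sits in a corner. -/
theorem numSYT_eq_sum_eraseRow {μ : YoungDiagram} (hμ : 0 < μ.card) {M : ℕ} (hM : μ.rowLen M = 0) :
    numSYT μ = ∑ r : Fin M,
      if μ.rowLen (r + 1) < μ.rowLen r then numSYT (eraseRow μ r) else 0 := by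
  classical
  rw [← Finset.sum_filter, ← Finset.sum_subtype_eq_sum_filter, numSYT_eq_card_isTableau]
  have hcorner : ∀ r : ℕ, μ.rowLen (r + 1) < μ.rowLen r → (r, μ.rowLen r - 1) ∈ μ := fun r h => by
    rw [YoungDiagram.mem_iff_lt_rowLen]
    omega
  have key : Nat.card (Σ r : {r : Fin M // μ.rowLen (r + 1) < μ.rowLen r},
      {g : ℕ × ℕ → ℕ // IsTableau (eraseRow μ r.1) g}) = Nat.card {f // IsTableau μ f} := by
    refine Nat.card_eq_of_bijective
      (fun p => ⟨Function.update p.2.1 (p.1.1, μ.rowLen p.1.1 - 1) (eraseRow μ p.1.1).card,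
        isTableau_update p.1.2 p.2.2⟩) ⟨?_, ?_⟩
    · rintro ⟨⟨r, hr⟩, g, hg⟩ ⟨⟨r', hr'⟩, g', hg'⟩ heq
      have heq' := Subtype.ext_iff.1 heq
      simp only at heq'
      have hc : (eraseRow μ r).card = (eraseRow μ r').card := by
        have := card_eraseRow hr
        have := card_eraseRow hr'
        omega
      -- The two updated functions coincide and are injective on `μ`, so the box with the largest
      -- entry, and hence its row, is the same.
      have hrr : r = r' := by
        have h1 := isTableau_update hr hg
        have h2 : Function.update g ((r : ℕ), μ.rowLen r - 1) (eraseRow μ r).card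
            ((r : ℕ), μ.rowLen r - 1) = Function.update g ((r : ℕ), μ.rowLen r - 1)
            (eraseRow μ r).card ((r' : ℕ), μ.rowLen r' - 1) := by
          rw [Function.update_self]
          conv_rhs => rw [heq']
          rw [Function.update_self, hc]
        have h3 := h1.inj _ _ (hcorner r hr) (hcorner r' hr') h2
        exact Fin.ext (Prod.mk.inj h3).1
      subst hrr
      congr
      ext c
      by_cases hcc : c = ((r : ℕ), μ.rowLen r - 1)
      · rw [hg.zero_off c fun h => ((mem_eraseRow hr c).1 h).2 hcc,
          hg'.zero_off c fun h => ((mem_eraseRow hr c).1 h).2 hcc]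
      · have := congrFun heq' c
        rwa [Function.update_of_ne hcc, Function.update_of_ne hcc] at this
    · rintro ⟨f, hf⟩
      obtain ⟨r, hr, g, hg, rfl⟩ := exists_isTableau_update hμ hf
      have hrM : r < M := by
        by_contra! hle
        have := μ.rowLen_anti M r hle
        omega
      exact ⟨⟨⟨⟨r, hrM⟩, hr⟩, g, hg⟩, rfl⟩
  rw [← key, Nat.card_sigma]
  refine Finset.sum_bij' (fun r _ => r) (fun r _ => r) ?_ ?_ ?_ ?_ ?_ <;>
    simp [numSYT_eq_card_isTableau]

/-! ### Young diagrams as increasing sequences -/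

/-- The strictly increasing sequence of the numbers `μ_r + M - 1 - r`, `r < M`. -/
def shifted (M : ℕ) (μ : YoungDiagram) (i : Fin M) : ℕ := μ.rowLen (M - 1 - i) + i

theorem shifted_strictMono (M : ℕ) (μ : YoungDiagram) : StrictMono (shifted M μ) := by
  intro i j hij
  have := μ.rowLen_anti (M - 1 - j) (M - 1 - i) (by have : (i : ℕ) < j := hij; omega)
  have : (i : ℕ) < j := hij
  simp only [shifted]
  omega

theorem card_eq_sum_rowLen {μ : YoungDiagram} {M : ℕ} (hM : μ.rowLen M = 0) :
    μ.card = ∑ i : Fin M, μ.rowLen i := by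
  rw [Fin.sum_univ_eq_sum_range (fun i => μ.rowLen i), YoungDiagram.card,
    Finset.card_eq_sum_card_fiberwise (f := Prod.fst) (t := Finset.range M)]
  · refine Finset.sum_congr rfl fun i _ => ?_
    rw [YoungDiagram.rowLen_eq_card, YoungDiagram.row]
  · rintro ⟨i, j⟩ hc
    have h1 : j < μ.rowLen i := YoungDiagram.mem_iff_lt_rowLen.1 (by simpa using hc)
    simp only [Finset.coe_range, Set.mem_Iio]
    by_contra! hle
    have := μ.rowLen_anti M i hle
    omega

theorem sum_shifted {μ : YoungDiagram} {M : ℕ} (hM : μ.rowLen M = 0) :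
    ∑ i, shifted M μ i = μ.card + staircase M := by
  simp only [shifted, Finset.sum_add_distrib, staircase]
  rw [card_eq_sum_rowLen hM, ← Equiv.sum_comp Fin.revPerm]
  congr 1
  refine Finset.sum_congr rfl fun i _ => ?_
  congr 1
  simp only [Fin.revPerm_apply, Fin.val_rev]
  omega

theorem numSYT_eq_one {μ : YoungDiagram} (h : μ.card = 0) : numSYT μ = 1 := by
  have hm : ∀ c, c ∉ μ := fun c hc => by
    have h1 : c ∈ μ.cells := by simpa using hc
    rw [YoungDiagram.card, Finset.card_eq_zero] at h
    rw [h] at h1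
    simp at h1
  rw [numSYT_eq_card_isTableau, Nat.card_eq_one_iff_unique]
  refine ⟨⟨fun f g => Subtype.ext (funext fun c => ?_)⟩, ⟨⟨0, ?_⟩⟩⟩
  · rw [f.2.zero_off c (hm c), g.2.zero_off c (hm c)]
  · exact ⟨fun _ _ => rfl, fun c hc => (hm c hc).elim, fun a _ ha => (hm a ha).elim,
      fun _ _ _ _ hc => (hm _ hc).elim, fun _ _ _ _ hc => (hm _ hc).elim⟩

theorem invFactDet_val (M : ℕ) : invFactDet (fun i : Fin M => (i : ℕ)) = 1 := by
  unfold invFactDet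
  rw [Matrix.det_of_isLowerTriangular]
  · simp [invFact]
  · intro i j hij
    have : (i : ℕ) < j := hij
    exact if_neg (not_le.2 this)

/-- The determinantal formula for the number of standard Young tableaux. -/
theorem numSYT_eq_factorial_mul_invFactDet {M : ℕ} (μ : YoungDiagram) (hM : μ.rowLen M = 0) :
    (numSYT μ : ℝ) = μ.card.factorial * invFactDet (shifted M μ) := by
  induction hN : μ.card generalizing μ with
  | zero =>
    have hz : shifted M μ = fun i : Fin M => (i : ℕ) := by
      ext i
      have : μ.rowLen (M - 1 - i) ≤ μ.card := by
        rw [YoungDiagram.rowLen_eq_card]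
        exact Finset.card_le_card (Finset.filter_subset _ _)
      simp only [shifted]
      omega
    rw [numSYT_eq_one hN, hz, invFactDet_val]
    simp
  | succ N ih =>
    rw [numSYT_eq_sum_eraseRow (by omega) hM]
    -- The lowering identity at `shifted M μ`, multiplied by `N!`, is the branching rule; row `M - 1
    -- - i` corresponds to argument `i`.
    have h := sum_invFactDet_lower (shifted M μ)
    rw [sum_shifted hM, hN] at h
    push_cast at h
    have h' : ((N + 1).factorial : ℝ) * invFactDet (shifted M μ) = N.factorial *
        (((N : ℝ) + 1 + staircase M - staircase M) * invFactDet (shifted M μ)) := by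
      rw [Nat.factorial_succ]
      push_cast
      ring
    rw [h', ← h, Finset.mul_sum, ← Equiv.sum_comp Fin.revPerm]
    push_cast
    refine Finset.sum_congr rfl fun i _ => ?_
    simp only [Fin.revPerm_apply]
    have hrev : ((Fin.rev i : Fin M) : ℕ) = M - 1 - i := by rw [Fin.val_rev]; omega
    rw [hrev]
    by_cases hc : μ.rowLen (M - 1 - i + 1) < μ.rowLen (M - 1 - i)
    · have hne : shifted M μ i ≠ 0 := by simp only [shifted]; omega
      rw [if_pos hc, if_neg hne]
      have hM' : (eraseRow μ (M - 1 - i)).rowLen M = 0 := by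
        rw [rowLen_eraseRow hc]
        split_ifs <;> omega
      rw [ih _ hM' (by have := card_eraseRow hc; omega)]
      congr 2
      ext k
      by_cases hk : k = i
      · subst hk
        simp only [shifted, rowLen_eraseRow hc, if_true, Function.update_self]
        omega
      · have hne' : M - 1 - (k : ℕ) ≠ M - 1 - i := by
          have := k.2
          have := i.2
          intro h''
          exact hk (Fin.ext (by omega))
        rw [Function.update_of_ne hk]
        simp [shifted, rowLen_eraseRow hc, hne']
    · rw [if_neg hc]
      split_ifs with h0
      · simp
      -- The row is as long as the next, so lowering its argument makes it equal to the preceding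
      -- one and the determinant vanishes. For `i = 0` the row would be empty, which `h0` excludes.
      · have heq : μ.rowLen (M - 1 - i + 1) = μ.rowLen (M - 1 - i) :=
          le_antisymm (μ.rowLen_anti _ _ (Nat.le_succ _)) (not_lt.1 hc)
        have hi : 0 < (i : ℕ) := by
          by_contra! hle
          have hi0 : (i : ℕ) = 0 := by omega
          have hlt := i.2
          rw [hi0, show M - 1 - 0 + 1 = M by omega, hM] at heq
          simp only [shifted] at h0
          rw [hi0] at h0
          omega
        let k : Fin M := ⟨i - 1, by omega⟩
        have hki : k ≠ i := fun h => by
          have : (i : ℕ) - 1 = i := congrArg Fin.val h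
          omega
        have : invFactDet (Function.update (shifted M μ) i (shifted M μ i - 1)) = 0 := by
          by_contra hne
          refine hki (injective_of_invFactDet_ne_zero hne ?_)
          rw [Function.update_self, Function.update_of_ne hki]
          simp only [shifted, k]
          rw [show M - 1 - ((i : ℕ) - 1) = M - 1 - i + 1 by omega, heq]
          omega
        rw [this]
        simp

/-- The Young diagram with prescribed row lengths. -/
def ofAntitone (f : ℕ → ℕ) (hf : Antitone f) (M : ℕ) : YoungDiagram where
  cells := (Finset.range M ×ˢ Finset.range (f 0)).filter fun c => c.2 < f c.1
  isLowerSet := by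
    rintro ⟨i, j⟩ ⟨i', j'⟩ ⟨hi, hj⟩ hm
    simp only [Finset.coe_filter, Finset.mem_product, Finset.mem_range, Set.mem_ofPred_eq] at *
    have := hf hi
    omega

theorem rowLen_ofAntitone {f : ℕ → ℕ} (hf : Antitone f) {M : ℕ} (hM : f M = 0) (i : ℕ) :
    (ofAntitone f hf M).rowLen i = f i := by
  refine rowLen_eq_of_mem_iff fun j => ?_
  rw [← YoungDiagram.mem_cells]
  simp only [ofAntitone, Finset.mem_filter, Finset.mem_product, Finset.mem_range]
  refine ⟨fun h => h.2, fun h => ⟨⟨?_, ?_⟩, h⟩⟩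
  · by_contra! hle
    have := hf hle
    omega
  · exact h.trans_le (hf (Nat.zero_le i))

/-- Subtracting `0, 1, …, M - 1` from an increasing sequence and reversing it gives decreasing row
lengths. -/
theorem exists_shifted_eq {M : ℕ} {z : Fin M → ℕ} (hz : StrictMono z) :
    ∃ μ : YoungDiagram, μ.rowLen M = 0 ∧ shifted M μ = z := by
  let f : ℕ → ℕ := fun r => if h : r < M then z ⟨M - 1 - r, by omega⟩ - (M - 1 - r) else 0
  have hle : ∀ i : Fin M, (i : ℕ) ≤ z i := by
    rintro ⟨i, hi⟩
    induction i with
    | zero => exact Nat.zero_le _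
    | succ k ih =>
      have h1 := ih (by omega)
      have h2 : z ⟨k, by omega⟩ < z ⟨k + 1, hi⟩ := hz (by simp)
      simp only at *
      omega
  have hf : Antitone f := by
    refine antitone_nat_of_succ_le fun r => ?_
    simp only [f]
    by_cases h : r + 1 < M
    · rw [dif_pos h, dif_pos (by omega)]
      have h2 : z ⟨M - 1 - (r + 1), by omega⟩ < z ⟨M - 1 - r, by omega⟩ := hz (by
        rw [Fin.mk_lt_mk]; omega)
      omega
    · rw [dif_neg h]
      exact Nat.zero_le _
  have hM : f M = 0 := dif_neg (lt_irrefl _)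
  refine ⟨ofAntitone f hf M, by rw [rowLen_ofAntitone hf hM, hM], funext fun i => ?_⟩
  have hi := i.2
  have h1 := hle i
  simp only [shifted, rowLen_ofAntitone hf hM, f]
  rw [dif_pos (by omega)]
  have : (⟨M - 1 - (M - 1 - (i : ℕ)), by omega⟩ : Fin M) = i := Fin.ext (by simp; omega)
  rw [this]
  omega

theorem shifted_injOn {M : ℕ} {μ ν : YoungDiagram} (hμ : μ.rowLen M = 0) (hν : ν.rowLen M = 0)
    (h : shifted M μ = shifted M ν) : μ = ν := by
  refine YoungDiagram.ext (Finset.ext fun ⟨i, j⟩ => ?_)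
  rw [YoungDiagram.mem_cells, YoungDiagram.mem_cells, YoungDiagram.mem_iff_lt_rowLen,
    YoungDiagram.mem_iff_lt_rowLen]
  suffices μ.rowLen i = ν.rowLen i by rw [this]
  by_cases hi : i < M
  · have := congrFun h ⟨M - 1 - i, by omega⟩
    simp only [shifted] at this
    rw [show M - 1 - (M - 1 - i) = i by omega] at this
    omega
  · have h1 := μ.rowLen_anti M i (by omega)
    have h2 := ν.rowLen_anti M i (by omega)
    omega

theorem mem_youngDiagrams {μ : YoungDiagram} {N : ℕ} : μ ∈ youngDiagrams N ↔ μ.card = N := by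
  simp [youngDiagrams]

/-- A sum over sequences of a symmetric function that vanishes unless the terms are distinct, as a
sum over Young diagrams. -/
theorem sum_piAntidiag_eq (M N : ℕ) (g : (Fin M → ℕ) → ℝ)
    (hsymm : ∀ z (σ : Equiv.Perm (Fin M)), g (z ∘ σ) = g z)
    (hinj : ∀ z, g z ≠ 0 → Function.Injective z) :
    ∑ z ∈ Finset.piAntidiag (Finset.univ : Finset (Fin M)) (N + staircase M), g z =
      M.factorial * ∑ μ ∈ (youngDiagrams N).filter (fun μ => μ.rowLen M = 0), g (shifted M μ) := by
  classical
  have h1 : (M.factorial : ℝ) *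
      ∑ μ ∈ (youngDiagrams N).filter (fun μ => μ.rowLen M = 0), g (shifted M μ) =
      ∑ p ∈ (Finset.univ : Finset (Equiv.Perm (Fin M))) ×ˢ
        (youngDiagrams N).filter (fun μ => μ.rowLen M = 0), g (shifted M p.2 ∘ p.1) := by
    rw [Finset.sum_product]
    simp_rw [hsymm]
    simp [Fintype.card_perm]
  rw [h1, ← Finset.sum_filter_of_ne (p := Function.Injective) fun z _ h => hinj z h]
  symm
  refine Finset.sum_bij (fun p _ => shifted M p.2 ∘ p.1) ?_ ?_ ?_ ?_
  · rintro ⟨σ, μ⟩ hp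
    simp only [Finset.mem_product, Finset.mem_filter, mem_youngDiagrams] at hp
    simp only [Finset.mem_filter, Finset.mem_piAntidiag, Finset.mem_univ, implies_true, and_true]
    refine ⟨?_, (shifted_strictMono M μ).injective.comp σ.injective⟩
    rw [← hp.2.1, ← sum_shifted hp.2.2]
    exact Equiv.sum_comp σ (shifted M μ)
  · rintro ⟨σ, μ⟩ hp ⟨τ, ν⟩ hq heq
    simp only [Finset.mem_product, Finset.mem_filter] at hp hq heq
    have hr : Set.range (shifted M μ) = Set.range (shifted M ν) := by
      rw [← σ.surjective.range_comp, heq, τ.surjective.range_comp]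
    have hs := ((shifted_strictMono M μ).range_inj (shifted_strictMono M ν)).1 hr
    have hμν := shifted_injOn hp.2.2 hq.2.2 hs
    subst hμν
    congr 1
    ext i : 1
    exact (shifted_strictMono M μ).injective (congrFun heq i)
  · intro z hz
    simp only [Finset.mem_filter, Finset.mem_piAntidiag, Finset.mem_univ, implies_true,
      and_true] at hz
    -- Sorting recovers both the diagram and the permutation from a sequence of distinct numbers.
    have hmono : StrictMono (z ∘ Tuple.sort z) :=
      (Tuple.monotone_sort z).strictMono_of_injective (hz.2.comp (Tuple.sort z).injective)
    obtain ⟨μ, hμM, hμ⟩ := exists_shifted_eq hmono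
    refine ⟨((Tuple.sort z).symm, μ), ?_, ?_⟩
    · simp only [Finset.mem_product, Finset.mem_univ, true_and, Finset.mem_filter,
        mem_youngDiagrams]
      refine ⟨?_, hμM⟩
      have h2 := sum_shifted hμM
      rw [hμ] at h2
      have h3 : ∑ i, (z ∘ Tuple.sort z) i = ∑ i, z i := Equiv.sum_comp (Tuple.sort z) z
      have h4 : ∑ i, z i = N + staircase M := hz.1
      omega
    · ext i
      simp [hμ]
  · intro p _
    rfl

/-! ### The total mass of Plancherel measure -/

theorem rowLen_eq_zero_of_card_le {μ : YoungDiagram} {M : ℕ} (h : μ.card ≤ M) :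
    μ.rowLen M = 0 := by
  by_contra hne
  have h2 : (Finset.range (M + 1)).image (fun i => (i, 0)) ⊆ μ.cells := by
    intro c hc
    obtain ⟨i, hi, rfl⟩ := Finset.mem_image.1 hc
    rw [YoungDiagram.mem_cells, YoungDiagram.mem_iff_lt_rowLen]
    have := μ.rowLen_anti i M (by simp at hi; omega)
    omega
  have h3 := Finset.card_le_card h2
  rw [Finset.card_image_of_injective _ (fun a b h => (Prod.mk.inj h).1), Finset.card_range] at h3
  have : μ.cells.card ≤ M := h
  omega

/-- The sum of the squares of the numbers of standard Young tableaux is `N!`. -/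
theorem sum_numSYT_sq (N : ℕ) :
    ∑ μ ∈ youngDiagrams N, (numSYT μ : ℝ) ^ 2 = N.factorial := by
  -- With `M = N` the bound on the number of rows is void in degrees up to `N`, and these are the
  -- degrees reached by the recursion for `sqSum`.
  have hrow : ∀ k ≤ N, (youngDiagrams k).filter (fun μ => μ.rowLen N = 0) = youngDiagrams k :=
    fun k hk => Finset.filter_true_of_mem fun μ hμ =>
      rowLen_eq_zero_of_card_le ((mem_youngDiagrams.1 hμ).trans_le hk)
  have hZ : ∀ k ≤ N, sqSum N k = N.factorial * ∑ μ ∈ youngDiagrams k,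
      ((numSYT μ : ℝ) / k.factorial) ^ 2 := by
    intro k hk
    unfold sqSum
    rw [sum_piAntidiag_eq N k (fun z => invFactDet z ^ 2) invFactDet_comp_perm_sq
      (fun z hz => injective_of_invFactDet_ne_zero fun h => hz (by simp [h])), hrow k hk]
    congr 1
    refine Finset.sum_congr rfl fun μ hμ => ?_
    rw [← hrow k hk, Finset.mem_filter, mem_youngDiagrams] at hμ
    rw [numSYT_eq_factorial_mul_invFactDet μ hμ.2, hμ.1, mul_div_cancel_left₀]
    positivity
  have h0 : sqSum N 0 = N.factorial := by
    have hbot : youngDiagrams 0 = {⊥} := by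
      ext μ
      rw [mem_youngDiagrams, Finset.mem_singleton, YoungDiagram.card, Finset.card_eq_zero]
      exact ⟨fun h => YoungDiagram.ext h, fun h => by rw [h]; rfl⟩
    rw [hZ 0 (Nat.zero_le _), hbot, Finset.sum_singleton, numSYT_eq_one rfl]
    simp
  have hk : ∀ k ≤ N, sqSum N k = N.factorial / k.factorial := by
    intro k
    induction k with
    | zero => intro _; simp [h0]
    | succ k ih =>
      intro hkN
      have h1 := sqSum_succ (M := N) (N := k) (by omega)
      rw [ih (by omega)] at h1
      rw [Nat.factorial_succ]
      push_cast
      have : ((k : ℝ) + 1) ≠ 0 := by positivity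
      field_simp
      field_simp at h1
      linarith
  have h1 := hZ N le_rfl
  rw [hk N le_rfl] at h1
  simp_rw [div_pow] at h1
  rw [← Finset.sum_div] at h1
  have : (N.factorial : ℝ) ≠ 0 := by positivity
  field_simp at h1
  linarith

end PlancherelRows

end

noncomputable section

namespace PlancherelRows

open MeasureTheory Filter Topology

/-! ### Weighted sums over Young diagrams as Toeplitz-like determinants -/

/-- `v ^ (y - i) / (y - i)!`, which is zero for `y < i`. -/
def powFact (v : ℝ) (y i : ℕ) : ℝ := v ^ (y - i) * invFact y i

/-- The weight `1 - t` on `y ≥ M + n` and `1` elsewhere. -/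
def tailWeight (M n : ℕ) (t : ℝ) (y : ℕ) : ℝ := if M + n ≤ y then 1 - t else 1

/-- The number of rows `r` (counted from `0`) of `μ` with `μ_r - r - 1 ≥ n`. -/
def exceed (n : ℕ) (μ : YoungDiagram) : ℕ :=
  ((Finset.range (μ.colLen 0)).filter fun r => n + 1 + r ≤ μ.rowLen r).card

theorem abs_tailWeight_le {M n : ℕ} {t : ℝ} (ht : |1 - t| ≤ 1) (y : ℕ) :
    |tailWeight M n t y| ≤ 1 := by
  unfold tailWeight
  split_ifs <;> simp [ht]

/-- In a nonzero Leibniz term the exponents `z r - σ r` add up to `∑ z - staircase M`. Terms with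
some `z r < σ r`, where truncated subtraction would spoil this, vanish. -/
theorem det_powFact {M : ℕ} (v : ℝ) (z : Fin M → ℕ) :
    (Matrix.of fun r i : Fin M => powFact v (z r) i).det =
      v ^ (∑ r, z r - staircase M) * invFactDet z := by
  rw [← Matrix.det_transpose, Matrix.det_apply', invFactDet, ← Matrix.det_transpose,
    Matrix.det_apply', Finset.mul_sum]
  refine Finset.sum_congr rfl fun σ _ => ?_
  simp only [Matrix.transpose_apply, Matrix.of_apply, powFact, Finset.prod_mul_distrib]
  by_cases h : ∀ r, (σ r : ℕ) ≤ z r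
  · have h1 : ∑ r, z r - staircase M = ∑ r, (z r - (σ r : ℕ)) := by
      have h2 : ∑ r, (z r - (σ r : ℕ)) + ∑ r, ((σ r : Fin M) : ℕ) = ∑ r, z r := by
        rw [← Finset.sum_add_distrib]
        exact Finset.sum_congr rfl fun r _ => Nat.sub_add_cancel (h r)
      have h3 : ∑ r, ((σ r : Fin M) : ℕ) = staircase M := Equiv.sum_comp σ fun i => (i : ℕ)
      omega
    rw [h1, Finset.prod_pow_eq_pow_sum]
    ring
  · push Not at h
    obtain ⟨r, hr⟩ := h
    have : ∏ r, invFact (z r) (σ r) = 0 :=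
      Finset.prod_eq_zero (Finset.mem_univ r) (if_neg (not_le.2 hr))
    rw [this]
    ring

theorem summable_abs_powFact (v : ℝ) (i : ℕ) : Summable fun y => |powFact v y i| := by
  rw [← summable_nat_add_iff i]
  have := (Real.summable_pow_div_factorial v).abs
  refine this.congr fun y => ?_
  simp [powFact, invFact, div_eq_mul_inv]

theorem abs_powFact_le (v : ℝ) (y i : ℕ) : |powFact v y i| ≤ ∑' k, |powFact v k i| :=
  (summable_abs_powFact v i).le_tsum y fun _ _ => abs_nonneg _

theorem summable_tailWeight_mul {M n : ℕ} {t : ℝ} (ht : |1 - t| ≤ 1) (v : ℝ) (i j : ℕ) :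
    Summable fun y => tailWeight M n t y * powFact v y i * powFact v y j := by
  refine Summable.of_norm_bounded
    ((summable_abs_powFact v j).mul_left (∑' k, |powFact v k i|)) fun y => ?_
  rw [Real.norm_eq_abs, abs_mul, abs_mul]
  refine mul_le_mul_of_nonneg_right ?_ (abs_nonneg _)
  calc |tailWeight M n t y| * |powFact v y i| ≤ 1 * ∑' k, |powFact v k i| :=
        mul_le_mul (abs_tailWeight_le ht y) (abs_powFact_le v y i) (abs_nonneg _) zero_le_one
    _ = _ := one_mul _

/-- The determinant of the matrix `∑_y w(y) v^{y-i} v^{y-j} / ((y-i)! (y-j)!)`. -/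
def weightedDet (M n : ℕ) (t v : ℝ) : ℝ :=
  (Matrix.of fun i j : Fin M => ∑' y, tailWeight M n t y * powFact v y i * powFact v y j).det

theorem sum_filter_numSYT_sq_le (N : ℕ) (p : YoungDiagram → Prop) [DecidablePred p] :
    ∑ μ ∈ (youngDiagrams N).filter p, ((numSYT μ : ℝ) / N.factorial) ^ 2 ≤ 1 / N.factorial := by
  calc ∑ μ ∈ (youngDiagrams N).filter p, ((numSYT μ : ℝ) / N.factorial) ^ 2
      ≤ ∑ μ ∈ youngDiagrams N, ((numSYT μ : ℝ) / N.factorial) ^ 2 :=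
        Finset.sum_le_sum_of_subset_of_nonneg (Finset.filter_subset _ _)
          fun _ _ _ => by positivity
    _ = 1 / N.factorial := by
        simp_rw [div_pow]
        rw [← Finset.sum_div, sum_numSYT_sq]
        have : (N.factorial : ℝ) ≠ 0 := by positivity
        field_simp

/-- Up to the factor `M!` from the orderings, this is a part of `∑ (d_μ / N!)² = 1 / N!`. -/
theorem sqSum_le (M N : ℕ) : sqSum M N ≤ M.factorial / N.factorial := by
  unfold sqSum
  rw [sum_piAntidiag_eq M N (fun z => invFactDet z ^ 2) invFactDet_comp_perm_sq
    (fun z hz => injective_of_invFactDet_ne_zero fun h => hz (by simp [h])), div_eq_mul_one_div]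
  refine mul_le_mul_of_nonneg_left (le_of_eq_of_le ?_
    (sum_filter_numSYT_sq_le N fun μ => μ.rowLen M = 0))
    (by positivity)
  refine Finset.sum_congr rfl fun μ hμ => ?_
  rw [Finset.mem_filter, mem_youngDiagrams] at hμ
  rw [numSYT_eq_factorial_mul_invFactDet μ hμ.2, hμ.1, mul_div_cancel_left₀]
  positivity

theorem abs_prod_tailWeight_le {M n : ℕ} {t : ℝ} (ht : |1 - t| ≤ 1) (z : Fin M → ℕ) :
    |∏ r, tailWeight M n t (z r)| ≤ 1 := by
  rw [Finset.abs_prod]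
  exact Finset.prod_le_one (fun _ _ => abs_nonneg _) fun r _ => abs_tailWeight_le ht _

/-- Stated for subsets `s` because it has to dominate sums over finite boxes uniformly in the size
of the box. -/
theorem sum_abs_weighted_le {M n : ℕ} {t : ℝ} (ht : |1 - t| ≤ 1) (v : ℝ) (N : ℕ)
    (s : Finset (Fin M → ℕ))
    (hs : s ⊆ Finset.piAntidiag (Finset.univ : Finset (Fin M)) (N + staircase M)) :
    |∑ z ∈ s, (∏ r, tailWeight M n t (z r)) * (v ^ (2 * N) * invFactDet z ^ 2)| ≤
      M.factorial * ((v ^ 2) ^ N / N.factorial) := by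
  calc |∑ z ∈ s, (∏ r, tailWeight M n t (z r)) * (v ^ (2 * N) * invFactDet z ^ 2)|
      ≤ ∑ z ∈ s, |(∏ r, tailWeight M n t (z r)) * (v ^ (2 * N) * invFactDet z ^ 2)| :=
        Finset.abs_sum_le_sum_abs _ _
    _ ≤ ∑ z ∈ s, v ^ (2 * N) * invFactDet z ^ 2 := by
        refine Finset.sum_le_sum fun z _ => ?_
        have h0 : 0 ≤ v ^ (2 * N) * invFactDet z ^ 2 := by
          rw [pow_mul]; positivity
        rw [abs_mul, abs_of_nonneg h0]
        exact mul_le_of_le_one_left h0 (abs_prod_tailWeight_le ht z)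
    _ ≤ ∑ z ∈ Finset.piAntidiag (Finset.univ : Finset (Fin M)) (N + staircase M),
          v ^ (2 * N) * invFactDet z ^ 2 :=
        Finset.sum_le_sum_of_subset_of_nonneg hs fun z _ _ => by rw [pow_mul]; positivity
    _ = v ^ (2 * N) * sqSum M N := by rw [sqSum, Finset.mul_sum]
    _ ≤ v ^ (2 * N) * (M.factorial / N.factorial) :=
        mul_le_mul_of_nonneg_left (sqSum_le M N) (by rw [pow_mul]; positivity)
    _ = _ := by rw [pow_mul]; ring

theorem summable_factorial_bound (M : ℕ) (v : ℝ) :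
    Summable fun N : ℕ => (M.factorial : ℝ) * ((v ^ 2) ^ N / N.factorial) :=
  (Real.summable_pow_div_factorial (v ^ 2)).mul_left _

/-- Andréief's identity for `y < L`, followed by `L → ∞`. Grouping the sequences by their sum gives
a bound independent of `L`. -/
theorem factorial_mul_weightedDet {M n : ℕ} {t : ℝ} (ht : |1 - t| ≤ 1) (v : ℝ) :
    M.factorial * weightedDet M n t v =
      ∑' N : ℕ, ∑ z ∈ Finset.piAntidiag (Finset.univ : Finset (Fin M)) (N + staircase M),
        (∏ r, tailWeight M n t (z r)) * (v ^ (2 * N) * invFactDet z ^ 2) := by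
  classical
  let box : ℕ → Finset (Fin M → ℕ) := fun L => Fintype.piFinset fun _ => Finset.range L
  let term : (Fin M → ℕ) → ℝ := fun z => (∏ r, tailWeight M n t (z r)) *
    (v ^ (2 * (∑ r, z r - staircase M)) * invFactDet z ^ 2)
  let part : ℕ → ℕ → ℝ := fun L N => ∑ z ∈ (box L).filter fun z => ∑ r, z r = N + staircase M,
    (∏ r, tailWeight M n t (z r)) * (v ^ (2 * N) * invFactDet z ^ 2)
  have hentry : Tendsto (fun L : ℕ => (M.factorial : ℝ) * (Matrix.of fun i j : Fin M =>
      ∑ y ∈ Finset.range L, tailWeight M n t y * powFact v y i * powFact v y j).det) atTop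
      (𝓝 (M.factorial * weightedDet M n t v)) := by
    refine Tendsto.const_mul _ ?_
    have hc : Continuous fun A : Matrix (Fin M) (Fin M) ℝ => A.det := continuous_id.matrix_det
    refine (hc.tendsto _).comp (tendsto_pi_nhds.2 fun i => tendsto_pi_nhds.2 fun j => ?_)
    exact (summable_tailWeight_mul ht v i j).hasSum.tendsto_sum_nat
  have hfin : ∀ L : ℕ, (M.factorial : ℝ) * (Matrix.of fun i j : Fin M =>
      ∑ y ∈ Finset.range L, tailWeight M n t y * powFact v y i * powFact v y j).det =
      ∑' N, part L N := by
    intro L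
    have h1 := andreief (n := Fin M) (Finset.range L)
      (fun y i => tailWeight M n t y * powFact v y i) (fun y i => powFact v y i)
    rw [Fintype.card_fin] at h1
    rw [← h1]
    have h2 : ∀ z : Fin M → ℕ,
        (Matrix.of fun r i : Fin M => tailWeight M n t (z r) * powFact v (z r) i).det *
          (Matrix.of fun r i : Fin M => powFact v (z r) i).det = term z := fun z => by
      have := Matrix.det_mul_column (fun r => tailWeight M n t (z r))
        (Matrix.of fun r i : Fin M => powFact v (z r) i)
      simp only [Matrix.of_apply] at this
      rw [this, det_powFact]
      simp only [term]
      rw [mul_comm 2, pow_mul]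
      ring
    simp_rw [h2]
    -- Sequences with sum below the staircase contribute zero; for the others the truncated
    -- difference in `term` is the true degree.
    have h3 : ∑ z ∈ box L, term z = ∑ z ∈ (box L).filter fun z => staircase M ≤ ∑ r, z r,
        term z := by
      symm
      refine Finset.sum_filter_of_ne fun z _ hz => ?_
      by_contra! hlt
      exact hz (by simp [term, invFactDet_eq_zero_of_sum_lt z hlt])
    have h4 := Finset.sum_fiberwise_of_maps_to
      (s := (box L).filter fun z => staircase M ≤ ∑ r, z r) (t := Finset.range (M * L + 1))
      (g := fun z => ∑ r, z r - staircase M) (f := term) (fun z hz => by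
        rw [Finset.mem_filter] at hz
        have h5 : ∑ r, z r ≤ ∑ _r : Fin M, L := Finset.sum_le_sum fun r _ =>
          (Finset.mem_range.1 (Fintype.mem_piFinset.1 hz.1 r)).le
        simp only [Finset.sum_const, Finset.card_univ, Fintype.card_fin, smul_eq_mul] at h5
        simp only [Finset.mem_range]
        omega)
    have h6 : ∀ N, ∑ z ∈ ((box L).filter fun z => staircase M ≤ ∑ r, z r).filter
        (fun z => ∑ r, z r - staircase M = N), term z = part L N := fun N => by
      simp only [part]
      rw [Finset.filter_filter]
      refine Finset.sum_congr (Finset.filter_congr fun z _ => by omega) fun z hz => ?_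
      rw [Finset.mem_filter] at hz
      simp only [term, hz.2, Nat.add_sub_cancel]
    change ∑ z ∈ box L, term z = _
    rw [h3, ← h4]
    simp_rw [h6]
    rw [tsum_eq_sum]
    intro N hN
    refine Finset.sum_eq_zero fun z hz => ?_
    rw [Finset.mem_filter] at hz
    exfalso
    have h5 : ∑ r, z r ≤ ∑ _r : Fin M, L := Finset.sum_le_sum fun r _ =>
      (Finset.mem_range.1 (Fintype.mem_piFinset.1 hz.1 r)).le
    simp only [Finset.sum_const, Finset.card_univ, Fintype.card_fin, smul_eq_mul] at h5
    simp only [Finset.mem_range] at hN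
    omega
  simp_rw [hfin] at hentry
  refine tendsto_nhds_unique hentry ?_
  refine tendsto_tsum_of_dominated_convergence (summable_factorial_bound M v) (fun N => ?_)
    (Eventually.of_forall fun L N => ?_)
  · refine tendsto_const_nhds.congr' ?_
    filter_upwards [eventually_gt_atTop (N + staircase M)] with L hL
    refine Finset.sum_congr ?_ fun _ _ => rfl
    ext z
    simp only [Finset.mem_piAntidiag, Finset.mem_univ, implies_true, and_true, Finset.mem_filter,
      box, Fintype.mem_piFinset, Finset.mem_range]
    refine ⟨fun h => ⟨fun r => ?_, h⟩, fun h => h.2⟩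
    have : z r ≤ Finset.univ.sum z := Finset.single_le_sum (fun _ _ => Nat.zero_le _)
      (Finset.mem_univ r)
    omega
  · rw [Real.norm_eq_abs]
    refine sum_abs_weighted_le ht v N _ fun z hz => ?_
    rw [Finset.mem_filter] at hz
    simpa using hz.2

/-- For `r = M - 1 - i` the point `μ_r + M - 1 - r` is at least `M + n` exactly when `μ_r ≥ n + 1 +
r`. -/
theorem prod_tailWeight_shifted {M n : ℕ} {t : ℝ} {μ : YoungDiagram} (hM : μ.rowLen M = 0) :
    ∏ i, tailWeight M n t (shifted M μ i) = (1 - t) ^ exceed n μ := by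
  unfold tailWeight
  rw [Finset.prod_ite]
  simp only [Finset.prod_const, one_pow, mul_one]
  congr 1
  unfold exceed
  refine Finset.card_bij (fun i _ => M - 1 - (i : ℕ)) ?_ ?_ ?_
  · intro i hi
    rw [Finset.mem_filter] at hi
    have hi := hi.2
    simp only [shifted] at hi
    have hlt := i.2
    simp only [Finset.mem_filter, Finset.mem_range]
    refine ⟨?_, by omega⟩
    rw [← YoungDiagram.mem_iff_lt_colLen, YoungDiagram.mem_iff_lt_rowLen]
    omega
  · intro i _ j _ h
    have := i.2
    have := j.2
    exact Fin.ext (by omega)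
  · intro r hr
    simp only [Finset.mem_filter, Finset.mem_range] at hr
    have hrM : r < M := by
      by_contra! hle
      have := μ.rowLen_anti M r hle
      omega
    refine ⟨⟨M - 1 - r, by omega⟩, ?_, by simp; omega⟩
    rw [Finset.mem_filter]
    refine ⟨Finset.mem_univ _, ?_⟩
    simp only [shifted]
    rw [show M - 1 - (M - 1 - r) = r by omega]
    omega

/-- `∑ (d_μ / N!)² (1 - t)^{exceed μ}` over the Young diagrams with `N` boxes. -/
def rowGen (n : ℕ) (t : ℝ) (N : ℕ) : ℝ :=
  ∑ μ ∈ youngDiagrams N, ((numSYT μ : ℝ) / N.factorial) ^ 2 * (1 - t) ^ exceed n μ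

/-- The `M!` orderings of each point configuration cancel the factorial in Andréief's identity. -/
theorem weightedDet_eq_tsum {M n : ℕ} {t : ℝ} (ht : |1 - t| ≤ 1) (v : ℝ) :
    weightedDet M n t v = ∑' N : ℕ, (v ^ 2) ^ N *
      ∑ μ ∈ (youngDiagrams N).filter (fun μ => μ.rowLen M = 0),
        ((numSYT μ : ℝ) / N.factorial) ^ 2 * (1 - t) ^ exceed n μ := by
  have hM : (M.factorial : ℝ) ≠ 0 := by positivity
  have h := factorial_mul_weightedDet (M := M) (n := n) ht v
  refine mul_left_cancel₀ hM ?_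
  rw [h, ← tsum_mul_left]
  refine tsum_congr fun N => ?_
  rw [sum_piAntidiag_eq M N (fun z => (∏ r, tailWeight M n t (z r)) *
    (v ^ (2 * N) * invFactDet z ^ 2))]
  · congr 1
    rw [Finset.mul_sum]
    refine Finset.sum_congr rfl fun μ hμ => ?_
    rw [Finset.mem_filter, mem_youngDiagrams] at hμ
    rw [numSYT_eq_factorial_mul_invFactDet μ hμ.2, hμ.1, mul_div_cancel_left₀ _ (by positivity),
      prod_tailWeight_shifted hμ.2, pow_mul]
    ring
  · intro z σ
    rw [invFactDet_comp_perm_sq]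
    congr 1
    exact Equiv.prod_comp σ fun r => tailWeight M n t (z r)
  · intro z hz
    exact injective_of_invFactDet_ne_zero fun h => hz (by simp [h])

theorem abs_sum_filter_le {n : ℕ} {t : ℝ} (ht : |1 - t| ≤ 1) (N : ℕ) (p : YoungDiagram → Prop)
    [DecidablePred p] :
    |∑ μ ∈ (youngDiagrams N).filter p,
      ((numSYT μ : ℝ) / N.factorial) ^ 2 * (1 - t) ^ exceed n μ| ≤ 1 / (N.factorial : ℝ) := by
  refine (Finset.abs_sum_le_sum_abs _ _).trans (le_trans ?_ (sum_filter_numSYT_sq_le N p))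
  refine Finset.sum_le_sum fun μ _ => ?_
  rw [abs_mul, abs_of_nonneg (by positivity : (0 : ℝ) ≤ ((numSYT μ : ℝ) / N.factorial) ^ 2),
    abs_pow]
  exact mul_le_of_le_one_right (by positivity) (pow_le_one₀ (abs_nonneg _) ht)

/-- For `M ≥ N` the restriction on the rows is void in degree `N`, and the terms are dominated by
the series of `exp (v ^ 2)`. -/
theorem tendsto_weightedDet {n : ℕ} {t : ℝ} (ht : |1 - t| ≤ 1) (v : ℝ) :
    Tendsto (fun M => weightedDet M n t v) atTop (𝓝 (∑' N : ℕ, (v ^ 2) ^ N * rowGen n t N)) := by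
  simp_rw [weightedDet_eq_tsum ht v]
  refine tendsto_tsum_of_dominated_convergence (Real.summable_pow_div_factorial (v ^ 2))
    (fun N => ?_) (Eventually.of_forall fun M N => ?_)
  · refine tendsto_const_nhds.congr' ?_
    filter_upwards [eventually_ge_atTop N] with M hM
    rw [rowGen, Finset.filter_true_of_mem fun μ hμ =>
      rowLen_eq_zero_of_card_le ((mem_youngDiagrams.1 hμ).trans_le hM)]
  · rw [norm_mul, Real.norm_of_nonneg (by positivity), div_eq_mul_one_div, Real.norm_eq_abs]
    exact mul_le_mul_of_nonneg_left (abs_sum_filter_le ht N _) (by positivity)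

/-! ### The Poissonized row probabilities -/

/-- The Poissonized generating function of the number of exceeding rows. -/
def poissonGen (n : ℕ) (lam t : ℝ) : ℝ := Real.exp (-lam) * ∑' N : ℕ, lam ^ N * rowGen n t N

theorem tsum_rowGen_zero (n : ℕ) (lam : ℝ) : ∑' N : ℕ, lam ^ N * rowGen n 0 N = Real.exp lam := by
  rw [Real.exp_eq_exp_ℝ, NormedSpace.exp_eq_tsum_div]
  refine tsum_congr fun N => ?_
  have h : rowGen n 0 N = 1 / N.factorial := by
    unfold rowGen
    simp only [sub_zero, one_pow, mul_one]
    simp_rw [div_pow]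
    rw [← Finset.sum_div, sum_numSYT_sq]
    have : (N.factorial : ℝ) ≠ 0 := by positivity
    field_simp
  rw [h, mul_one_div]

/-- At `t = 0` all weights are one and the limit is `exp lam`, so the quotient becomes an average
under Poissonized Plancherel measure. -/
theorem tendsto_weightedDet_ratio {n : ℕ} {lam t : ℝ} (ht : |1 - t| ≤ 1) {v : ℝ}
    (hv : v ^ 2 = lam) :
    Tendsto (fun M => weightedDet M n t v / weightedDet M n 0 v) atTop
      (𝓝 (poissonGen n lam t)) := by
  have h1 := tendsto_weightedDet (n := n) ht v
  have h2 := tendsto_weightedDet (n := n) (t := 0) (by simp) v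
  rw [hv] at h1 h2
  rw [tsum_rowGen_zero] at h2
  have := h1.div h2 (Real.exp_pos _).ne'
  rwa [div_eq_inv_mul (∑' N : ℕ, lam ^ N * rowGen n t N), ← Real.exp_neg] at this

theorem rowLen_eq_zero_of_colLen_le {μ : YoungDiagram} {r : ℕ} (h : μ.colLen 0 ≤ r) :
    μ.rowLen r = 0 := by
  by_contra hne
  have : (r, 0) ∈ μ := YoungDiagram.mem_iff_lt_rowLen.2 (Nat.pos_of_ne_zero hne)
  have := YoungDiagram.mem_iff_lt_colLen.1 this
  omega

/-- As `μ_r - r` is strictly decreasing in `r`, the rows that are counted form an initial segment.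
-/
theorem exceed_eq_zero_iff {n : ℕ} {μ : YoungDiagram} : exceed n μ = 0 ↔ μ.rowLen 0 ≤ n := by
  unfold exceed
  rw [Finset.card_eq_zero, Finset.filter_eq_empty_iff]
  constructor
  · intro h
    by_contra! hlt
    have h0 : 0 < μ.colLen 0 := by
      by_contra! hle
      have := rowLen_eq_zero_of_colLen_le (r := 0) hle
      omega
    exact h (Finset.mem_range.2 h0) (by omega)
  · intro h r _ hr
    have := μ.rowLen_anti 0 r (Nat.zero_le _)
    omega

/-- Two rows are counted exactly when row `1` is, that is, when `μ_1 ≥ n + 2`. This is the origin of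
the index `n + 1` for the second row. -/
theorem exceed_le_one_iff {n : ℕ} {μ : YoungDiagram} : exceed n μ ≤ 1 ↔ μ.rowLen 1 ≤ n + 1 := by
  unfold exceed
  constructor
  · intro h
    by_contra! hlt
    have h1 : 1 < μ.colLen 0 := by
      by_contra! hle
      have := rowLen_eq_zero_of_colLen_le (r := 1) hle
      omega
    have := μ.rowLen_anti 0 1 (Nat.zero_le _)
    have h2 : ({0, 1} : Finset ℕ) ⊆
        (Finset.range (μ.colLen 0)).filter fun r => n + 1 + r ≤ μ.rowLen r := by
      intro r hr
      simp only [Finset.mem_insert, Finset.mem_singleton] at hr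
      rw [Finset.mem_filter, Finset.mem_range]
      rcases hr with rfl | rfl <;> omega
    have h3 := Finset.card_le_card h2
    rw [Finset.card_pair (by norm_num)] at h3
    omega
  · intro h
    refine (Finset.card_le_card (t := {0}) fun r hr => ?_).trans (by simp)
    rw [Finset.mem_filter] at hr
    rw [Finset.mem_singleton]
    by_contra hne
    have := μ.rowLen_anti 1 r (by omega)
    omega

theorem poissonRow_eq (k n : ℕ) (lam : ℝ) : poissonRow k n lam = Real.exp (-lam) *
    ∑' N : ℕ, lam ^ N * ∑ μ ∈ youngDiagrams N,
      ((numSYT μ : ℝ) / N.factorial) ^ 2 * (if μ.rowLen (k - 1) ≤ n then 1 else 0) := by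
  unfold poissonRow rowProb
  rw [← tsum_mul_left]
  refine tsum_congr fun N => ?_
  rw [Finset.sum_filter, Finset.mul_sum, Finset.mul_sum, Finset.mul_sum, Finset.mul_sum]
  refine Finset.sum_congr rfl fun μ _ => ?_
  split_ifs
  · rw [div_pow]
    ring
  · simp

theorem poissonRow_one_eq_poissonGen (n : ℕ) (lam : ℝ) :
    poissonRow 1 n lam = poissonGen n lam 1 := by
  rw [poissonRow_eq, poissonGen]
  congr 1
  refine tsum_congr fun N => ?_
  congr 1
  refine Finset.sum_congr rfl fun μ _ => ?_
  congr 1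
  rw [sub_self, zero_pow_eq]
  simp only [Nat.sub_self, exceed_eq_zero_iff]

/-- The weights `(d_μ / N!)²` add up to `1 / N!`, so bounded functions of the diagram have
absolutely convergent Poissonized sums. -/
theorem summable_mul_sum_of_abs_le {lam C : ℝ} (hlam : 0 ≤ lam) {f : YoungDiagram → ℝ}
    (hf : ∀ μ, |f μ| ≤ C) :
    Summable (fun N : ℕ => lam ^ N * ∑ μ ∈ youngDiagrams N,
      ((numSYT μ : ℝ) / N.factorial) ^ 2 * f μ) ∧
    |∑' N : ℕ, lam ^ N * ∑ μ ∈ youngDiagrams N, ((numSYT μ : ℝ) / N.factorial) ^ 2 * f μ| ≤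
      C * Real.exp lam := by
  classical
  have hb : ∀ N : ℕ, ‖lam ^ N * ∑ μ ∈ youngDiagrams N,
      ((numSYT μ : ℝ) / N.factorial) ^ 2 * f μ‖ ≤ C * (lam ^ N / N.factorial) := fun N => by
    rw [norm_mul, Real.norm_of_nonneg (by positivity), Real.norm_eq_abs]
    have h1 : |∑ μ ∈ youngDiagrams N, ((numSYT μ : ℝ) / N.factorial) ^ 2 * f μ| ≤
        ∑ μ ∈ youngDiagrams N, ((numSYT μ : ℝ) / N.factorial) ^ 2 * C := by
      refine (Finset.abs_sum_le_sum_abs _ _).trans (Finset.sum_le_sum fun μ _ => ?_)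
      rw [abs_mul, abs_of_nonneg (by positivity)]
      exact mul_le_mul_of_nonneg_left (hf μ) (by positivity)
    have hC : 0 ≤ C := (abs_nonneg _).trans (hf ⊥)
    have h2 := sum_filter_numSYT_sq_le N fun _ => True
    rw [Finset.filter_true] at h2
    rw [← Finset.sum_mul] at h1
    calc _ ≤ lam ^ N * (1 / N.factorial * C) :=
          mul_le_mul_of_nonneg_left (h1.trans (mul_le_mul_of_nonneg_right h2 hC)) (by positivity)
      _ = _ := by ring
  have hs := (Real.summable_pow_div_factorial lam).mul_left C
  refine ⟨Summable.of_norm_bounded hs hb, ?_⟩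
  have h3 := tsum_of_norm_bounded (hs.hasSum) hb
  rw [tsum_mul_left] at h3
  rwa [Real.exp_eq_exp_ℝ, NormedSpace.exp_eq_tsum_div]

/-- First order expansion of `τ ^ e` at `τ = 0` with a remainder uniform in `e`, so that it can be
summed over all diagrams. -/
theorem abs_pow_sub_indicators_le {τ : ℝ} (hτ : |τ| ≤ 1) (e : ℕ) :
    |τ ^ e - (if e = 0 then 1 else 0) - (if e = 1 then 1 else 0) * τ| ≤ τ ^ 2 := by
  rcases e with _ | _ | e
  · simpa using sq_nonneg τ
  · simpa using sq_nonneg τ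
  · simp only [Nat.add_eq_zero_iff, one_ne_zero, and_false, if_false, sub_zero]
    rw [if_neg (by omega), zero_mul, sub_zero, abs_pow, add_assoc, pow_add, ← sq_abs τ]
    exact mul_le_of_le_one_left (by positivity) (pow_le_one₀ (abs_nonneg _) hτ)

/-- The derivative at `t = 1` of the generating function. -/
theorem hasDerivAt_poissonGen (n : ℕ) {lam : ℝ} (hlam : 0 ≤ lam) :
    HasDerivAt (poissonGen n lam)
      (-(poissonRow 2 (n + 1) lam - poissonRow 1 n lam)) 1 := by
  set S : (YoungDiagram → ℝ) → ℝ := fun f => ∑' N : ℕ, lam ^ N * ∑ μ ∈ youngDiagrams N,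
    ((numSYT μ : ℝ) / N.factorial) ^ 2 * f μ with hS
  have hlin : ∀ (f g : YoungDiagram → ℝ) (c : ℝ), (∃ C, ∀ μ, |f μ| ≤ C) → (∃ C, ∀ μ, |g μ| ≤ C) →
      S (fun μ => f μ - c * g μ) = S f - c * S g := by
    rintro f g c ⟨C, hf⟩ ⟨D, hg⟩
    have h1 := (summable_mul_sum_of_abs_le hlam hf).1
    have h2 := (summable_mul_sum_of_abs_le hlam hg).1
    simp only [hS]
    rw [← tsum_mul_left, ← h1.tsum_sub (h2.mul_left c)]
    refine tsum_congr fun N => ?_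
    simp_rw [mul_sub, Finset.sum_sub_distrib, Finset.mul_sum]
    rw [mul_sub, Finset.mul_sum, Finset.mul_sum]
    congr 1
    exact Finset.sum_congr rfl fun μ _ => by ring
  set a : YoungDiagram → ℝ := fun μ => if exceed n μ = 0 then 1 else 0
  set b : YoungDiagram → ℝ := fun μ => if exceed n μ = 1 then 1 else 0
  have ha : ∀ μ, |a μ| ≤ 1 := fun μ => by simp only [a]; split_ifs <;> simp
  have hb : ∀ μ, |b μ| ≤ 1 := fun μ => by simp only [b]; split_ifs <;> simp
  have h1 : poissonRow 1 n lam = Real.exp (-lam) * S a := by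
    rw [poissonRow_eq]
    simp only [hS, a, exceed_eq_zero_iff, Nat.sub_self]
  have h2 : poissonRow 2 (n + 1) lam - poissonRow 1 n lam = Real.exp (-lam) * S b := by
    rw [h1, poissonRow_eq, ← mul_sub]
    congr 1
    have h3 := hlin (fun μ => if μ.rowLen (2 - 1) ≤ n + 1 then 1 else 0) a 1
      ⟨1, fun μ => by split_ifs <;> simp⟩ ⟨1, ha⟩
    rw [one_mul] at h3
    rw [← h3]
    congr 1
    ext μ
    have h4 : μ.rowLen (2 - 1) ≤ n + 1 ↔ exceed n μ ≤ 1 := exceed_le_one_iff.symm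
    simp only [h4, a, b, one_mul]
    rcases h : exceed n μ with _ | _ | e
    · simp
    · simp
    · simp
  have hgen : ∀ t, poissonGen n lam t = Real.exp (-lam) * S fun μ => (1 - t) ^ exceed n μ :=
    fun t => rfl
  rw [h2, hasDerivAt_iff_isLittleO]
  -- Without the constant and linear parts the summands are at most `(1 - t) ^ 2`, uniformly in `μ`,
  -- and the total mass is one.
  have hbig : (fun t => poissonGen n lam t - poissonGen n lam 1 -
      (t - 1) • -(Real.exp (-lam) * S b)) =O[𝓝 1] fun t => (t - 1) ^ 2 := by
    refine Asymptotics.IsBigO.of_bound 1 ?_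
    filter_upwards [Metric.ball_mem_nhds (1 : ℝ) one_pos] with t ht
    rw [Metric.mem_ball, Real.dist_eq, abs_sub_comm] at ht
    rw [← poissonRow_one_eq_poissonGen, h1, hgen]
    have hp : ∀ μ, |(1 - t) ^ exceed n μ| ≤ 1 := fun μ => by
      rw [abs_pow]; exact pow_le_one₀ (abs_nonneg _) ht.le
    have h5 : S (fun μ => (1 - t) ^ exceed n μ - 1 * a μ - (1 - t) * b μ) =
        S (fun μ => (1 - t) ^ exceed n μ) - 1 * S a - (1 - t) * S b := by
      rw [hlin (fun μ => (1 - t) ^ exceed n μ - 1 * a μ) b (1 - t) ⟨2, fun μ => ?_⟩ ⟨1, hb⟩,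
        hlin _ a 1 ⟨1, hp⟩ ⟨1, ha⟩]
      refine (abs_sub _ _).trans ?_
      rw [one_mul]
      linarith [hp μ, ha μ]
    have h6 := (summable_mul_sum_of_abs_le (C := (1 - t) ^ 2) hlam
      (f := fun μ => (1 - t) ^ exceed n μ - 1 * a μ - (1 - t) * b μ) fun μ => by
        have := abs_pow_sub_indicators_le ht.le (exceed n μ)
        simp only [a, b]
        rw [one_mul, mul_comm (1 - t)]
        exact this).2
    have h7 : Real.exp (-lam) * S (fun μ => (1 - t) ^ exceed n μ) - Real.exp (-lam) * S a -
        (t - 1) • -(Real.exp (-lam) * S b) = Real.exp (-lam) *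
        S (fun μ => (1 - t) ^ exceed n μ - 1 * a μ - (1 - t) * b μ) := by
      rw [h5, smul_eq_mul]
      ring
    rw [h7, norm_mul, Real.norm_of_nonneg (Real.exp_pos _).le, Real.norm_eq_abs, one_mul,
      Real.norm_of_nonneg (sq_nonneg _)]
    calc _ ≤ Real.exp (-lam) * ((1 - t) ^ 2 * Real.exp lam) :=
          mul_le_mul_of_nonneg_left h6 (Real.exp_pos _).le
      _ = (1 - t) ^ 2 * (Real.exp (-lam) * Real.exp lam) := by ring
      _ = (t - 1) ^ 2 := by rw [← Real.exp_add]; simp; ring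
  refine hbig.trans_isLittleO ?_
  refine (Asymptotics.isLittleO_pow_sub_sub (1 : ℝ) (m := 2) (by norm_num)).congr_left ?_
  intro t
  rw [Real.norm_eq_abs, sq_abs]

end PlancherelRows

end

noncomputable section

namespace PlancherelRows

open MeasureTheory Filter Topology

/-! ### The Fourier basis and multiplication operators on the circle -/

/-- The normalized monomial `z^k / √(2π)` as a continuous function. -/
def monomial (k : ℤ) : C(Angle, ℂ) := ((Real.sqrt (2 * Real.pi))⁻¹ : ℂ) • fourier k

/-- The class of a continuous function in `L²`. -/
abbrev toL2 : C(Angle, ℂ) →L[ℂ] L2Circle := ContinuousMap.toLp 2 volume ℂ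

theorem sqrt_two_pi_inv_mul_self :
    ((Real.sqrt (2 * Real.pi))⁻¹ : ℂ) * ((Real.sqrt (2 * Real.pi))⁻¹ : ℂ) * (2 * Real.pi) = 1 := by
  have h : Real.sqrt (2 * Real.pi) * Real.sqrt (2 * Real.pi) = 2 * Real.pi :=
    Real.mul_self_sqrt (by positivity)
  have h' : (Real.sqrt (2 * Real.pi) : ℂ) * Real.sqrt (2 * Real.pi) = 2 * Real.pi := by
    exact_mod_cast h
  have hne : (Real.sqrt (2 * Real.pi) : ℂ) ≠ 0 := by
    simpa using (Real.sqrt_pos.2 Real.two_pi_pos).ne'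
  rw [← h']
  field_simp

theorem orthonormal_monomial : Orthonormal ℂ fun k => toL2 (monomial k) := by
  rw [orthonormal_iff_ite]
  intro i j
  rw [ContinuousMap.inner_toLp]
  have h : ∀ x : Angle, monomial j x * (starRingEnd ℂ) (monomial i x) =
      ((Real.sqrt (2 * Real.pi))⁻¹ : ℂ) * ((Real.sqrt (2 * Real.pi))⁻¹ : ℂ) *
        fourier (j + -i) x := fun x => by
    rw [fourier_add, fourier_neg]
    simp only [monomial, ContinuousMap.smul_apply, smul_eq_mul, map_mul, map_inv₀,
      Complex.conj_ofReal]
    ring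
  simp_rw [h]
  rw [integral_const_mul]
  split_ifs with hij
  · subst hij
    simp only [add_neg_cancel, fourier_zero, integral_const, Measure.real, AddCircle.measure_univ,
      ENNReal.toReal_ofReal Real.two_pi_pos.le]
    rw [Complex.real_smul, mul_one]
    push_cast
    exact sqrt_two_pi_inv_mul_self
  · have hne : j + -i ≠ 0 := sub_ne_zero.mpr (Ne.symm hij)
    rw [integral_eq_zero_of_add_right_eq_neg (μ := (volume : Measure Angle))
      (fourier_add_half_inv_index hne Real.two_pi_pos), mul_zero]

theorem span_monomial_eq_top :
    ⊤ ≤ (Submodule.span ℂ (Set.range fun k => toL2 (monomial k))).topologicalClosure := by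
  have hne : ((Real.sqrt (2 * Real.pi))⁻¹ : ℂ) ≠ 0 := by
    simpa using (Real.sqrt_pos.2 Real.two_pi_pos).ne'
  have h1 := (ContinuousMap.toLp_denseRange ℂ (volume : Measure Angle) (p := 2) ℂ
    (by norm_num)).topologicalClosure_map_submodule (span_fourier_closure_eq_top (T := 2 * Real.pi))
  rw [← h1, Submodule.map_span]
  refine Submodule.topologicalClosure_mono (Submodule.span_le.2 ?_)
  rintro _ ⟨_, ⟨k, rfl⟩, rfl⟩
  have : toL2 (fourier k) = ((Real.sqrt (2 * Real.pi))⁻¹ : ℂ)⁻¹ • toL2 (monomial k) := by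
    rw [← map_smul, monomial, smul_smul, inv_mul_cancel₀ hne, one_smul]
  change toL2 (fourier k) ∈ _
  rw [this]
  exact Submodule.smul_mem _ _ (Submodule.subset_span ⟨k, rfl⟩)

/-- The Fourier basis of `L²` of the circle with respect to arc length. -/
def fBasis : HilbertBasis ℤ ℂ L2Circle :=
  HilbertBasis.mk orthonormal_monomial span_monomial_eq_top

theorem fBasis_apply (k : ℤ) : fBasis k = toL2 (monomial k) := by
  rw [fBasis, HilbertBasis.coe_mk]

theorem inner_fBasis (i j : ℤ) : inner ℂ (fBasis i) (fBasis j) = if i = j then (1 : ℂ) else 0 :=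
  (orthonormal_iff_ite.1 fBasis.orthonormal) i j

theorem norm_fBasis (k : ℤ) : ‖fBasis k‖ = 1 := fBasis.orthonormal.1 k

/-- Multiplication by a continuous function on `L²` of the circle. -/
def mulOp : C(Angle, ℂ) →L[ℂ] (L2Circle →L[ℂ] L2Circle) :=
  ((ContinuousLinearMap.mul ℂ ℂ).holderL (volume : Measure Angle) ⊤ 2 2).comp
    (ContinuousMap.toLp ⊤ volume ℂ)

theorem coeFn_mulOp (g : C(Angle, ℂ)) (f : L2Circle) :
    mulOp g f =ᵐ[volume] fun θ => g θ * f θ := by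
  have h1 := ContinuousLinearMap.coeFn_holder (r := 2) (ContinuousLinearMap.mul ℂ ℂ)
    (ContinuousMap.toLp (E := ℂ) ⊤ (volume : Measure Angle) ℂ g) f
  have h2 := ContinuousMap.coeFn_toLp (p := ⊤) (𝕜 := ℂ) (volume : Measure Angle) g
  filter_upwards [h1, h2] with θ h1 h2
  rw [h2] at h1
  exact h1

theorem mulOp_mulOp (g h : C(Angle, ℂ)) (f : L2Circle) : mulOp g (mulOp h f) = mulOp (g * h) f := by
  refine Lp.ext ?_
  filter_upwards [coeFn_mulOp g (mulOp h f), coeFn_mulOp h f, coeFn_mulOp (g * h) f]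
    with θ h1 h2 h3
  rw [h1, h2, h3, ContinuousMap.mul_apply, mul_assoc]

theorem mulOp_one (f : L2Circle) : mulOp 1 f = f := by
  refine Lp.ext ?_
  filter_upwards [coeFn_mulOp 1 f] with θ h1
  rw [h1, ContinuousMap.one_apply, one_mul]

theorem mulOp_toL2 (g h : C(Angle, ℂ)) : mulOp g (toL2 h) = toL2 (g * h) := by
  refine Lp.ext ?_
  filter_upwards [coeFn_mulOp g (toL2 h), ContinuousMap.coeFn_toLp (p := 2) (𝕜 := ℂ) volume h,
    ContinuousMap.coeFn_toLp (p := 2) (𝕜 := ℂ) volume (g * h)] with θ h1 h2 h3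
  rw [h1, h2, h3, ContinuousMap.mul_apply]

theorem inner_mulOp_left (g : C(Angle, ℂ)) (x y : L2Circle) :
    inner ℂ (mulOp g x) y = inner ℂ x (mulOp (star g) y) := by
  rw [L2.inner_def, L2.inner_def]
  refine integral_congr_ae ?_
  filter_upwards [coeFn_mulOp g x, coeFn_mulOp (star g) y] with θ h1 h2
  rw [h1, h2]
  simp only [RCLike.inner_apply, map_mul, ContinuousMap.star_apply, RCLike.star_def]
  ring

theorem mulOp_fourier_fBasis (m k : ℤ) : mulOp (fourier m) (fBasis k) = fBasis (k + m) := by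
  rw [fBasis_apply, fBasis_apply, mulOp_toL2]
  congr 1
  ext θ
  simp only [ContinuousMap.mul_apply, monomial, ContinuousMap.smul_apply, smul_eq_mul, fourier_add]
  ring

/-! ### The exponentials `exp (v z)` and `exp (v / z)` -/

/-- The function `exp (v z^σ)` on the circle. -/
def fexp (σ : ℤ) (v : ℝ) : C(Angle, ℂ) where
  toFun θ := Complex.exp (v * fourier σ θ)
  continuous_toFun := by fun_prop

theorem fexp_apply (σ : ℤ) (v : ℝ) (θ : Angle) : fexp σ v θ = Complex.exp (v * fourier σ θ) := rfl

/-- The coefficient `v^m / m!` of the exponential series. -/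
def expCoeff (v : ℝ) (m : ℕ) : ℂ := ((v ^ m / m.factorial : ℝ) : ℂ)

theorem fourier_mul_natCast (σ : ℤ) (m : ℕ) (θ : Angle) :
    fourier (m * σ) θ = (fourier σ θ : ℂ) ^ m := by
  induction m with
  | zero => simp
  | succ m ih =>
    rw [pow_succ, ← ih, ← fourier_add]
    congr 2
    push_cast
    ring

theorem hasSum_fexp (σ : ℤ) (v : ℝ) :
    HasSum (fun m : ℕ => expCoeff v m • (fourier (m * σ) : C(Angle, ℂ))) (fexp σ v) := by
  have hs : Summable fun m : ℕ => expCoeff v m • (fourier (m * σ) : C(Angle, ℂ)) := by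
    refine Summable.of_norm ?_
    refine ((Real.summable_pow_div_factorial v).abs).congr fun m => ?_
    rw [norm_smul, fourier_norm, mul_one, expCoeff, Complex.norm_real, Real.norm_eq_abs]
  have hlim : ∑' m : ℕ, expCoeff v m • (fourier (m * σ) : C(Angle, ℂ)) = fexp σ v := by
    ext θ
    have h1 := hs.hasSum.mapL (ContinuousMap.evalCLM ℂ θ)
    have h2 : HasSum (fun m : ℕ => (v * fourier σ θ : ℂ) ^ m / m.factorial)
        (Complex.exp (v * fourier σ θ)) := by
      rw [Complex.exp_eq_exp_ℂ]
      exact NormedSpace.expSeries_div_hasSum_exp _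
    refine h1.unique (h2.congr_fun ?_)
    intro m
    simp only [ContinuousMap.evalCLM_apply, ContinuousMap.smul_apply, smul_eq_mul,
      fourier_mul_natCast, expCoeff]
    push_cast
    rw [mul_pow]
    ring
  rw [← hlim]
  exact hs.hasSum

theorem hasSum_mulOp_fexp (σ : ℤ) (v : ℝ) (k : ℤ) :
    HasSum (fun m : ℕ => expCoeff v m • fBasis (k + m * σ)) (mulOp (fexp σ v) (fBasis k)) := by
  have h := (hasSum_fexp σ v).mapL ((ContinuousLinearMap.apply ℂ L2Circle (fBasis k)).comp mulOp)
  refine h.congr_fun fun m => ?_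
  simp [mulOp_fourier_fBasis]

theorem fexp_mul_fexp_neg (σ : ℤ) (v : ℝ) : fexp σ v * fexp σ (-v) = 1 := by
  ext θ
  rw [ContinuousMap.mul_apply, fexp_apply, fexp_apply, ← Complex.exp_add]
  simp

theorem mulOp_fexp_mulOp_fexp_neg (σ : ℤ) (v : ℝ) (f : L2Circle) :
    mulOp (fexp σ v) (mulOp (fexp σ (-v)) f) = f := by
  rw [mulOp_mulOp, fexp_mul_fexp_neg, mulOp_one]

theorem mulOp_fexp_neg_mulOp_fexp (σ : ℤ) (v : ℝ) (f : L2Circle) :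
    mulOp (fexp σ (-v)) (mulOp (fexp σ v) f) = f := by
  simpa using mulOp_fexp_mulOp_fexp_neg σ (-v) f

theorem star_fexp (σ : ℤ) (v : ℝ) : star (fexp σ v) = fexp (-σ) v := by
  ext θ
  rw [ContinuousMap.star_apply, fexp_apply, fexp_apply, fourier_neg, RCLike.star_def,
    ← Complex.exp_conj, map_mul, Complex.conj_ofReal]

/-- The coordinates of `exp (v / z) z^(b - i)`. -/
theorem inner_fBasis_mulOp_fexp (v : ℝ) (b : ℤ) (y i : ℕ) :
    inner ℂ (fBasis (b - y)) (mulOp (fexp (-1) v) (fBasis (b - i))) = (powFact v y i : ℂ) := by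
  have h := (hasSum_mulOp_fexp (-1) v (b - i)).mapL (innerSL ℂ (fBasis (b - y)))
  have h' : HasSum (fun m : ℕ => if y = i + m then expCoeff v m else 0)
      (inner ℂ (fBasis (b - y)) (mulOp (fexp (-1) v) (fBasis (b - i)))) := by
    refine h.congr_fun fun m => ?_
    simp only [innerSL_apply_apply, inner_smul_right, inner_fBasis]
    by_cases hy : y = i + m
    · rw [if_pos hy, if_pos (by subst hy; push_cast; ring), mul_one]
    · rw [if_neg hy, if_neg (by omega), mul_zero]
  refine h'.unique ?_
  by_cases hle : i ≤ y
  · have h1 := hasSum_ite_eq (y - i) (expCoeff v (y - i))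
    have h2 : (powFact v y i : ℂ) = expCoeff v (y - i) := by
      simp [powFact, invFact, hle, expCoeff, div_eq_mul_inv]
    rw [h2]
    refine h1.congr_fun fun m => ?_
    by_cases hm : m = y - i
    · subst hm
      rw [if_pos (by omega), if_pos rfl]
    · rw [if_neg (by omega), if_neg hm]
  · have h2 : (powFact v y i : ℂ) = 0 := by simp [powFact, invFact, hle]
    rw [h2]
    refine hasSum_zero.congr_fun fun m => ?_
    rw [if_neg (by omega)]

theorem hasSum_powFact_smul (v : ℝ) (b : ℤ) (i : ℕ) :
    HasSum (fun y : ℕ => (powFact v y i : ℂ) • fBasis (b - y))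
      (mulOp (fexp (-1) v) (fBasis (b - i))) := by
  have hinj : Function.Injective fun m : ℕ => i + m := fun a b h => by simpa using h
  rw [← hinj.hasSum_iff]
  · refine (hasSum_mulOp_fexp (-1) v (b - i)).congr_fun fun m => ?_
    simp only [Function.comp_apply]
    congr 1
    · simp [powFact, invFact, expCoeff, div_eq_mul_inv]
    · congr 1
      push_cast
      ring
  · intro y hy
    have : ¬ i ≤ y := fun hle => hy ⟨y - i, by simp; omega⟩
    simp [powFact, invFact, this]

end PlancherelRows

end

noncomputable section

namespace PlancherelRows

open MeasureTheory Filter Topology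

/-! ### Nuclear expansions of differences of projections -/

/-- Multiplication by `exp (-u / z)`. -/
abbrev psiOp (u : ℝ) : L2Circle →L[ℂ] L2Circle := mulOp (fexp (-1) (-u))

/-- Multiplication by `exp (u z)`. -/
abbrev chiOp (u : ℝ) : L2Circle →L[ℂ] L2Circle := mulOp (fexp 1 u)

/-- Conjugation inverts `z` on the circle, so the adjoint of `exp (-u / z)` is `exp (-u z)`, the
inverse of `exp (u z)`. The systems `exp (-u / z) z^i` and `exp (u z) z^j` are therefore
biorthogonal. -/
theorem inner_psiOp_chiOp (u : ℝ) (x y : L2Circle) :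
    inner ℂ (psiOp u x) (chiOp u y) = inner ℂ x y := by
  rw [inner_mulOp_left, star_fexp, neg_neg, mulOp_fexp_neg_mulOp_fexp]

/-- The properties of the orthogonal projection onto the span of `exp (-u / z) z^j`, `j ∈ J`, that
are needed for the nuclear expansion. -/
structure IsCut (u : ℝ) (J : Set ℕ) (Q : L2Circle →L[ℂ] L2Circle) : Prop where
  norm_le : ∀ x, ‖Q x‖ ≤ ‖x‖
  norm_sub_le : ∀ x, ‖x - Q x‖ ≤ ‖x‖
  lower : ∀ i j, i ≤ j → j ∈ J → i ∈ J
  fix : ∀ j ∈ J, Q (psiOp u (fBasis j)) = psiOp u (fBasis j)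
  kill : ∀ j : ℕ, Q (chiOp u (fBasis (-1 - j))) = 0
  top : ∀ j : ℕ, j ∉ J → Q (fBasis j) = 0

/-- The span of `exp (-u / z) z^j`, `j < M`. -/
def cutSpace (u : ℝ) (M : ℕ) : Submodule ℂ L2Circle :=
  Submodule.span ℂ (Set.range fun j : Fin M => psiOp u (fBasis j))

instance (u : ℝ) (M : ℕ) : FiniteDimensional ℂ (cutSpace u M) :=
  FiniteDimensional.span_of_finite ℂ (Set.finite_range _)

/-- The orthogonal projection onto the span of `exp (-u / z) z^j`, `j < M`. -/
def cutProj (u : ℝ) (M : ℕ) : L2Circle →L[ℂ] L2Circle := (cutSpace u M).starProjection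

/-- The orthogonal projection onto the closed span of `exp (-u / z) z^j`, `j ≥ 0`. -/
def fullProj (u : ℝ) : L2Circle →L[ℂ] L2Circle :=
  (⨆ M, cutSpace u M).topologicalClosure.starProjection

theorem cutSpace_mono (u : ℝ) : Monotone (cutSpace u) := by
  intro M M' h
  refine Submodule.span_le.2 ?_
  rintro _ ⟨j, rfl⟩
  exact Submodule.subset_span ⟨⟨j, j.2.trans_le h⟩, rfl⟩

theorem tendsto_cutProj (u : ℝ) (x : L2Circle) :
    Tendsto (fun M => cutProj u M x) atTop (𝓝 (fullProj u x)) :=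
  Submodule.starProjection_tendsto_closure_iSup (cutSpace u) (cutSpace_mono u) x

theorem cutProj_eq_zero {u : ℝ} {M : ℕ} {x : L2Circle}
    (h : ∀ j : Fin M, inner ℂ (psiOp u (fBasis j)) x = 0) : cutProj u M x = 0 := by
  rw [cutProj, Submodule.starProjection_apply_eq_zero_iff, Submodule.mem_orthogonal]
  intro y hy
  induction hy using Submodule.span_induction with
  | mem y hy => obtain ⟨j, rfl⟩ := hy; exact h j
  | zero => exact inner_zero_left _
  | add a b _ _ ha hb => rw [inner_add_left, ha, hb, add_zero]
  | smul c a _ ha => rw [inner_smul_left, ha, mul_zero]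

/-- `kill` is biorthogonality with `exp (u z) z^(-1-j)`; `top` holds because `exp (-u / z) z^i`
contains only powers up to `i`. -/
theorem isCut_cutProj (u : ℝ) (M : ℕ) : IsCut u (Set.Iio M) (cutProj u M) where
  norm_le x := (cutSpace u M).norm_starProjection_apply_le x
  norm_sub_le x := by
    rw [cutProj, ← Submodule.starProjection_orthogonal_val]
    exact Submodule.norm_starProjection_apply_le _ x
  lower i j hij hj := lt_of_le_of_lt hij hj
  fix j hj := Submodule.starProjection_eq_self_iff.2 (Submodule.subset_span ⟨⟨j, hj⟩, rfl⟩)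
  kill j := cutProj_eq_zero fun i => by
    rw [inner_psiOp_chiOp, inner_fBasis, if_neg (by omega)]
  top j hj := cutProj_eq_zero fun i => by
    have h := inner_fBasis_mulOp_fexp (-u) j 0 (j - i)
    have hlt : (i : ℕ) < j := i.2.trans_le (not_lt.1 hj)
    have hz : powFact (-u) 0 (j - i) = 0 := by simp [powFact, invFact]; omega
    rw [hz, show ((j : ℤ) - ((0 : ℕ) : ℤ)) = j by simp,
      show ((j : ℤ) - ((j - i : ℕ) : ℤ)) = i by omega] at h
    rw [← inner_conj_symm, h]
    simp

/-- `fix` and `kill` pass to the strong limit of the finite cuts, and `top` is vacuous. -/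
theorem isCut_fullProj (u : ℝ) : IsCut u Set.univ (fullProj u) where
  norm_le x := Submodule.norm_starProjection_apply_le _ x
  norm_sub_le x := by
    rw [fullProj, ← Submodule.starProjection_orthogonal_val]
    exact Submodule.norm_starProjection_apply_le _ x
  lower _ _ _ _ := trivial
  fix j _ := by
    refine tendsto_nhds_unique (tendsto_cutProj u _) (tendsto_const_nhds.congr' ?_)
    filter_upwards [eventually_gt_atTop j] with M hM
    exact ((isCut_cutProj u M).fix j hM).symm
  kill j := by
    refine tendsto_nhds_unique (tendsto_cutProj u _) ?_
    simp_rw [(isCut_cutProj u _).kill]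
    exact tendsto_const_nhds
  top j hj := (hj trivial).elim

/-- The index type of the nuclear expansion. -/
abbrev NucIndex (n : ℕ) : Type := (ℕ × ℕ) ⊕ ((ℕ × ℕ) ⊕ Fin n)

/-- The left vectors of the nuclear expansion. -/
def nucLeft (u : ℝ) (n : ℕ) (Q : L2Circle →L[ℂ] L2Circle) : NucIndex n → L2Circle
  | Sum.inl (_, l) => Q (chiOp u (fBasis l))
  | Sum.inr (Sum.inl (_, l)) => -(psiOp u (fBasis (-1 - l)) - Q (psiOp u (fBasis (-1 - l))))
  | Sum.inr (Sum.inr r) => -(fBasis (-1 - (r : ℕ)) - Q (fBasis (-1 - (r : ℕ))))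

open Classical in
/-- The right vectors of the nuclear expansion. -/
def nucRight (u : ℝ) (n : ℕ) (J : Set ℕ) : NucIndex n → L2Circle
  | Sum.inl (j, l) => if n ≤ j then expCoeff (-u) (j + l + 1) • fBasis (-1 - j) else 0
  | Sum.inr (Sum.inl (j, l)) => if j ∈ J then expCoeff u (j + l + 1) • fBasis j else 0
  | Sum.inr (Sum.inr r) => fBasis (-1 - (r : ℕ))

/-- A summable bound for the terms of the nuclear expansion. -/
def nucBound (u : ℝ) (n : ℕ) : NucIndex n → ℝ
  | Sum.inl (j, l) => ‖chiOp u‖ * ‖expCoeff (-u) (j + l + 1)‖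
  | Sum.inr (Sum.inl (j, l)) => ‖psiOp u‖ * ‖expCoeff u (j + l + 1)‖
  | Sum.inr (Sum.inr _) => 1

/-- `j! l! ≤ (j + l + 1)!` bounds the Hankel coefficients by a product of two exponential series. -/
theorem summable_expCoeff (v : ℝ) :
    Summable fun p : ℕ × ℕ => ‖expCoeff v (p.1 + p.2 + 1)‖ := by
  have h := (Real.summable_pow_div_factorial |v|).mul_of_nonneg
    (Real.summable_pow_div_factorial |v|) (fun _ => by positivity) (fun _ => by positivity)
  refine Summable.of_nonneg_of_le (fun _ => norm_nonneg _) (fun p => ?_) (h.mul_left |v|)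
  rw [expCoeff, Complex.norm_real, Real.norm_eq_abs, abs_div, abs_pow, Nat.abs_cast]
  have h1 : (p.1.factorial : ℝ) * p.2.factorial ≤ (p.1 + p.2 + 1).factorial := by
    have h2 := Nat.le_of_dvd (Nat.factorial_pos _)
      (Nat.factorial_mul_factorial_dvd_factorial_add p.1 p.2)
    have h3 := Nat.factorial_le (Nat.le_succ (p.1 + p.2))
    exact_mod_cast h2.trans h3
  calc |v| ^ (p.1 + p.2 + 1) / ((p.1 + p.2 + 1).factorial : ℝ)
      ≤ |v| ^ (p.1 + p.2 + 1) / (p.1.factorial * p.2.factorial) :=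
        div_le_div_of_nonneg_left (by positivity) (by positivity) h1
    _ = _ := by
        rw [pow_succ, pow_add]
        field_simp

theorem summable_nucBound (u : ℝ) (n : ℕ) : Summable (nucBound u n) := by
  refine Summable.sum _ ?_ (Summable.sum _ ?_ ?_)
  · exact (summable_expCoeff (-u)).mul_left ‖chiOp u‖
  · exact (summable_expCoeff u).mul_left ‖psiOp u‖
  · exact Summable.of_finite

theorem nucBound_nonneg (u : ℝ) (n : ℕ) : 0 ≤ nucBound u n := by
  rintro (⟨j, l⟩ | ⟨j, l⟩ | r)
  · exact mul_nonneg (norm_nonneg _) (norm_nonneg _)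
  · exact mul_nonneg (norm_nonneg _) (norm_nonneg _)
  · exact zero_le_one

variable {u : ℝ} {n : ℕ} {J : Set ℕ} {Q : L2Circle →L[ℂ] L2Circle}

/-- The bound involves neither `Q` nor `J`, as dominated convergence in `tendsto_minorSum_cut`
requires. -/
theorem norm_nucLeft_mul_norm_nucRight_le (hQ : IsCut u J Q) (i : NucIndex n) :
    ‖nucLeft u n Q i‖ * ‖nucRight u n J i‖ ≤ nucBound u n i := by
  rcases i with ⟨j, l⟩ | ⟨j, l⟩ | r
  · refine mul_le_mul ?_ ?_ (norm_nonneg _) (norm_nonneg _)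
    · refine (hQ.norm_le _).trans ((ContinuousLinearMap.le_opNorm _ _).trans ?_)
      rw [norm_fBasis, mul_one]
    · simp only [nucRight]
      split_ifs
      · rw [norm_smul, norm_fBasis, mul_one]
      · simp
  · refine mul_le_mul ?_ ?_ (norm_nonneg _) (norm_nonneg _)
    · simp only [nucLeft, norm_neg]
      refine (hQ.norm_sub_le _).trans ((ContinuousLinearMap.le_opNorm _ _).trans ?_)
      rw [norm_fBasis, mul_one]
    · simp only [nucRight]
      split_ifs
      · rw [norm_smul, norm_fBasis, mul_one]
      · simp
  · simp only [nucLeft, nucRight, nucBound, norm_neg, norm_fBasis, mul_one]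
    exact (hQ.norm_sub_le _).trans (norm_fBasis _).le

theorem summable_nuc (hQ : IsCut u J Q) :
    Summable fun i => ‖nucLeft u n Q i‖ * ‖nucRight u n J i‖ :=
  Summable.of_nonneg_of_le (fun _ => by positivity) (norm_nucLeft_mul_norm_nucRight_le hQ)
    (summable_nucBound u n)

/-- The image of a negative monomial under a cut. -/
theorem IsCut.hasSum_neg (hQ : IsCut u J Q) (j : ℕ) :
    HasSum (fun l : ℕ => expCoeff (-u) (j + l + 1) • Q (chiOp u (fBasis l)))
      (Q (fBasis (-1 - j))) := by
  -- Write `z^(-1-j)` as `exp (u z)` times the expansion of `exp (-u z) z^(-1-j)`; by `kill` the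
  -- terms with negative powers drop out.
  have h := (hasSum_mulOp_fexp 1 (-u) (-1 - j)).mapL (Q.comp (chiOp u))
  rw [ContinuousLinearMap.comp_apply, mulOp_fexp_mulOp_fexp_neg] at h
  have hinj : Function.Injective fun l : ℕ => j + l + 1 := fun a b h => by simpa using h
  rw [← hinj.hasSum_iff] at h
  · refine h.congr_fun fun l => ?_
    simp only [Function.comp_apply, map_smul, ContinuousLinearMap.comp_apply]
    congr 4
    push_cast
    ring
  · intro m hm
    have hle : m ≤ j := by
      by_contra! hlt
      exact hm ⟨m - j - 1, by simp; omega⟩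
    have hk := hQ.kill (j - m)
    rw [map_smul, ContinuousLinearMap.comp_apply,
      show (-1 - (j : ℤ) + m * 1) = -1 - ((j - m : ℕ) : ℤ) by omega, hk, smul_zero]

/-- The defect of a nonnegative monomial under a cut. -/
theorem IsCut.hasSum_nonneg (hQ : IsCut u J Q) {j : ℕ} (hj : j ∈ J) :
    HasSum (fun l : ℕ => expCoeff u (j + l + 1) •
      (-(psiOp u (fBasis (-1 - l)) - Q (psiOp u (fBasis (-1 - l))))))
      (-(fBasis j - Q (fBasis j))) := by
  set D : L2Circle →L[ℂ] L2Circle := -(ContinuousLinearMap.id ℂ L2Circle - Q)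
  have hD : ∀ x, D x = -(x - Q x) := fun x => rfl
  -- Write `z^j` as `exp (-u / z)` times the expansion of `exp (u / z) z^j`; the terms with
  -- nonnegative powers are fixed by `Q` and have no defect.
  have h := (hasSum_mulOp_fexp (-1) u j).mapL (D.comp (psiOp u))
  rw [ContinuousLinearMap.comp_apply, mulOp_fexp_neg_mulOp_fexp, hD] at h
  have hinj : Function.Injective fun l : ℕ => j + l + 1 := fun a b h => by simpa using h
  rw [← hinj.hasSum_iff] at h
  · refine h.congr_fun fun l => ?_
    simp only [Function.comp_apply, map_smul, ContinuousLinearMap.comp_apply]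
    rw [show (j : ℤ) + (j + l + 1 : ℕ) * -1 = -1 - l by push_cast; ring, hD]
  · intro m hm
    have hle : m ≤ j := by
      by_contra! hlt
      exact hm ⟨m - j - 1, by simp; omega⟩
    have hk := hQ.fix (j - m) (hQ.lower _ _ (Nat.sub_le _ _) hj)
    rw [map_smul, ContinuousLinearMap.comp_apply, hD,
      show ((j : ℤ) + m * -1) = ((j - m : ℕ) : ℤ) by omega, hk, sub_self, neg_zero, smul_zero]

theorem hasSum_prod_of_fst_eq {E : Type*} [AddCommMonoid E] [TopologicalSpace E]
    {f : ℕ × ℕ → E} {a : E} (j₀ : ℕ) (h0 : ∀ j l, j ≠ j₀ → f (j, l) = 0)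
    (h : HasSum (fun l => f (j₀, l)) a) : HasSum f a := by
  have hinj : Function.Injective fun l : ℕ => (j₀, l) := fun a b h => (Prod.mk.inj h).2
  rw [← hinj.hasSum_iff]
  · exact h
  · rintro ⟨j, l⟩ hp
    refine h0 j l fun hj => hp ⟨l, by rw [hj]⟩

/-- The nuclear expansion of `Q - R`, where `R` is the projection onto the span of `z^k` with
`-n ≤ k < 0` or `k ∈ J`. -/
theorem IsCut.hasSum_nuclear (hQ : IsCut u J Q) {T : L2Circle →L[ℂ] L2Circle}
    (hneg : ∀ j : ℕ, T (fBasis (-1 - j)) =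
      Q (fBasis (-1 - j)) - if j < n then fBasis (-1 - j) else 0)
    (hmem : ∀ j ∈ J, T (fBasis (j : ℕ)) = Q (fBasis j) - fBasis j)
    (hnot : ∀ j : ℕ, j ∉ J → T (fBasis j) = 0) (v : L2Circle) :
    HasSum (fun i => inner ℂ (nucRight u n J i) v • nucLeft u n Q i) (T v) := by
  classical
  refine hasSum_nuclear_of_basis fBasis (summable_nuc hQ) (fun k => ?_) v
  have hcoeff : ∀ (w : ℝ) (m : ℕ), (starRingEnd ℂ) (expCoeff w m) = expCoeff w m := fun w m => by
    rw [expCoeff, Complex.conj_ofReal]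
  -- Orthonormality leaves at most one family of terms on `z^k`: a single rank one term for `-n ≤ k
  -- < 0`, the expansion of `Q` for `k < -n`, that of `Q - 1` for `k ∈ J`, and nothing for the
  -- remaining `k`.
  rcases lt_or_ge k 0 with hk | hk
  · obtain ⟨j₀, rfl⟩ : ∃ j₀ : ℕ, k = -1 - j₀ := ⟨(-1 - k).toNat, by omega⟩
    have h2 : HasSum ((fun i : NucIndex n => inner ℂ (nucRight u n J i) (fBasis (-1 - j₀)) •
        nucLeft u n Q i) ∘ Sum.inr ∘ Sum.inl) 0 := by
      refine hasSum_zero.congr_fun ?_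
      rintro ⟨j, l⟩
      simp only [Function.comp_apply, nucRight]
      split_ifs
      · rw [inner_smul_left, inner_fBasis, if_neg (by omega), mul_zero, zero_smul]
      · rw [inner_zero_left, zero_smul]
    rw [hneg]
    by_cases hj : j₀ < n
    · have h1 : HasSum ((fun i : NucIndex n => inner ℂ (nucRight u n J i) (fBasis (-1 - j₀)) •
          nucLeft u n Q i) ∘ Sum.inl) 0 := by
        refine hasSum_zero.congr_fun ?_
        rintro ⟨j, l⟩
        simp only [Function.comp_apply, nucRight]
        split_ifs
        · rw [inner_smul_left, inner_fBasis, if_neg (by omega), mul_zero, zero_smul]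
        · rw [inner_zero_left, zero_smul]
      have h3 : HasSum ((fun i : NucIndex n => inner ℂ (nucRight u n J i) (fBasis (-1 - j₀)) •
          nucLeft u n Q i) ∘ Sum.inr ∘ Sum.inr) (Q (fBasis (-1 - j₀)) - fBasis (-1 - j₀)) := by
        have h4 := hasSum_ite_eq (⟨j₀, hj⟩ : Fin n) (Q (fBasis (-1 - j₀)) - fBasis (-1 - j₀))
        refine h4.congr_fun fun r => ?_
        simp only [Function.comp_apply, nucRight, nucLeft, inner_fBasis]
        by_cases hr : r = ⟨j₀, hj⟩
        · subst hr
          simp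
        · have : ¬ (-1 - ((r : ℕ) : ℤ) = -1 - (j₀ : ℤ)) := fun h => hr (Fin.ext (by simp; omega))
          rw [if_neg this, if_neg hr, zero_smul]
      have := h1.sum (f := fun i : NucIndex n => inner ℂ (nucRight u n J i) (fBasis (-1 - j₀)) •
          nucLeft u n Q i) (HasSum.sum h2 h3)
      rw [if_pos hj]
      simpa using this
    · have h1 : HasSum ((fun i : NucIndex n => inner ℂ (nucRight u n J i) (fBasis (-1 - j₀)) •
          nucLeft u n Q i) ∘ Sum.inl) (Q (fBasis (-1 - j₀))) := by
        refine hasSum_prod_of_fst_eq j₀ (fun j l hjl => ?_) ?_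
        · simp only [Function.comp_apply, nucRight]
          split_ifs
          · rw [inner_smul_left, inner_fBasis, if_neg (by omega), mul_zero, zero_smul]
          · rw [inner_zero_left, zero_smul]
        · refine (hQ.hasSum_neg j₀).congr_fun fun l => ?_
          simp only [Function.comp_apply, nucRight, nucLeft]
          rw [if_pos (by omega), inner_smul_left, inner_fBasis, if_pos rfl, mul_one, hcoeff]
      have h3 : HasSum ((fun i : NucIndex n => inner ℂ (nucRight u n J i) (fBasis (-1 - j₀)) •
          nucLeft u n Q i) ∘ Sum.inr ∘ Sum.inr) 0 := by
        refine hasSum_zero.congr_fun fun r => ?_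
        have := r.2
        simp only [Function.comp_apply, nucRight, inner_fBasis]
        rw [if_neg (by omega), zero_smul]
      have := h1.sum (f := fun i : NucIndex n => inner ℂ (nucRight u n J i) (fBasis (-1 - j₀)) •
          nucLeft u n Q i) (HasSum.sum h2 h3)
      rw [if_neg hj]
      simpa using this
  · obtain ⟨j₀, rfl⟩ : ∃ j₀ : ℕ, k = j₀ := ⟨k.toNat, by omega⟩
    have h1 : HasSum ((fun i : NucIndex n => inner ℂ (nucRight u n J i) (fBasis j₀) •
        nucLeft u n Q i) ∘ Sum.inl) 0 := by
      refine hasSum_zero.congr_fun ?_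
      rintro ⟨j, l⟩
      simp only [Function.comp_apply, nucRight]
      split_ifs
      · rw [inner_smul_left, inner_fBasis, if_neg (by omega), mul_zero, zero_smul]
      · rw [inner_zero_left, zero_smul]
    have h3 : HasSum ((fun i : NucIndex n => inner ℂ (nucRight u n J i) (fBasis j₀) •
        nucLeft u n Q i) ∘ Sum.inr ∘ Sum.inr) 0 := by
      refine hasSum_zero.congr_fun fun r => ?_
      simp only [Function.comp_apply, nucRight, inner_fBasis]
      rw [if_neg (by omega), zero_smul]
    have h2 : HasSum ((fun i : NucIndex n => inner ℂ (nucRight u n J i) (fBasis j₀) •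
        nucLeft u n Q i) ∘ Sum.inr ∘ Sum.inl) (T (fBasis j₀)) := by
      by_cases hj : j₀ ∈ J
      · rw [hmem j₀ hj, ← neg_sub]
        refine hasSum_prod_of_fst_eq j₀ (fun j l hjl => ?_) ?_
        · simp only [Function.comp_apply, nucRight]
          split_ifs
          · rw [inner_smul_left, inner_fBasis, if_neg (by omega), mul_zero, zero_smul]
          · rw [inner_zero_left, zero_smul]
        · refine (hQ.hasSum_nonneg hj).congr_fun fun l => ?_
          simp only [Function.comp_apply, nucRight, nucLeft]
          rw [if_pos hj, inner_smul_left, inner_fBasis, if_pos rfl, mul_one, hcoeff]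
      · rw [hnot j₀ hj]
        refine hasSum_zero.congr_fun ?_
        rintro ⟨j, l⟩
        simp only [Function.comp_apply, nucRight]
        split_ifs with hjJ
        · rw [inner_smul_left, inner_fBasis, if_neg (fun h => hj ?_), mul_zero, zero_smul]
          have : j = j₀ := by omega
          rwa [← this]
        · rw [inner_zero_left, zero_smul]
    have := h1.sum (f := fun i : NucIndex n => inner ℂ (nucRight u n J i) (fBasis j₀) •
          nucLeft u n Q i) (HasSum.sum h2 h3)
    simpa using this

/-- The sums of principal minors for the finite cuts converge to the one for the full cut. -/
theorem tendsto_minorSum_cut (u : ℝ) (n : ℕ) (c : ℂ) :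
    Tendsto (fun M => minorSum fun i j => inner ℂ (nucRight u n (Set.Iio M) i)
      (c • nucLeft u n (cutProj u M) j)) atTop
      (𝓝 (minorSum fun i j => inner ℂ (nucRight u n Set.univ i)
        (c • nucLeft u n (fullProj u) j))) := by
  classical
  -- One index set and one bound serve all `M`, so convergence of each inner product suffices, and
  -- this follows from strong convergence of the projections.
  refine tendsto_minorSum ((summable_nucBound u n).mul_left ‖c‖)
    (fun i => mul_nonneg (norm_nonneg _) (nucBound_nonneg u n i)) (fun M S => ?_) fun i j => ?_
  · refine (norm_principalMinor_inner_le (fun i => c • nucLeft u n (cutProj u M) i) _ S).trans ?_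
    refine Finset.prod_le_prod (fun _ _ => by positivity) fun i _ => ?_
    rw [norm_smul, mul_assoc]
    exact mul_le_mul_of_nonneg_left
      (norm_nucLeft_mul_norm_nucRight_le (isCut_cutProj u M) i) (norm_nonneg _)
  · have hr : Tendsto (fun M => nucRight u n (Set.Iio M) i) atTop
        (𝓝 (nucRight u n Set.univ i)) := by
      rcases i with ⟨a, l⟩ | ⟨a, l⟩ | r
      · exact tendsto_const_nhds
      · refine tendsto_const_nhds.congr' ?_
        filter_upwards [eventually_gt_atTop a] with M hM
        simp only [nucRight]
        rw [if_pos (Set.mem_univ a), if_pos (Set.mem_Iio.2 hM)]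
      · exact tendsto_const_nhds
    have hl : Tendsto (fun M => nucLeft u n (cutProj u M) j) atTop
        (𝓝 (nucLeft u n (fullProj u) j)) := by
      rcases j with ⟨a, l⟩ | ⟨a, l⟩ | r
      · exact tendsto_cutProj u _
      · exact (tendsto_const_nhds.sub (tendsto_cutProj u _)).neg
      · exact (tendsto_const_nhds.sub (tendsto_cutProj u _)).neg
    exact hr.inner (hl.const_smul c)

end PlancherelRows

end

noncomputable section

namespace PlancherelRows

open MeasureTheory Filter Topology

/-! ### Determinants of differences of finite rank projections -/

section Blocks

variable {m p : Type*} [Fintype m] [DecidableEq m] [Fintype p] [DecidableEq p]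

/-- The determinant of `1 - c (Q - R)` for projections `Q`, `R` of finite rank, in terms of a Gram
matrix `T` of a basis of the range of `Q` and its inner products `C` with an orthonormal basis of
the range of `R`. -/
theorem det_fromBlocks_projections (T : Matrix m m ℂ) (hT : T.det ≠ 0) (C : Matrix p m ℂ) (c : ℂ)
    (hc : 1 + c ≠ 0) :
    (1 + c) ^ Fintype.card m * (Matrix.fromBlocks ((1 - c) • (1 : Matrix m m ℂ))
        (c • (T⁻¹ * C.conjTranspose)) (-(c • C)) ((1 + c) • (1 : Matrix p p ℂ))).det =
      (1 + c) ^ Fintype.card p *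
        (((1 - c ^ 2) • T + c ^ 2 • (C.conjTranspose * C)).det / T.det) := by
  let _ : Invertible ((1 + c) • (1 : Matrix p p ℂ)) :=
    ⟨(1 + c)⁻¹ • 1, by simp [smul_smul, hc], by simp [smul_smul, hc]⟩
  have hinv : ⅟((1 + c) • (1 : Matrix p p ℂ)) = (1 + c)⁻¹ • 1 := rfl
  have hTu : IsUnit T.det := isUnit_iff_ne_zero.2 hT
  -- Schur complement of the block `(1 + c) • 1`. The factor `(1 + c) ^ card m` is absorbed into the
  -- complement `(1 - c) + c² / (1 + c) • T⁻¹ C* C`, which becomes `T⁻¹` times the matrix on the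
  -- right.
  rw [Matrix.det_fromBlocks₂₂, hinv, Matrix.det_smul, Matrix.det_one, mul_one, mul_left_comm]
  congr 1
  rw [← Matrix.det_smul]
  have h1 : (1 + c) • ((1 - c) • (1 : Matrix m m ℂ) -
      c • (T⁻¹ * C.conjTranspose) * ((1 + c)⁻¹ • (1 : Matrix p p ℂ)) * -(c • C)) =
      T⁻¹ * ((1 - c ^ 2) • T + c ^ 2 • (C.conjTranspose * C)) := by
    have h2 : T⁻¹ * ((1 - c ^ 2) • T + c ^ 2 • (C.conjTranspose * C)) =
        (1 - c ^ 2) • 1 + c ^ 2 • (T⁻¹ * C.conjTranspose * C) := by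
      rw [Matrix.mul_add, Matrix.mul_smul, Matrix.nonsing_inv_mul T hTu, Matrix.mul_smul,
        ← Matrix.mul_assoc]
    rw [h2]
    simp only [Matrix.smul_mul, Matrix.mul_smul, Matrix.mul_neg, Matrix.mul_one, sub_neg_eq_add,
      smul_add, smul_smul]
    congr 2
    · ring
    · field_simp
  rw [h1, Matrix.det_mul, Matrix.det_nonsing_inv, Ring.inverse_eq_inv', div_eq_inv_mul]

end Blocks

/-! ### The finite rank approximations -/

variable (u : ℝ) (n M : ℕ)

/-- The vectors `exp (-u / z) z^l`, `l < M`. -/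
def cutVec (l : Fin M) : L2Circle := psiOp u (fBasis (l : ℕ))

/-- The monomials `z^k`, `-n ≤ k < M`. -/
def rangeVec (r : Fin (M + n)) : L2Circle := fBasis ((r : ℕ) - n)

theorem linearIndependent_cutVec : LinearIndependent ℂ (cutVec u M) := by
  have h1 : LinearIndependent ℂ fun l : Fin M => fBasis ((l : ℕ) : ℤ) :=
    fBasis.orthonormal.linearIndependent.comp (fun l : Fin M => ((l : ℕ) : ℤ))
      fun a b h => Fin.ext (by
        have h' : ((a : ℕ) : ℤ) = b := h
        exact_mod_cast h')
  refine h1.map' (psiOp u).toLinearMap (LinearMap.ker_eq_bot.2 ?_)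
  intro x y h
  have h' : psiOp u x = psiOp u y := h
  rw [← mulOp_fexp_mulOp_fexp_neg (-1) u x, ← mulOp_fexp_mulOp_fexp_neg (-1) u y]
  exact congrArg _ h'

theorem det_gram_cutVec_ne_zero : (Matrix.gram ℂ (cutVec u M)).det ≠ 0 :=
  Matrix.det_gram_ne_zero_iff_linearIndependent.2 (linearIndependent_cutVec u M)

/-- The dual basis of `cutVec`. -/
def dualVec (l : Fin M) : L2Circle :=
  ∑ k, star ((Matrix.gram ℂ (cutVec u M))⁻¹ l k) • cutVec u M k

theorem inner_dualVec (l : Fin M) (x : L2Circle) :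
    inner ℂ (dualVec u M l) x =
      ∑ k, (Matrix.gram ℂ (cutVec u M))⁻¹ l k * inner ℂ (cutVec u M k) x := by
  rw [dualVec, sum_inner]
  refine Finset.sum_congr rfl fun k _ => ?_
  rw [inner_smul_left]
  simp

theorem inner_dualVec_cutVec (l k : Fin M) :
    inner ℂ (dualVec u M l) (cutVec u M k) = if l = k then 1 else 0 := by
  rw [inner_dualVec]
  have h := Matrix.nonsing_inv_mul (Matrix.gram ℂ (cutVec u M))
    (isUnit_iff_ne_zero.2 (det_gram_cutVec_ne_zero u M))
  have := congrFun (congrFun h l) k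
  rw [Matrix.mul_apply, Matrix.one_apply] at this
  exact this

theorem cutProj_eq_sum (x : L2Circle) :
    cutProj u M x = ∑ l, inner ℂ (dualVec u M l) x • cutVec u M l := by
  refine Submodule.eq_starProjection_of_mem_of_inner_eq_zero
    (Submodule.sum_mem _ fun l _ => Submodule.smul_mem _ _ (Submodule.subset_span ⟨l, rfl⟩)) ?_
  have hbase : ∀ j : Fin M, inner ℂ (cutVec u M j)
      (x - ∑ l, inner ℂ (dualVec u M l) x • cutVec u M l) = 0 := by
    intro j
    rw [inner_sub_right, inner_sum, sub_eq_zero]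
    simp_rw [inner_smul_right, inner_dualVec, Finset.sum_mul]
    rw [Finset.sum_comm]
    have h := Matrix.mul_nonsing_inv (Matrix.gram ℂ (cutVec u M))
      (isUnit_iff_ne_zero.2 (det_gram_cutVec_ne_zero u M))
    have h2 : ∀ k, ∑ l, (Matrix.gram ℂ (cutVec u M))⁻¹ l k * inner ℂ (cutVec u M k) x *
        inner ℂ (cutVec u M j) (cutVec u M l) =
        (if j = k then 1 else 0) * inner ℂ (cutVec u M k) x := fun k => by
      have h3 := congrFun (congrFun h j) k
      rw [Matrix.mul_apply, Matrix.one_apply] at h3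
      rw [← h3, Finset.sum_mul]
      refine Finset.sum_congr rfl fun l _ => ?_
      rw [Matrix.gram_apply]
      ring
    simp_rw [h2]
    simp
  intro w hw
  rw [← inner_conj_symm]
  suffices inner ℂ w (x - ∑ l, inner ℂ (dualVec u M l) x • cutVec u M l) = 0 by
    rw [this, map_zero]
  induction hw using Submodule.span_induction with
  | mem y hy => obtain ⟨j, rfl⟩ := hy; exact hbase j
  | zero => exact inner_zero_left _
  | add a b _ _ ha hb => rw [inner_add_left, ha, hb, add_zero]
  | smul c a _ ha => rw [inner_smul_left, ha, mul_zero]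

/-- The difference of the finite cut and the projection onto `z^k`, `-n ≤ k < M`. -/
def cutDiff : L2Circle →L[ℂ] L2Circle :=
  cutProj u M - ∑ r, InnerProductSpace.rankOne ℂ (rangeVec n M r) (rangeVec n M r)

theorem cutDiff_apply (x : L2Circle) : cutDiff u n M x =
    cutProj u M x - ∑ r, inner ℂ (rangeVec n M r) x • rangeVec n M r := by
  simp [cutDiff]

theorem sum_rangeVec (k : ℤ) :
    ∑ r, inner ℂ (rangeVec n M r) (fBasis k) • rangeVec n M r =
      if -(n : ℤ) ≤ k ∧ k < M then fBasis k else 0 := by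
  simp only [rangeVec, inner_fBasis]
  split_ifs with h
  · let r₀ : Fin (M + n) := ⟨(k + n).toNat, by omega⟩
    rw [Finset.sum_eq_single r₀]
    · have : (((r₀ : ℕ) : ℤ) - n) = k := by simp only [r₀]; omega
      rw [this, if_pos rfl, one_smul]
    · intro r _ hr
      rw [if_neg (fun h' => hr (Fin.ext (by simp only [r₀]; omega))), zero_smul]
    · simp
  · refine Finset.sum_eq_zero fun r _ => ?_
    have := r.2
    rw [if_neg (by omega), zero_smul]

/-- On `z^k` with `k ≥ M` both projections vanish, so the expansion with `J = {j < M}` applies. -/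
theorem hasSum_nuclear_cutDiff (x : L2Circle) :
    HasSum (fun i => inner ℂ (nucRight u n (Set.Iio M) i) x • nucLeft u n (cutProj u M) i)
      (cutDiff u n M x) := by
  refine (isCut_cutProj u M).hasSum_nuclear (fun j => ?_) (fun j hj => ?_) (fun j hj => ?_) x
  · rw [cutDiff_apply, sum_rangeVec]
    congr 1
    exact if_congr (by omega) rfl rfl
  · have : j < M := hj
    rw [cutDiff_apply, sum_rangeVec, if_pos (by omega)]
  · have : ¬ j < M := hj
    rw [cutDiff_apply, sum_rangeVec, if_neg (by omega), (isCut_cutProj u M).top j hj, sub_zero]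

/-- The matrix of inner products of `rangeVec` and `cutVec`. -/
def crossMatrix : Matrix (Fin (M + n)) (Fin M) ℂ :=
  Matrix.of fun r l => inner ℂ (rangeVec n M r) (cutVec u M l)

/-- The Fredholm determinant of the finite rank approximations. -/
theorem hasFredholmDet_cutDiff (c : ℂ) (hc : 1 + c ≠ 0) :
    HasFredholmDet (c • cutDiff u n M) ((1 + c) ^ n *
      (((1 - c ^ 2) • Matrix.gram ℂ (cutVec u M) +
        c ^ 2 • ((crossMatrix u n M).conjTranspose * crossMatrix u n M)).det /
          (Matrix.gram ℂ (cutVec u M)).det)) := by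
  classical
  -- A second representation with only `2M + n` terms: the cut through `cutVec` and its dual basis,
  -- the other projection through the orthonormal `rangeVec`. Its inner products form the block
  -- matrix of `det_fromBlocks_projections`.
  let x : Fin M ⊕ Fin (M + n) → L2Circle :=
    Sum.elim (fun l => c • cutVec u M l) fun r => -(c • rangeVec n M r)
  let y : Fin M ⊕ Fin (M + n) → L2Circle := Sum.elim (dualVec u M) (rangeVec n M)
  have hT : ∀ v, HasSum (fun i => inner ℂ (y i) v • x i) ((c • cutDiff u n M) v) := fun v => by
    have h1 : (c • cutDiff u n M) v = ∑ i, inner ℂ (y i) v • x i := by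
      rw [Fintype.sum_sum_type]
      simp only [x, y, Sum.elim_inl, Sum.elim_inr, smul_apply, cutDiff_apply,
        cutProj_eq_sum, smul_sub, Finset.smul_sum, smul_neg, Finset.sum_neg_distrib,
        ← sub_eq_add_neg]
      congr 1 <;> exact Finset.sum_congr rfl fun i _ => smul_comm _ _ _
    rw [h1]
    exact hasSum_fintype _
  have h := hasFredholmDet_of_nuclear (x := x) (y := y) Summable.of_finite hT
  convert h using 1
  have hm : minorSum (fun i j => inner ℂ (y i) (x j)) =
      (1 - Matrix.of fun i j => inner ℂ (y i) (x j)).det := minorSum_of_fintype _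
  rw [hm]
  have hrange : ∀ r s, inner ℂ (rangeVec n M r) (rangeVec n M s) = if r = s then (1 : ℂ) else 0 :=
    fun r s => by
      rw [rangeVec, rangeVec, inner_fBasis]
      exact if_congr (by rw [Fin.ext_iff]; omega) rfl rfl
  have hblock : (1 - Matrix.of fun i j => inner ℂ (y i) (x j)) =
      Matrix.fromBlocks ((1 - c) • (1 : Matrix (Fin M) (Fin M) ℂ))
        (c • ((Matrix.gram ℂ (cutVec u M))⁻¹ * (crossMatrix u n M).conjTranspose))
        (-(c • crossMatrix u n M)) ((1 + c) • (1 : Matrix (Fin (M + n)) (Fin (M + n)) ℂ)) := by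
    ext (i | i) (j | j)
    · simp only [Matrix.sub_apply, Matrix.of_apply, x, y, Sum.elim_inl, Matrix.fromBlocks_apply₁₁,
        inner_smul_right, inner_dualVec_cutVec, Matrix.smul_apply, Matrix.one_apply, Sum.inl.injEq,
        smul_eq_mul]
      split_ifs <;> ring
    · simp only [Matrix.sub_apply, Matrix.of_apply, x, y, Sum.elim_inl, Sum.elim_inr,
        Matrix.fromBlocks_apply₁₂, inner_neg_right, inner_smul_right, inner_dualVec,
        Matrix.smul_apply, smul_eq_mul, Matrix.mul_apply, Matrix.conjTranspose_apply, crossMatrix]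
      rw [Matrix.one_apply_ne (by simp)]
      simp only [zero_sub, neg_neg]
      congr 1
      refine Finset.sum_congr rfl fun k _ => ?_
      rw [← inner_conj_symm]
      rfl
    · simp only [Matrix.sub_apply, Matrix.of_apply, x, y, Sum.elim_inl, Sum.elim_inr,
        Matrix.fromBlocks_apply₂₁, inner_smul_right, Matrix.neg_apply, Matrix.smul_apply,
        smul_eq_mul, crossMatrix]
      rw [Matrix.one_apply_ne (by simp), zero_sub]
    · simp only [Matrix.sub_apply, Matrix.of_apply, x, y, Sum.elim_inr, Matrix.fromBlocks_apply₂₂,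
        inner_neg_right, inner_smul_right, hrange, Matrix.smul_apply, Matrix.one_apply,
        Sum.inr.injEq, smul_eq_mul]
      split_ifs <;> ring
  rw [hblock]
  have hdet := det_fromBlocks_projections _ (det_gram_cutVec_ne_zero u M) (crossMatrix u n M) c hc
  -- The blocks have sizes `M` and `M + n`; cancelling `(1 + c) ^ M` leaves `(1 + c) ^ n`.
  rw [Fintype.card_fin, Fintype.card_fin, pow_add, mul_assoc] at hdet
  exact (mul_left_cancel₀ (pow_ne_zero _ hc) hdet).symm

/-! ### The Gram matrices as weighted sums -/

/-- Counting powers and vectors downwards from `M - 1` turns the Laurent coefficients into entries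
`powFact` with indices starting at zero. -/
theorem inner_cutVec (l : Fin M) (y : ℕ) :
    inner ℂ (fBasis ((M : ℤ) - 1 - y)) (cutVec u M l) = (powFact (-u) y (Fin.rev l) : ℂ) := by
  have h := inner_fBasis_mulOp_fexp (-u) ((M : ℤ) - 1) y (Fin.rev l)
  have hl : (M : ℤ) - 1 - ((Fin.rev l : Fin M) : ℕ) = (l : ℕ) := by
    rw [Fin.val_rev]
    have := l.2
    omega
  rw [hl] at h
  exact h

theorem inner_cutVec_cutVec (l k : Fin M) : inner ℂ (cutVec u M l) (cutVec u M k) =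
    ((∑' y, powFact (-u) y (Fin.rev l) * powFact (-u) y (Fin.rev k) : ℝ) : ℂ) := by
  have h := hasSum_powFact_smul (-u) ((M : ℤ) - 1) (Fin.rev k)
  have hl : (M : ℤ) - 1 - ((Fin.rev k : Fin M) : ℕ) = (k : ℕ) := by
    rw [Fin.val_rev]
    have := k.2
    omega
  rw [hl] at h
  have h1 := h.mapL (innerSL ℂ (cutVec u M l))
  rw [Complex.ofReal_tsum]
  refine (HasSum.tsum_eq ?_).symm
  refine h1.congr_fun fun y => ?_
  rw [innerSL_apply_apply, inner_smul_right, ← inner_conj_symm, inner_cutVec, Complex.conj_ofReal]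
  push_cast
  ring

/-- The powers `z^k`, `-n ≤ k < M`, are `z^(M-1-y)` with `y < M + n`: the Gram sum is cut off at `M
+ n`. -/
theorem crossMatrix_mul (l k : Fin M) :
    ((crossMatrix u n M).conjTranspose * crossMatrix u n M) l k =
      ((∑ y ∈ Finset.range (M + n), powFact (-u) y (Fin.rev l) * powFact (-u) y (Fin.rev k) : ℝ)
        : ℂ) := by
  have hr : ∀ (r : Fin (M + n)) (l : Fin M),
      crossMatrix u n M r l = (powFact (-u) (Fin.rev r) (Fin.rev l) : ℂ) := fun r l => by
    rw [← inner_cutVec, crossMatrix, Matrix.of_apply, rangeVec]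
    congr 2
    rw [Fin.val_rev]
    have := r.2
    omega
  rw [Matrix.mul_apply, Complex.ofReal_sum,
    ← Fin.sum_univ_eq_sum_range (fun y => ((powFact (-u) y (Fin.rev l) *
      powFact (-u) y (Fin.rev k) : ℝ) : ℂ)), ← Equiv.sum_comp Fin.revPerm]
  refine Finset.sum_congr rfl fun r _ => ?_
  simp only [Matrix.conjTranspose_apply, hr, Fin.revPerm_apply, Fin.rev_rev]
  simp

/-- The weight is `1 - t` plus `t` times the indicator of `y < M + n`, matching `(1 - c²) T + c² C*
C` at `c² = t`. -/
theorem tsum_tailWeight_eq {t : ℝ} (ht : |1 - t| ≤ 1) (v : ℝ) (i j : ℕ) :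
    ∑' y, tailWeight M n t y * powFact v y i * powFact v y j =
      (1 - t) * ∑' y, powFact v y i * powFact v y j +
        t * ∑ y ∈ Finset.range (M + n), powFact v y i * powFact v y j := by
  have h0 : Summable fun y => powFact v y i * powFact v y j := by
    simpa [tailWeight] using summable_tailWeight_mul (M := M) (n := n) (t := 0) (by simp) v i j
  have h1 : ∑' y, tailWeight M n t y * powFact v y i * powFact v y j -
      (1 - t) * ∑' y, powFact v y i * powFact v y j =
      ∑' y, (if y < M + n then t * (powFact v y i * powFact v y j) else 0) := by
    rw [← tsum_mul_left, ← (summable_tailWeight_mul ht v i j).tsum_sub (h0.mul_left _)]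
    refine tsum_congr fun y => ?_
    unfold tailWeight
    by_cases h : M + n ≤ y
    · rw [if_pos h, if_neg (by omega)]
      ring
    · rw [if_neg h, if_pos (by omega)]
      ring
  rw [tsum_eq_sum (s := Finset.range (M + n)) (fun y hy => if_neg (by simpa using hy))] at h1
  rw [Finset.mul_sum, ← sub_eq_iff_eq_add', h1]
  refine Finset.sum_congr rfl fun y hy => if_pos (by simpa using hy)

theorem det_gram_add_crossMatrix {t : ℝ} (ht : |1 - t| ≤ 1) :
    ((1 - (t : ℂ)) • Matrix.gram ℂ (cutVec u M) +
      (t : ℂ) • ((crossMatrix u n M).conjTranspose * crossMatrix u n M)).det =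
      (weightedDet M n t (-u) : ℂ) := by
  have h : ((1 - (t : ℂ)) • Matrix.gram ℂ (cutVec u M) +
      (t : ℂ) • ((crossMatrix u n M).conjTranspose * crossMatrix u n M)) =
      (((Matrix.of fun i j : Fin M =>
        ∑' y, tailWeight M n t y * powFact (-u) y i * powFact (-u) y j).map
          Complex.ofRealHom).submatrix Fin.revPerm Fin.revPerm) := by
    ext l k
    rw [Matrix.submatrix_apply, Matrix.map_apply, Matrix.of_apply, tsum_tailWeight_eq n M ht,
      Matrix.add_apply, Matrix.smul_apply, Matrix.smul_apply, crossMatrix_mul, Matrix.gram_apply,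
      inner_cutVec_cutVec]
    simp only [Fin.revPerm_apply, smul_eq_mul, Complex.ofRealHom_eq_coe]
    push_cast
    rfl
  rw [h, Matrix.det_submatrix_equiv_self, ← RingHom.mapMatrix_apply, ← RingHom.map_det]
  rfl

/-- The Fredholm determinants of the finite rank approximations as weighted determinants. -/
theorem hasFredholmDet_cutDiff_weightedDet {t : ℝ} (ht0 : 0 ≤ t) (ht : |1 - t| ≤ 1) :
    HasFredholmDet ((Real.sqrt t : ℂ) • cutDiff u n M) ((1 + (Real.sqrt t : ℂ)) ^ n *
      ((weightedDet M n t (-u) / weightedDet M n 0 (-u) : ℝ) : ℂ)) := by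
  have hc : 1 + (Real.sqrt t : ℂ) ≠ 0 := by
    have : (0 : ℝ) < 1 + Real.sqrt t := by positivity
    exact_mod_cast this.ne'
  have h := hasFredholmDet_cutDiff u n M _ hc
  have hsq : (Real.sqrt t : ℂ) ^ 2 = t := by exact_mod_cast Real.sq_sqrt ht0
  have h0 := det_gram_add_crossMatrix u n M (t := 0) (by simp)
  rw [Complex.ofReal_zero, sub_zero, one_smul, zero_smul, add_zero] at h0
  rw [hsq, det_gram_add_crossMatrix u n M ht, h0] at h
  push_cast
  exact h

end PlancherelRows

end

noncomputable section

namespace PlancherelRows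

open MeasureTheory Filter Topology

/-! ### Integral operators with separated kernels -/

/-- An operator with an absolutely convergent expansion into rank one operators of continuous
functions is the integral operator whose kernel is the sum of the expansion off the diagonal. -/
theorem isIntegralOperator_of_hasSum {I : Type*} [Countable I] {X Y : I → C(Angle, ℂ)}
    {k : ℂ → ℂ → ℂ} {K : L2Circle →L[ℂ] L2Circle} (hs : Summable fun i => ‖X i‖ * ‖Y i‖)
    (hK : ∀ v, HasSum (fun i => inner ℂ (toL2 (Y i)) v • toL2 (X i)) (K v))
    (hk : ∀ θ η : Angle, θ ≠ η → HasSum (fun i => X i θ * (starRingEnd ℂ) (Y i η))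
      (k (pt θ) (pt η) * (Complex.I * pt η))) : IsIntegralOperator k K := by
  intro f
  have hsum : Summable fun i => inner ℂ (toL2 (Y i)) f • X i := by
    refine Summable.of_norm_bounded (hs.mul_left (‖toL2‖ * ‖f‖)) fun i => ?_
    rw [norm_smul]
    have h1 : ‖inner ℂ (toL2 (Y i)) f‖ ≤ ‖toL2‖ * ‖Y i‖ * ‖f‖ :=
      (norm_inner_le_norm _ _).trans
        (mul_le_mul_of_nonneg_right (toL2.le_opNorm _) (norm_nonneg _))
    calc _ ≤ ‖toL2‖ * ‖Y i‖ * ‖f‖ * ‖X i‖ := mul_le_mul_of_nonneg_right h1 (norm_nonneg _)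
      _ = _ := by ring
  -- The series converges in the sup norm, so `K f` has a continuous representative that can be
  -- evaluated pointwise.
  set G : C(Angle, ℂ) := ∑' i, inner ℂ (toL2 (Y i)) f • X i with hG
  have hKG : K f = toL2 G := by
    refine (hK f).unique ((hsum.hasSum.mapL toL2).congr_fun fun i => ?_)
    rw [map_smul]
  have hf : Integrable f volume := (Lp.memLp f).integrable (by norm_num)
  rw [hKG]
  filter_upwards [ContinuousMap.coeFn_toLp (p := 2) (𝕜 := ℂ) volume G] with θ hθ
  rw [hθ]
  have h1 : HasSum (fun i => inner ℂ (toL2 (Y i)) f * X i θ) (G θ) :=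
    hsum.hasSum.mapL (ContinuousMap.evalCLM ℂ θ)
  have hint : ∀ i, Integrable (fun η => X i θ * (starRingEnd ℂ) (Y i η) * f η) volume := fun i => by
    refine hf.bdd_mul (c := ‖X i‖ * ‖Y i‖) ?_ (ae_of_all _ fun η => ?_)
    · exact Continuous.aestronglyMeasurable (by fun_prop)
    · rw [norm_mul, RCLike.norm_conj]
      exact mul_le_mul ((X i).norm_coe_le_norm θ) ((Y i).norm_coe_le_norm η) (norm_nonneg _)
        (norm_nonneg _)
  have h2 : ∀ i, inner ℂ (toL2 (Y i)) f * X i θ =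
      ∫ η, X i θ * (starRingEnd ℂ) (Y i η) * f η := fun i => by
    rw [L2.inner_def, ← integral_mul_const]
    refine integral_congr_ae ?_
    filter_upwards [ContinuousMap.coeFn_toLp (p := 2) (𝕜 := ℂ) volume (Y i)] with η hη
    rw [hη, RCLike.inner_apply]
    ring
  have h3 := hasSum_integral_of_summable_integral_norm hint (by
    refine Summable.of_nonneg_of_le (fun i => by positivity) (fun i => ?_)
      (hs.mul_right (∫ η, ‖f η‖))
    rw [← integral_const_mul]
    refine integral_mono (hint i).norm (hf.norm.const_mul _) fun η => ?_
    simp only [norm_mul, RCLike.norm_conj]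
    exact mul_le_mul_of_nonneg_right (mul_le_mul ((X i).norm_coe_le_norm θ)
      ((Y i).norm_coe_le_norm η) (norm_nonneg _) (norm_nonneg _)) (norm_nonneg _))
  simp_rw [← h2] at h3
  rw [h1.unique h3]
  refine integral_congr_ae ?_
  -- For fixed `θ` the diagonal is a single point of measure zero, so the kernel is needed off the
  -- diagonal only.
  have hne : ∀ᵐ η : Angle, η ≠ θ := by
    have h0 : volume ({θ} : Set Angle) = 0 := by
      rw [← Metric.closedBall_zero, AddCircle.volume_closedBall]
      simp [Real.pi_pos.le]
    exact measure_eq_zero_iff_ae_notMem.1 h0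
  filter_upwards [hne] with η hη
  rw [tsum_mul_right, (hk θ η hη.symm).tsum_eq]
  ring

theorem fourier_eq_pt_zpow (k : ℤ) (θ : Angle) : fourier k θ = pt θ ^ k := by
  rw [fourier_apply, AddCircle.toCircle_zsmul, pt, Circle.coe_zpow]

theorem norm_pt (θ : Angle) : ‖pt θ‖ = 1 := Circle.norm_coe _

theorem pt_ne_zero (θ : Angle) : pt θ ≠ 0 := Circle.coe_ne_zero _

theorem pt_injective : Function.Injective pt := fun _ _ h =>
  AddCircle.injective_toCircle Real.two_pi_pos.ne' (Subtype.ext h)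

theorem conj_pt (θ : Angle) : (starRingEnd ℂ) (pt θ) = (pt θ)⁻¹ :=
  (Circle.coe_inv_eq_conj _).symm

theorem sum_antidiagonal_pow_mul {x y : ℂ} (hxy : x ≠ y) (m : ℕ) :
    ∑ p ∈ Finset.HasAntidiagonal.antidiagonal m, x ^ p.2 * y ^ p.1 =
      (x ^ (m + 1) - y ^ (m + 1)) / (x - y) := by
  rw [eq_div_iff (sub_ne_zero.2 hxy), ← (Commute.all x y).geom_sum₂_mul,
    Finset.Nat.sum_antidiagonal_eq_sum_range_succ (fun a b => x ^ b * y ^ a),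
    ← Finset.sum_range_reflect]
  congr 1
  refine Finset.sum_congr rfl fun i hi => ?_
  have : i < m + 1 := Finset.mem_range.1 hi
  congr 2
  omega

/-- The divided difference of the exponential function as a double series. -/
theorem hasSum_expCoeff_mul_pow (v : ℝ) {x y : ℂ} (hx : ‖x‖ = 1) (hy : ‖y‖ = 1) (hxy : x ≠ y) :
    HasSum (fun p : ℕ × ℕ => expCoeff v (p.1 + p.2 + 1) * (x ^ p.2 * y ^ p.1))
      ((Complex.exp (v * x) - Complex.exp (v * y)) / (x - y)) := by
  have hs : Summable fun p : ℕ × ℕ => expCoeff v (p.1 + p.2 + 1) * (x ^ p.2 * y ^ p.1) := by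
    refine Summable.of_norm ((summable_expCoeff v).congr fun p => ?_)
    simp [hx, hy]
  have hexp : ∀ a : ℂ, HasSum (fun m => expCoeff v m * a ^ m) (Complex.exp (v * a)) := fun a => by
    rw [Complex.exp_eq_exp_ℂ]
    refine (NormedSpace.expSeries_div_hasSum_exp (v * a : ℂ)).congr_fun fun m => ?_
    rw [expCoeff]
    push_cast
    ring
  have h1 : HasSum (fun m => expCoeff v (m + 1) * ((x ^ (m + 1) - y ^ (m + 1)) / (x - y)))
      ((Complex.exp (v * x) - Complex.exp (v * y)) / (x - y)) := by
    have h2 := ((hexp x).sub (hexp y)).div_const (x - y)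
    rw [← hasSum_nat_add_iff' 1] at h2
    simp only [Finset.range_one, Finset.sum_singleton, pow_zero, sub_self, zero_div, sub_zero]
      at h2
    refine h2.congr_fun fun m => ?_
    ring
  -- Absolute convergence permits summing along `p.1 + p.2 = m`, where the monomials add up to `(x ^
  -- (m + 1) - y ^ (m + 1)) / (x - y)`.
  have h3 := (Finset.HasAntidiagonal.sigmaAntidiagonalEquivProd.hasSum_iff.2 hs.hasSum).sigma
    (fun m => hasSum_fintype _)
  have h4 := h3.unique (h1.congr_fun fun m => ?_)
  · rw [← h4]
    exact hs.hasSum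
  · rw [← sum_antidiagonal_pow_mul hxy, Finset.mul_sum,
      ← Finset.sum_coe_sort (Finset.HasAntidiagonal.antidiagonal m)]
    refine Finset.sum_congr rfl fun p _ => ?_
    have : p.1.1 + p.1.2 = m := Finset.HasAntidiagonal.mem_antidiagonal.1 p.2
    simp [Finset.HasAntidiagonal.sigmaAntidiagonalEquivProd, this]

end PlancherelRows

end

noncomputable section

namespace PlancherelRows

open MeasureTheory Filter Topology

/-! ### The operator as a difference of projections -/

variable (u : ℝ) (n : ℕ)

/-- The orthogonal projection onto the closed span of `z^j`, `j ≥ 0`. -/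
abbrev posProj : L2Circle →L[ℂ] L2Circle := fullProj 0

theorem mulOp_fexp_zero (σ : ℤ) (f : L2Circle) : mulOp (fexp σ 0) f = f := by
  have h : fexp σ 0 = 1 := by
    ext θ
    simp [fexp_apply]
  rw [h, mulOp_one]

theorem posProj_natCast (j : ℕ) : posProj (fBasis j) = fBasis j := by
  have h := (isCut_fullProj 0).fix j (Set.mem_univ j)
  rwa [psiOp, neg_zero, mulOp_fexp_zero] at h

theorem posProj_negSucc (j : ℕ) : posProj (fBasis (-1 - j)) = 0 := by
  have h := (isCut_fullProj 0).kill j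
  rwa [chiOp, mulOp_fexp_zero] at h

/-- The projection onto the closed span of `exp (-u / z) z^j`, `j ≥ 0`, minus the projection onto
the closed span of `z^k`, `k ≥ -n`. -/
def fullDiff : L2Circle →L[ℂ] L2Circle :=
  fullProj u - posProj - ∑ r : Fin n, InnerProductSpace.rankOne ℂ
    (fBasis (-1 - (r : ℕ))) (fBasis (-1 - (r : ℕ)))

theorem fullDiff_apply (x : L2Circle) : fullDiff u n x = fullProj u x - posProj x -
    ∑ r : Fin n, inner ℂ (fBasis (-1 - (r : ℕ))) x • fBasis (-1 - (r : ℕ)) := by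
  simp [fullDiff]

theorem hasSum_nuclear_fullDiff (x : L2Circle) :
    HasSum (fun i => inner ℂ (nucRight u n Set.univ i) x • nucLeft u n (fullProj u) i)
      (fullDiff u n x) := by
  refine (isCut_fullProj u).hasSum_nuclear (fun j => ?_) (fun j _ => ?_)
    (fun j hj => (hj trivial).elim) x
  · rw [fullDiff_apply, posProj_negSucc, sub_zero]
    congr 1
    simp only [inner_fBasis]
    split_ifs with h
    · rw [Finset.sum_eq_single ⟨j, h⟩]
      · simp
      · intro r _ hr
        rw [if_neg (fun h' => hr (Fin.ext (by simp only; omega))), zero_smul]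
      · simp
    · refine Finset.sum_eq_zero fun r _ => ?_
      have := r.2
      rw [if_neg (by omega), zero_smul]
  · rw [fullDiff_apply, posProj_natCast, Finset.sum_eq_zero, sub_zero]
    intro r _
    rw [inner_fBasis, if_neg (by omega), zero_smul]

theorem isTraceClass_fullDiff : IsTraceClass (fullDiff u n) :=
  isTraceClass_of_nuclear (summable_nuc (isCut_fullProj u)) (hasSum_nuclear_fullDiff u n)

theorem hasFredholmDet_smul_of_nuclear {T : L2Circle →L[ℂ] L2Circle} {x y : NucIndex n → L2Circle}
    (hs : Summable fun i => ‖x i‖ * ‖y i‖) (hT : ∀ v, HasSum (fun i => inner ℂ (y i) v • x i) (T v))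
    (c : ℂ) : HasFredholmDet (c • T) (minorSum fun i j => inner ℂ (y i) (c • x j)) := by
  refine hasFredholmDet_of_nuclear (x := fun i => c • x i) ?_ fun v => ?_
  · refine (hs.mul_left ‖c‖).congr fun i => ?_
    rw [norm_smul, mul_assoc]
  · refine ((hT v).const_smul c).congr_fun fun i => ?_
    rw [smul_comm]

theorem hasFredholmDet_fullDiff (c : ℂ) : HasFredholmDet (c • fullDiff u n)
    (minorSum fun i j => inner ℂ (nucRight u n Set.univ i) (c • nucLeft u n (fullProj u) j)) :=
  hasFredholmDet_smul_of_nuclear n (summable_nuc (isCut_fullProj u)) (hasSum_nuclear_fullDiff u n) c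

/-- The Fredholm determinant of the operator in terms of the Plancherel generating function. -/
theorem fredholmDet_fullDiff {t lam : ℝ} (hu : u ^ 2 = lam) (ht0 : 0 ≤ t) (ht : |1 - t| ≤ 1) :
    fredholmDet ((Real.sqrt t : ℂ) • fullDiff u n) =
      (1 + (Real.sqrt t : ℂ)) ^ n * (poissonGen n lam t : ℂ) := by
  rw [(hasFredholmDet_fullDiff u n _).fredholmDet_eq fBasis]
  -- The minor sums of the cuts are also ratios of weighted determinants: both are Fredholm
  -- determinants of the same finite rank operator, from its two nuclear representations.
  refine tendsto_nhds_unique (tendsto_minorSum_cut u n (Real.sqrt t : ℂ)) ?_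
  have h1 := tendsto_weightedDet_ratio (n := n) ht (v := -u) (lam := lam) (by rw [neg_sq, hu])
  have h2 := ((Complex.continuous_ofReal.tendsto _).comp h1).const_mul
    ((1 + (Real.sqrt t : ℂ)) ^ n)
  refine h2.congr fun M => ?_
  refine (hasFredholmDet_cutDiff_weightedDet u n M ht0 ht).unique fBasis ?_
  exact hasFredholmDet_smul_of_nuclear n (summable_nuc (isCut_cutProj u M))
    (hasSum_nuclear_cutDiff u n M) _

/-! ### The kernel of the operator -/

theorem psiOp_chiOp_comm (x : L2Circle) : psiOp u (chiOp u x) = chiOp u (psiOp u x) := by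
  rw [mulOp_mulOp, mulOp_mulOp, mul_comm (fexp 1 u)]

/-- `exp (u z) z^j` has only nonnegative powers, so `φ z^j` lies in the range of `fullProj u`.
Together with the next lemma this says that `fullProj u` is `posProj` conjugated by `φ`. -/
theorem fullProj_symbol_natCast (j : ℕ) :
    fullProj u (chiOp u (psiOp u (fBasis j))) = chiOp u (psiOp u (fBasis j)) := by
  rw [← psiOp_chiOp_comm]
  have h := (hasSum_mulOp_fexp 1 u j).mapL (psiOp u)
  refine (h.mapL (fullProj u)).unique (h.congr_fun fun m => ?_)
  rw [map_smul, map_smul, show (j : ℤ) + m * 1 = ((j + m : ℕ) : ℤ) by push_cast; ring,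
    (isCut_fullProj u).fix _ trivial]

/-- `exp (-u / z) z^(-1-j)` has only negative powers, and `fullProj u` kills `exp (u z)` times each
of them. -/
theorem fullProj_symbol_negSucc (j : ℕ) :
    fullProj u (chiOp u (psiOp u (fBasis (-1 - j)))) = 0 := by
  have h := ((hasSum_mulOp_fexp (-1) (-u) (-1 - j)).mapL (chiOp u)).mapL (fullProj u)
  refine h.unique (hasSum_zero.congr_fun fun m => ?_)
  rw [map_smul, map_smul, show (-1 - (j : ℤ)) + m * -1 = -1 - ((j + m : ℕ) : ℤ) by push_cast; ring,
    (isCut_fullProj u).kill, smul_zero]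

theorem injective_add_add_one (j : ℕ) : Function.Injective fun l : ℕ => j + l + 1 :=
  fun a b h => by simpa using h

theorem le_of_notMem_range {j m : ℕ} (hm : m ∉ Set.range fun l : ℕ => j + l + 1) : m ≤ j := by
  by_contra! hlt
  exact hm ⟨m - j - 1, by simp only; omega⟩

/-- The Hankel part of multiplication by `exp (-u / z)`. -/
theorem hasSum_sub_posProj_psiOp (j : ℕ) :
    HasSum (fun l : ℕ => expCoeff (-u) (j + l + 1) • fBasis (-1 - l))
      (psiOp u (fBasis j) - posProj (psiOp u (fBasis j))) := by
  have h1 := hasSum_mulOp_fexp (-1) (-u) j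
  have h := h1.sub (h1.mapL posProj)
  rw [← (injective_add_add_one j).hasSum_iff] at h
  · refine h.congr_fun fun l => ?_
    rw [Function.comp_apply, map_smul,
      show (j : ℤ) + (j + l + 1 : ℕ) * -1 = -1 - l by push_cast; ring, posProj_negSucc, smul_zero,
      sub_zero]
  · intro m hm
    have hle := le_of_notMem_range hm
    rw [map_smul, show ((j : ℤ) + m * -1) = ((j - m : ℕ) : ℤ) by omega, posProj_natCast, sub_self]

/-- The Hankel part of multiplication by `exp (u z)`. -/
theorem hasSum_posProj_chiOp (j : ℕ) :
    HasSum (fun l : ℕ => expCoeff u (j + l + 1) • fBasis l)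
      (posProj (chiOp u (fBasis (-1 - j)))) := by
  have h := (hasSum_mulOp_fexp 1 u (-1 - j)).mapL posProj
  rw [← (injective_add_add_one j).hasSum_iff] at h
  · refine h.congr_fun fun l => ?_
    rw [Function.comp_apply, map_smul,
      show (-1 - (j : ℤ)) + (j + l + 1 : ℕ) * 1 = l by push_cast; ring, posProj_natCast]
  · intro m hm
    have hle := le_of_notMem_range hm
    rw [map_smul, show ((-1 - (j : ℤ)) + m * 1) = -1 - ((j - m : ℕ) : ℤ) by omega, posProj_negSucc,
      smul_zero]

theorem posProj_chiOp_natCast (j : ℕ) : posProj (chiOp u (fBasis j)) = chiOp u (fBasis j) := by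
  have h := hasSum_mulOp_fexp 1 u j
  refine (h.mapL posProj).unique (h.congr_fun fun m => ?_)
  rw [map_smul, show (j : ℤ) + m * 1 = ((j + m : ℕ) : ℤ) by push_cast; ring, posProj_natCast]

theorem posProj_psiOp_negSucc (j : ℕ) : posProj (psiOp u (fBasis (-1 - j))) = 0 := by
  have h := (hasSum_mulOp_fexp (-1) (-u) (-1 - j)).mapL posProj
  refine h.unique (hasSum_zero.congr_fun fun m => ?_)
  rw [map_smul, show (-1 - (j : ℤ)) + m * -1 = -1 - ((j + m : ℕ) : ℤ) by push_cast; ring,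
    posProj_negSucc, smul_zero]

/-- Conjugation of `posProj` by multiplication by `exp (u z)`. -/
def midProj : L2Circle →L[ℂ] L2Circle := (chiOp u).comp (posProj.comp (mulOp (fexp 1 (-u))))

/-- Composed with multiplication by `φ`, the difference vanishes on negative powers and maps `z^j`
to `exp (u z)` times the negative part of `exp (-u / z) z^j`. Undoing the composition moves `φ` to
the right-hand vectors, its inverse being its adjoint. -/
theorem hasSum_fullProj_sub_midProj (v : L2Circle) :
    HasSum (fun p : ℕ × ℕ => inner ℂ
        (expCoeff (-u) (p.1 + p.2 + 1) • chiOp u (psiOp u (fBasis p.1))) v •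
          chiOp u (fBasis (-1 - p.2)))
      (fullProj u v - midProj u v) := by
  have hs : Summable fun p : ℕ × ℕ => ‖chiOp u (fBasis (-1 - p.2))‖ *
      ‖expCoeff (-u) (p.1 + p.2 + 1) • fBasis (p.1 : ℤ)‖ := by
    refine Summable.of_nonneg_of_le (fun _ => by positivity) (fun p => ?_)
      ((summable_expCoeff (-u)).mul_left ‖chiOp u‖)
    rw [norm_smul, norm_fBasis, mul_one]
    refine mul_le_mul_of_nonneg_right ?_ (norm_nonneg _)
    refine ((chiOp u).le_opNorm _).trans ?_
    rw [norm_fBasis, mul_one]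
  have h := hasSum_nuclear_of_basis fBasis
    (T := (fullProj u - midProj u).comp ((chiOp u).comp (psiOp u))) hs (fun k => ?_)
    (mulOp (fexp (-1) u) (mulOp (fexp 1 (-u)) v))
  · simp only [ContinuousLinearMap.comp_apply, mulOp_fexp_mulOp_fexp_neg,
      mulOp_fexp_neg_mulOp_fexp, sub_apply] at h
    refine h.congr_fun fun p => ?_
    congr 1
    rw [inner_smul_left, inner_smul_left, inner_mulOp_left, inner_mulOp_left, star_fexp, star_fexp,
      mulOp_mulOp, mulOp_mulOp,
      mul_comm (fexp (-1) u), neg_neg]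
  · simp only [ContinuousLinearMap.comp_apply, sub_apply, midProj,
      mulOp_fexp_neg_mulOp_fexp]
    rcases lt_or_ge k 0 with hk | hk
    · obtain ⟨j₀, rfl⟩ : ∃ j₀ : ℕ, k = -1 - j₀ := ⟨(-1 - k).toNat, by omega⟩
      rw [fullProj_symbol_negSucc, posProj_psiOp_negSucc, map_zero, sub_zero]
      refine hasSum_zero.congr_fun fun p => ?_
      rw [inner_smul_left, inner_fBasis, if_neg (by omega), mul_zero, zero_smul]
    · obtain ⟨j₀, rfl⟩ : ∃ j₀ : ℕ, k = j₀ := ⟨k.toNat, by omega⟩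
      rw [fullProj_symbol_natCast, ← map_sub]
      refine hasSum_prod_of_fst_eq j₀ (fun j l hjl => ?_) ?_
      · rw [inner_smul_left, inner_fBasis, if_neg (by omega), mul_zero, zero_smul]
      · refine ((hasSum_sub_posProj_psiOp u j₀).mapL (chiOp u)).congr_fun fun l => ?_
        rw [inner_smul_left, inner_fBasis, if_pos rfl, mul_one, expCoeff, Complex.conj_ofReal,
          map_smul]

/-- Composed with `exp (u z)`, the difference vanishes on nonnegative powers, which `exp (u z)`
preserves, and on negative powers is minus the nonnegative part of their image. -/
theorem hasSum_midProj_sub_posProj (v : L2Circle) :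
    HasSum (fun p : ℕ × ℕ => inner ℂ
        (expCoeff u (p.1 + p.2 + 1) • psiOp u (fBasis (-1 - p.1))) v • -fBasis p.2)
      (midProj u v - posProj v) := by
  have hs : Summable fun p : ℕ × ℕ => ‖-fBasis (p.2 : ℤ)‖ *
      ‖expCoeff u (p.1 + p.2 + 1) • fBasis (-1 - p.1)‖ := by
    refine (summable_expCoeff u).congr fun p => ?_
    rw [norm_smul, norm_neg, norm_fBasis, norm_fBasis, mul_one, one_mul]
  have h := hasSum_nuclear_of_basis fBasis
    (T := (midProj u - posProj).comp (chiOp u)) hs (fun k => ?_) (mulOp (fexp 1 (-u)) v)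
  · simp only [ContinuousLinearMap.comp_apply, mulOp_fexp_mulOp_fexp_neg,
      sub_apply] at h
    refine h.congr_fun fun p => ?_
    congr 1
    rw [inner_smul_left, inner_smul_left, inner_mulOp_left, star_fexp]
    rfl
  · simp only [ContinuousLinearMap.comp_apply, sub_apply, midProj,
      mulOp_fexp_neg_mulOp_fexp]
    rcases lt_or_ge k 0 with hk | hk
    · obtain ⟨j₀, rfl⟩ : ∃ j₀ : ℕ, k = -1 - j₀ := ⟨(-1 - k).toNat, by omega⟩
      rw [posProj_negSucc, map_zero, zero_sub]
      refine hasSum_prod_of_fst_eq j₀ (fun j l hjl => ?_) ?_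
      · rw [inner_smul_left, inner_fBasis, if_neg (by omega), mul_zero, zero_smul]
      · refine (hasSum_posProj_chiOp u j₀).neg.congr_fun fun l => ?_
        rw [inner_smul_left, inner_fBasis, if_pos rfl, mul_one, expCoeff, Complex.conj_ofReal,
          smul_neg]
    · obtain ⟨j₀, rfl⟩ : ∃ j₀ : ℕ, k = j₀ := ⟨k.toNat, by omega⟩
      rw [posProj_chiOp_natCast, posProj_natCast, sub_self]
      refine hasSum_zero.congr_fun fun p => ?_
      rw [inner_smul_left, inner_fBasis, if_neg (by omega), mul_zero, zero_smul]

/-- The left functions of the expansion of the kernel. -/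
def kerLeft : NucIndex n → C(Angle, ℂ)
  | Sum.inl (_, l) => fexp 1 u * monomial (-1 - l)
  | Sum.inr (Sum.inl (_, l)) => -monomial l
  | Sum.inr (Sum.inr r) => -monomial (-1 - (r : ℕ))

/-- The right functions of the expansion of the kernel. -/
def kerRight : NucIndex n → C(Angle, ℂ)
  | Sum.inl (j, l) => expCoeff (-u) (j + l + 1) • (fexp 1 u * (fexp (-1) (-u) * monomial j))
  | Sum.inr (Sum.inl (j, l)) => expCoeff u (j + l + 1) • (fexp (-1) (-u) * monomial (-1 - j))
  | Sum.inr (Sum.inr r) => monomial (-1 - (r : ℕ))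

theorem norm_monomial (k : ℤ) : ‖monomial k‖ = (Real.sqrt (2 * Real.pi))⁻¹ := by
  rw [monomial, norm_smul, fourier_norm, mul_one, norm_inv, Complex.norm_real, Real.norm_eq_abs,
    abs_of_nonneg (Real.sqrt_nonneg _)]

theorem summable_ker : Summable fun i => ‖kerLeft u n i‖ * ‖kerRight u n i‖ := by
  set s := (Real.sqrt (2 * Real.pi))⁻¹ with hs
  have hs0 : 0 ≤ s := by positivity
  have hmul : ∀ (g : C(Angle, ℂ)) (k : ℤ), ‖g * monomial k‖ ≤ ‖g‖ * s := fun g k => by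
    rw [hs, ← norm_monomial k]
    exact norm_mul_le _ _
  refine Summable.sum _ ?_ (Summable.sum _ ?_ Summable.of_finite)
  · refine Summable.of_nonneg_of_le (fun _ => mul_nonneg (norm_nonneg _) (norm_nonneg _))
      (fun p => ?_)
      ((summable_expCoeff (-u)).mul_left ((‖fexp 1 u‖ * s) * (‖fexp 1 u * fexp (-1) (-u)‖ * s)))
    simp only [Function.comp_apply, kerLeft, kerRight]
    rw [norm_smul, ← mul_assoc (fexp 1 u), mul_left_comm, mul_comm ‖expCoeff _ _‖]
    exact mul_le_mul_of_nonneg_right (mul_le_mul (hmul _ _) (hmul _ _) (by positivity)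
      (by positivity)) (norm_nonneg _)
  · refine Summable.of_nonneg_of_le (fun _ => mul_nonneg (norm_nonneg _) (norm_nonneg _))
      (fun p => ?_)
      ((summable_expCoeff u).mul_left (s * (‖fexp (-1) (-u)‖ * s)))
    simp only [Function.comp_apply, kerLeft, kerRight]
    rw [norm_smul, norm_neg, norm_monomial, mul_left_comm, mul_comm ‖expCoeff _ _‖]
    exact mul_le_mul_of_nonneg_right (mul_le_mul_of_nonneg_left (hmul _ _) (by positivity))
      (norm_nonneg _)

/-- Telescopes `fullProj u - posProj` through `midProj`. The vectors here are explicit continuous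
functions, whereas `nucLeft` contains images under a projection that are given only in `L²`. -/
theorem hasSum_ker_apply (v : L2Circle) :
    HasSum (fun i => inner ℂ (toL2 (kerRight u n i)) v • toL2 (kerLeft u n i))
      (fullDiff u n v) := by
  have h1 := hasSum_fullProj_sub_midProj u v
  have h2 := hasSum_midProj_sub_posProj u v
  have h3 := hasSum_fintype fun r : Fin n =>
    inner ℂ (fBasis (-1 - (r : ℕ))) v • -fBasis (-1 - (r : ℕ))
  have h := HasSum.sum (f := fun i => inner ℂ (toL2 (kerRight u n i)) v • toL2 (kerLeft u n i))
    (h1.congr_fun fun p => ?_) (HasSum.sum (h2.congr_fun fun p => ?_) (h3.congr_fun fun r => ?_))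
  · rw [fullDiff_apply]
    convert h using 1
    simp only [smul_neg, Finset.sum_neg_distrib]
    abel
  · simp only [Function.comp_apply, kerLeft, kerRight, map_smul, ← mulOp_toL2, ← fBasis_apply]
  · simp only [Function.comp_apply, kerLeft, kerRight, map_smul, map_neg, ← mulOp_toL2,
      ← fBasis_apply]
  · simp only [Function.comp_apply, kerLeft, kerRight, map_neg, ← fBasis_apply]

theorem conj_fexp (σ : ℤ) (v : ℝ) (η : Angle) :
    (starRingEnd ℂ) (fexp σ v η) = Complex.exp (v * pt η ^ (-σ)) := by
  rw [← fourier_eq_pt_zpow, ← fexp_apply, ← star_fexp]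
  rfl

theorem monomial_apply (k : ℤ) (θ : Angle) :
    monomial k θ = ((Real.sqrt (2 * Real.pi))⁻¹ : ℂ) * pt θ ^ k := by
  rw [monomial, ContinuousMap.smul_apply, fourier_eq_pt_zpow, smul_eq_mul]

theorem conj_monomial (k : ℤ) (η : Angle) :
    (starRingEnd ℂ) (monomial k η) = ((Real.sqrt (2 * Real.pi))⁻¹ : ℂ) * pt η ^ (-k) := by
  rw [monomial_apply, map_mul, map_inv₀, Complex.conj_ofReal, map_zpow₀, conj_pt, inv_zpow',
    zpow_neg]

theorem sum_div_pow_succ {z w : ℂ} (hz : z ≠ 0) (hzw : z ≠ w) (n : ℕ) :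
    ∑ r ∈ Finset.range n, (w / z) ^ (r + 1) = w * ((w / z) ^ n - 1) / (w - z) := by
  have hq : w / z ≠ 1 := fun h => hzw ((div_eq_one_iff_eq hz).1 h).symm
  have hwz : w - z ≠ 0 := sub_ne_zero.2 hzw.symm
  have hq' : w / z - 1 = (w - z) / z := by field_simp
  simp_rw [pow_succ]
  rw [← Finset.sum_mul, geom_sum_eq hq, hq']
  field_simp

/-- The first two families are divided differences of the exponential, in `1/z, 1/w` and in `z, w`.
Their mixed terms `exp (u z) exp (-u w)` cancel, leaving a multiple of `1 - φ(z) / φ(w)`, and the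
geometric sum of the third family replaces `1` by `(w / z) ^ n`. -/
theorem hasSum_ker_pointwise {lam : ℝ} {θ η : Angle} (hne : θ ≠ η) :
    HasSum (fun i => kerLeft (Real.sqrt lam) n i θ *
        (starRingEnd ℂ) (kerRight (Real.sqrt lam) n i η))
      (kernel lam n (pt θ) (pt η) * (Complex.I * pt η)) := by
  set u := Real.sqrt lam with hu
  set s : ℂ := ((Real.sqrt (2 * Real.pi))⁻¹ : ℂ) with hsdef
  have hz := pt_ne_zero θ
  have hw := pt_ne_zero η
  have hzn := norm_pt θ
  have hwn := norm_pt η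
  have hzw : pt θ ≠ pt η := fun h => hne (pt_injective h)
  have hconj : ∀ (v : ℝ) (m : ℕ), (starRingEnd ℂ) (expCoeff v m) = expCoeff v m := fun v m =>
    Complex.conj_ofReal _
  have hpi : (Real.pi : ℂ) ≠ 0 := by exact_mod_cast Real.pi_ne_zero
  have hss : s * s = (2 * (Real.pi : ℂ))⁻¹ := by
    have := sqrt_two_pi_inv_mul_self
    rw [← hsdef] at this
    exact eq_inv_of_mul_eq_one_left this
  have h1 := (hasSum_expCoeff_mul_pow (-u) (x := (pt θ)⁻¹) (y := (pt η)⁻¹)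
    (by rw [norm_inv, hzn, inv_one]) (by rw [norm_inv, hwn, inv_one])
    (fun h => hzw (inv_injective h))).mul_left (Complex.exp (u * pt θ) *
      (Complex.exp (u * (pt η)⁻¹) * Complex.exp (-u * pt η)) * (pt θ)⁻¹ * (s * s))
  have h2 := (hasSum_expCoeff_mul_pow u hzn hwn hzw).mul_left
    (-(Complex.exp (-u * pt η) * pt η * (s * s)))
  have h3 := hasSum_fintype fun r : Fin n => -((s * s) * (pt η / pt θ) ^ ((r : ℕ) + 1))
  have h := HasSum.sum
    (f := fun i => kerLeft u n i θ * (starRingEnd ℂ) (kerRight u n i η))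
    (h1.congr_fun fun p => ?_) (HasSum.sum (h2.congr_fun fun p => ?_) (h3.congr_fun fun r => ?_))
  · convert h using 1
    rw [Finset.sum_neg_distrib, ← Finset.mul_sum,
      Fin.sum_univ_eq_sum_range (fun r => (pt η / pt θ) ^ (r + 1)), sum_div_pow_succ hz hzw, hss]
    have e1 : symbolFn lam (pt θ) =
        Complex.exp (u * pt θ) * Complex.exp ((-u : ℝ) * (pt θ)⁻¹) := by
      rw [symbolFn, ← Complex.exp_add]
      congr 1
      push_cast
      ring
    have e2 : symbolFn lam (pt η) =
        Complex.exp (u * pt η) * Complex.exp ((-u : ℝ) * (pt η)⁻¹) := by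
      rw [symbolFn, ← Complex.exp_add]
      congr 1
      push_cast
      ring
    have e3 : Complex.exp (u * (pt η)⁻¹) = (Complex.exp ((-u : ℝ) * (pt η)⁻¹))⁻¹ := by
      rw [← Complex.exp_neg]
      congr 1
      push_cast
      ring
    have e4 : Complex.exp (-u * pt η) = (Complex.exp (u * pt η))⁻¹ := by
      rw [← Complex.exp_neg]
      congr 1
      ring
    rw [kernel, e1, e2, e3, e4]
    have hA := Complex.exp_ne_zero (u * pt η)
    have hB := Complex.exp_ne_zero ((-u : ℝ) * (pt η)⁻¹)
    generalize Complex.exp (u * pt η) = A at *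
    generalize Complex.exp ((-u : ℝ) * (pt η)⁻¹) = B at *
    generalize Complex.exp (u * pt θ) = C
    generalize Complex.exp ((-u : ℝ) * (pt θ)⁻¹) = D
    generalize pt θ = z at *
    generalize pt η = w at *
    have hd : z - w ≠ 0 := sub_ne_zero.2 hzw
    have hd1 : w - z ≠ 0 := sub_ne_zero.2 hzw.symm
    have hd2 : z⁻¹ - w⁻¹ = (w - z) / (z * w) := by field_simp
    have hd3 : w - z = -(z - w) := by ring
    rw [hd2, hd3, div_pow, zpow_neg, zpow_natCast]
    have hI := Complex.I_ne_zero
    field_simp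
    ring
  · simp only [Function.comp_apply, kerLeft, kerRight, ContinuousMap.mul_apply,
      ContinuousMap.smul_apply, smul_eq_mul, map_mul, conj_fexp, conj_monomial, hconj]
    simp only [monomial_apply, fexp_apply, fourier_eq_pt_zpow, neg_neg, zpow_one, zpow_neg,
      zpow_natCast, Complex.ofReal_neg, ← hsdef]
    rw [zpow_sub₀ hz, zpow_natCast, zpow_neg_one, inv_pow, inv_pow]
    ring
  · simp only [Function.comp_apply, kerLeft, kerRight, ContinuousMap.mul_apply,
      ContinuousMap.smul_apply, ContinuousMap.neg_apply, smul_eq_mul, map_mul, conj_fexp,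
      conj_monomial, hconj]
    simp only [monomial_apply, neg_neg, zpow_one, zpow_natCast, neg_sub, sub_neg_eq_add,
      Complex.ofReal_neg, ← hsdef]
    rw [zpow_add₀ hw, zpow_natCast, zpow_one]
    ring
  · simp only [Function.comp_apply, kerLeft, kerRight, ContinuousMap.neg_apply, conj_monomial]
    simp only [monomial_apply, neg_sub, sub_neg_eq_add, ← hsdef]
    rw [zpow_add₀ hw, zpow_sub₀ hz, zpow_natCast, zpow_natCast, zpow_one, zpow_neg_one, pow_succ,
      div_pow]
    ring

theorem isIntegralOperator_fullDiff (lam : ℝ) :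
    IsIntegralOperator (kernel lam n) (fullDiff (Real.sqrt lam) n) :=
  isIntegralOperator_of_hasSum (summable_ker _ n) (hasSum_ker_apply _ n)
    fun _ _ h => hasSum_ker_pointwise n h

end PlancherelRows

end

/-! ### The theorem -/

theorem theorem1 (n : ℕ) (lam : ℝ) (hlam : 0 ≤ lam) :
    ∃ K : PlancherelRows.L2Circle →L[ℂ] PlancherelRows.L2Circle,
      PlancherelRows.IsIntegralOperator (PlancherelRows.kernel lam n) K ∧
      PlancherelRows.IsTraceClass K ∧
      (∀ c : ℂ, PlancherelRows.HasFredholmDet (c • K) (PlancherelRows.fredholmDet (c • K))) ∧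
      (PlancherelRows.poissonRow 1 n lam : ℂ) =
        (2 : ℂ) ^ (-(n : ℤ)) * PlancherelRows.fredholmDet K ∧
      DifferentiableAt ℝ
        (fun t : ℝ => (1 + (Real.sqrt t : ℂ)) ^ (-(n : ℤ)) *
          PlancherelRows.fredholmDet ((Real.sqrt t : ℂ) • K)) 1 ∧
      (PlancherelRows.poissonRow 2 (n + 1) lam : ℂ) =
        (PlancherelRows.poissonRow 1 n lam : ℂ) +
          -deriv (fun t : ℝ => (1 + (Real.sqrt t : ℂ)) ^ (-(n : ℤ)) *
            PlancherelRows.fredholmDet ((Real.sqrt t : ℂ) • K)) 1 := by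
  set K := PlancherelRows.fullDiff (Real.sqrt lam) n with hKdef
  have hK : ∀ t : ℝ, 0 ≤ t → |1 - t| ≤ 1 →
      (1 + (Real.sqrt t : ℂ)) ^ (-(n : ℤ)) *
        PlancherelRows.fredholmDet ((Real.sqrt t : ℂ) • K) =
          (PlancherelRows.poissonGen n lam t : ℂ) := fun t ht0 ht => by
    have hc : 1 + (Real.sqrt t : ℂ) ≠ 0 := by
      have : (0 : ℝ) < 1 + Real.sqrt t := by positivity
      exact_mod_cast this.ne'
    rw [hKdef, PlancherelRows.fredholmDet_fullDiff _ n (Real.sq_sqrt hlam) ht0 ht, zpow_neg,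
      zpow_natCast, inv_mul_cancel_left₀ (pow_ne_zero n hc)]
  have hderiv : HasDerivAt (fun t : ℝ => (1 + (Real.sqrt t : ℂ)) ^ (-(n : ℤ)) *
      PlancherelRows.fredholmDet ((Real.sqrt t : ℂ) • K))
      ((-(PlancherelRows.poissonRow 2 (n + 1) lam - PlancherelRows.poissonRow 1 n lam) : ℝ) : ℂ)
      1 := by
    -- The determinant formula is used for `0 < t < 2` only; this neighbourhood of `1` suffices to
    -- transfer the derivative.
    refine (PlancherelRows.hasDerivAt_poissonGen n hlam).ofReal_comp.congr_of_eventuallyEq ?_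
    filter_upwards [Ioo_mem_nhds (zero_lt_one (α := ℝ)) one_lt_two] with t ht
    exact hK t ht.1.le (abs_le.2 ⟨by linarith [ht.2], by linarith [ht.1]⟩)
  refine ⟨K, PlancherelRows.isIntegralOperator_fullDiff n lam,
    PlancherelRows.isTraceClass_fullDiff _ n,
    fun c => (PlancherelRows.hasFredholmDet_fullDiff _ n c).fredholmDet, ?_,
    hderiv.differentiableAt, ?_⟩
  · have h := hK 1 zero_le_one (by simp)
    rw [Real.sqrt_one, Complex.ofReal_one, one_smul, one_add_one_eq_two] at h
    rw [PlancherelRows.poissonRow_one_eq_poissonGen, h]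
  · rw [hderiv.deriv]
    push_cast
    ring
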